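/- Let $d,m\ge 1$ be integers, let $a\in L^2_{\mathrm{loc}}(\mathbb R^d;\mathbb R^d)$, and let $V:\mathbb R^d\to\mathbb R^{m\times m}$ be a matrix-valued function with entries in $L^1_{\mathrm{loc}}(\mathbb R^d)$ such that, for almost every $x$, the matrix $V(x)$ is symmetric and its smallest eigenvalue $\lambda_V(x)$ is nonnegative. Write $\nabla_a f=\nabla f-iaf$ (in the sense of distributions), and let $\langle\cdot,\cdot\rangle$ and $\|\cdot\|$ be the Euclidean inner product (linear in the first argument) and norm on $\mathbb C^k$. On $L^2(\mathbb R^d;\mathbb C^m)$ consider the sesquilinear form $$\mathfrak a(u,v)=\sum_{i=1}^m\int_{\mathbb R^d}\langle\nabla_a u_i,\nabla_a v_i\rangle\,dx+\int_{\mathbb R^d}\langle Vu,v\rangle\,dx,$$ $$D(\mathfrak a)=\{u\in L^2(\mathbb R^d;\mathbb C^m):\nabla_a u_i\in L^2(\mathbb R^d;\mathbb C^d)\ (1\le i\le m),\ V^{1/2}u\in L^2(\mathbb R^d;\mathbb C^m)\},$$ and on $L^2(\mathbb R^d;\mathbb C)$ the sesquilinear form $$\mathfrak h(u,v)=\int_{\mathbb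 R^d}\langle\nabla u,\nabla v\rangle\,dx+\int_{\mathbb R^d}\lambda_V u\overline v\,dx,\qquad D(\mathfrak h)=\{u\in H^1(\mathbb R^d;\mathbb C):\sqrt{\lambda_V}\,u\in L^2(\mathbb R^d;\mathbb C)\}.$$ Let $A$ be the operator associated with $\mathfrak a$: $u\in D(A)$ and $Au=f$ if and only if $u\in D(\mathfrak a)$, $f\in L^2(\mathbb R^d;\mathbb C^m)$ and $\mathfrak a(u,v)=\int_{\mathbb R^d}\langle f,v\rangle\,dx$ for all $v\in D(\mathfrak a)$. Let $H$ be the operator associated with $\mathfrak h$ in the same way. Then there are a unique strongly continuous semigroup $(e^{-tA})_{t\ge0}$ on $L^2(\mathbb R^d;\mathbb C^m)$ with generator $-A$ and a unique strongly continuous semigroup $(e^{-tH})_{t\ge0}$ on $L^2(\mathbb R^d;\mathbb C)$ with generator $-H$, and for every $u\in L^2(\mathbb R^d;\mathbb C^m)$ and every $t\ge0$, $$\|(e^{-tA}u)(x)\|\le (e^{-tH}\|u\|)(x)\qquad\text{for almost every }x\in\mathbb R^d,$$ where $\|u\|$ denotes the scalar function $x\mapsto\|u(x)\|$. (In particular,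 the right-hand side is real for almost every $x$.) -/

import Mathlib

open MeasureTheory Filter Topology
open scoped NNReal ENNReal ContDiff

noncomputable section

/-! ### Strongly continuous semigroups and operators associated with forms -/

section Abstract

variable {E : Type*} [NormedAddCommGroup E] [InnerProductSpace ℂ E]

/-- `T` is a strongly continuous one-parameter semigroup of bounded operators on `E`. -/
structure IsC0Semigroup (T : ℝ≥0 → E →L[ℂ] E) : Prop where
  map_zero : T 0 = ContinuousLinearMap.id ℂ E
  map_add : ∀ s t, T (s + t) = (T s).comp (T t)
  continuous_orbit : ∀ u, Continuous fun t => T t u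

/-- `u` lies in the domain of the infinitesimal generator `B` of `T`, and `B u = g`. -/
def IsGeneratorValue (T : ℝ≥0 → E →L[ℂ] E) (u g : E) : Prop :=
  Tendsto (fun t : ℝ≥0 => (((t : ℝ) : ℂ))⁻¹ • (T t u - u)) (𝓝[>] 0) (𝓝 g)

/-- For the operator `A` associated with the form `q` on the form domain `D`
(`q` is linear in its first and conjugate linear in its second argument):
`u ∈ D(A)` and `A u = f`, i.e. `u ∈ D` and `q(u, v) = ⟨f, v⟩` for all `v ∈ D`. -/
def IsFormOperatorValue (D : Set E) (q : E → E → ℂ) (u f : E) : Prop :=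
  u ∈ D ∧ ∀ v ∈ D, q u v = inner ℂ v f

/-- `T` is the semigroup `(e^{-tA})_{t ≥ 0}`, where `A` is the operator associated with the form `q`
on `D`: it is strongly continuous and its generator is `-A` (same domain, same values). -/
structure IsFormSemigroup (D : Set E) (q : E → E → ℂ) (T : ℝ≥0 → E →L[ℂ] E) : Prop where
  isC0Semigroup : IsC0Semigroup T
  generator : ∀ u f, IsFormOperatorValue D q u f ↔ IsGeneratorValue T u (-f)

end Abstract

/-! ### Weak and magnetic gradients -/

section Gradient

variable {d : ℕ}

/-- `G` is the weak (distributional) gradient of `f`, both being locally integrable. -/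
structure IsWeakGradient (f : EuclideanSpace ℝ (Fin d) → ℂ)
    (G : EuclideanSpace ℝ (Fin d) → EuclideanSpace ℂ (Fin d)) : Prop where
  locallyIntegrable : LocallyIntegrable f volume
  locallyIntegrable_grad : LocallyIntegrable G volume
  integral_eq : ∀ φ : EuclideanSpace ℝ (Fin d) → ℝ, ContDiff ℝ ∞ φ → HasCompactSupport φ →
    ∀ k : Fin d,
      ∫ x, ((fderiv ℝ φ x (EuclideanSpace.single k 1) : ℝ) : ℂ) * f x
        = -∫ x, ((φ x : ℝ) : ℂ) * G x k

/-- `f` belongs to `W^{1,1}_loc`. -/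
def HasWeakGradient (f : EuclideanSpace ℝ (Fin d) → ℂ) : Prop :=
  ∃ G, IsWeakGradient f G

open Classical in
/-- The weak gradient `∇f` (unique up to null sets; `0` if there is none). -/
def weakGradient (f : EuclideanSpace ℝ (Fin d) → ℂ) :
    EuclideanSpace ℝ (Fin d) → EuclideanSpace ℂ (Fin d) :=
  if h : HasWeakGradient f then h.choose else 0

/-- The magnetic gradient `∇_a f = ∇f - i a f`. -/
def magneticGradient (a : EuclideanSpace ℝ (Fin d) → EuclideanSpace ℝ (Fin d))
    (f : EuclideanSpace ℝ (Fin d) → ℂ) :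
    EuclideanSpace ℝ (Fin d) → EuclideanSpace ℂ (Fin d) :=
  fun x => WithLp.toLp 2 fun k => weakGradient f x k - Complex.I * (a x k : ℂ) * f x

/-- The distribution `∇_a f` is a function in `L²`. As `a f` is locally integrable for
`a ∈ L²_loc` and `f ∈ L²`, the distribution `∇f = ∇_a f + i a f` is then a locally integrable
function, so that `f` has a weak gradient. -/
def HasL2MagneticGradient (a : EuclideanSpace ℝ (Fin d) → EuclideanSpace ℝ (Fin d))
    (f : EuclideanSpace ℝ (Fin d) → ℂ) : Prop :=
  HasWeakGradient f ∧ MemLp (magneticGradient a f) 2 volume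

end Gradient

/-! ### The magnetic Schrödinger form -/

/-- `L²(ℝ^d; ℂ^m)`. -/
abbrev L2Vec (d m : ℕ) : Type :=
  Lp (EuclideanSpace ℂ (Fin m)) 2 (volume : Measure (EuclideanSpace ℝ (Fin d)))

/-- `L²(ℝ^d; ℂ)`. -/
abbrev L2Scalar (d : ℕ) : Type :=
  Lp ℂ 2 (volume : Measure (EuclideanSpace ℝ (Fin d)))

section Forms

variable {d m : ℕ}

/-- A real matrix seen as a complex matrix. -/
def complexify (M : Matrix (Fin m) (Fin m) ℝ) : Matrix (Fin m) (Fin m) ℂ :=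
  M.map Complex.ofReal

/-- The square root `M^{1/2}` of a real symmetric positive semidefinite matrix, as a complex
matrix. -/
def matrixSqrt (M : Matrix (Fin m) (Fin m) ℝ) : Matrix (Fin m) (Fin m) ℂ :=
  cfc Real.sqrt (complexify M)

/-- `D(𝔞)`: those `u ∈ L²(ℝ^d; ℂ^m)` for which all `∇_a u_i` and `V^{1/2} u` are in `L²`. -/
def magneticFormDomain (a : EuclideanSpace ℝ (Fin d) → EuclideanSpace ℝ (Fin d))
    (V : EuclideanSpace ℝ (Fin d) → Matrix (Fin m) (Fin m) ℝ) : Set (L2Vec d m) :=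
  {u | (∀ i, HasL2MagneticGradient a fun x => u x i) ∧
    MemLp (fun x => Matrix.toEuclideanLin (matrixSqrt (V x)) (u x)) 2 volume}

/-- `𝔞(u, v) = ∑ i, ∫ ⟨∇_a u_i, ∇_a v_i⟩ + ∫ ⟨V u, v⟩`. Mathlib's inner product is
conjugate linear in the first argument, whence the order of the arguments. -/
def magneticForm (a : EuclideanSpace ℝ (Fin d) → EuclideanSpace ℝ (Fin d))
    (V : EuclideanSpace ℝ (Fin d) → Matrix (Fin m) (Fin m) ℝ) (u v : L2Vec d m) : ℂ :=
  (∑ i, ∫ x, inner ℂ (magneticGradient a (fun y => v y i) x)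
      (magneticGradient a (fun y => u y i) x))
    + ∫ x, inner ℂ (v x) (Matrix.toEuclideanLin (complexify (V x)) (u x))

/-- The smallest eigenvalue of a real symmetric matrix. -/
def smallestEigenvalue (M : Matrix (Fin m) (Fin m) ℝ) : ℝ :=
  sInf {μ : ℝ | Module.End.HasEigenvalue (Matrix.toLin' M) μ}

/-- `D(𝔥)` for the scalar potential `w`: those `u ∈ H¹(ℝ^d; ℂ)` with `√w u ∈ L²`. -/
def scalarFormDomain (w : EuclideanSpace ℝ (Fin d) → ℝ) : Set (L2Scalar d) :=
  {u | HasWeakGradient u ∧ MemLp (weakGradient u) 2 volume ∧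
    MemLp (fun x => ((Real.sqrt (w x) : ℝ) : ℂ) * u x) 2 volume}

/-- `𝔥(u, v) = ∫ ⟨∇u, ∇v⟩ + ∫ w u v̄`. -/
def scalarForm (w : EuclideanSpace ℝ (Fin d) → ℝ) (u v : L2Scalar d) : ℂ :=
  (∫ x, inner ℂ (weakGradient v x) (weakGradient u x))
    + ∫ x, (w x : ℂ) * u x * (starRingEnd ℂ) (v x)

/-- The scalar function `‖u‖ : x ↦ ‖u(x)‖`, as an element of `L²(ℝ^d; ℂ)`. -/
def pointwiseNorm (u : L2Vec d m) : L2Scalar d :=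
  MemLp.toLp (fun x => ((‖u x‖ : ℝ) : ℂ)) (Lp.memLp u).norm.ofReal

end Forms

end

/-! Both forms have the shape q(u, v) = ⟨Bu, Bv⟩ with B closed and densely defined: Bu = (∇_a u_1,
…, ∇_a u_m, V^{1/2}u) for 𝔞 and Bu = (∇u, √λ_V u) for 𝔥. If P is the orthogonal projection onto the
graph of B, the first component of P(g, 0) is (1 + B*B)⁻¹g, so R = (1 + A)⁻¹ is available without B*
(`IsClosedForm.isFormResolvent`). It is self-adjoint with spectrum in [0, 1] and dense range, and
e^{-tA} is the function exp(-t(1/x - 1)) of R. For uniqueness, the difference w of two orbits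
starting in D(A) satisfies d/dt ‖w‖² = -2 Re⟨w, Aw⟩ ≤ 0.

By the exponential formula e^{-tA} = lim (1 + (t/n)A)^{-n}, domination reduces to resolvents: if u +
sAu = f, h + sHh = g and ‖f‖ ≤ g, then ‖u‖ ≤ h. Testing with h - (Re h)⁺ shows h ≥ 0. Put φ = (‖u‖ -
h)⁺ and v = φu/‖u‖. The core is Re 𝔥(h, φ) ≤ Re 𝔞(u, v) (`exists_test_functions`); inserting the two
equations gives 0 ≤ Re⟨v, f - u⟩ - Re⟨φ, g - h⟩ ≤ -‖φ‖², hence φ = 0.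

The core inequality holds pointwise. The term i a_k u is orthogonal to u for the real inner product,
so n := ∂_k‖u‖ = Re⟨u, p⟩/‖u‖, where p is the k-th covariant derivative of u. With s = ∂_k h, the
gradient terms differ on {h < ‖u‖} by (‖u‖ - h)/‖u‖ · (‖p‖² - n²) + (n - s)² ≥ 0
(`mul_excessDeriv_le`). The potential terms compare because ⟨Vu, u⟩ ≥ λ_V‖u‖².

Placing v and φ in the form domains takes a chain rule for Lipschitz maps with kinks. Difference
quotients of f converge in L¹_loc to its weak derivative, hence a.e. with an integrable majorant
along a sequence of steps, so Lipschitz functions of f can be differentiated pointwise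
(`IsWeakDeriv.of_diffQuot`). The kinks are harmless because the weak derivative of f vanishes a.e.
on {f = 0}. -/

set_option linter.unusedSectionVars false

noncomputable section

/-! ### Weak directional derivatives and difference quotients -/

section WeakDerivative

variable {X : Type*} [NormedAddCommGroup X] [NormedSpace ℝ X]
  [MeasurableSpace X] {μ : Measure X}
  {E : Type*} [NormedAddCommGroup E] [NormedSpace ℝ E]
  {E' : Type*} [NormedAddCommGroup E'] [NormedSpace ℝ E']

/-- `g` is the weak derivative of `f` in the direction `e`. -/
structure IsWeakDeriv (μ : Measure X) (e : X) (f g : X → E) : Prop where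
  locallyIntegrable : LocallyIntegrable f μ
  locallyIntegrable_deriv : LocallyIntegrable g μ
  integral_eq : ∀ φ : X → ℝ, ContDiff ℝ ∞ φ → HasCompactSupport φ →
    ∫ x, fderiv ℝ φ x e • f x ∂μ = -∫ x, φ x • g x ∂μ

/-- The difference quotient of `f` in the direction `e` with step `t`. -/
def diffQuot (e : X) (t : ℝ) (f : X → E) (x : X) : E := t⁻¹ • (f (x + t • e) - f x)

lemma IsWeakDeriv.congr {e : X} {f g f' g' : X → E} (h : IsWeakDeriv μ e f g)
    (hf : f =ᵐ[μ] f') (hg : g =ᵐ[μ] g') : IsWeakDeriv μ e f' g' where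
  locallyIntegrable := h.locallyIntegrable.congr hf
  locallyIntegrable_deriv := h.locallyIntegrable_deriv.congr hg
  integral_eq φ h1 h2 := by
    rw [integral_congr_ae (g := fun x => fderiv ℝ φ x e • f x) (by
        filter_upwards [hf] with x hx; rw [hx]),
      integral_congr_ae (f := fun x => φ x • g' x) (g := fun x => φ x • g x) (by
        filter_upwards [hg] with x hx; rw [hx])]
    exact h.integral_eq φ h1 h2

omit [MeasurableSpace X] in
lemma ContDiff.fderiv_apply_const {φ : X → ℝ} (h : ContDiff ℝ ∞ φ) (e : X) :
    ContDiff ℝ ∞ fun x => fderiv ℝ φ x e :=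
  (h.fderiv_right (m := ∞) (by simp)).clm_apply contDiff_const

variable [FiniteDimensional ℝ X] [BorelSpace X] [μ.IsAddHaarMeasure]

open scoped Pointwise in
-- Continuity of translation in L¹, applied to `g` cut off to `K` enlarged by a ball of radius
-- `‖e‖`. For |s| ≤ 1 the cutoff is invisible from `K`.
lemma tendsto_lintegral_translate_sub {g : X → E} (hg : LocallyIntegrable g μ) (e : X)
    {K : Set X} (hK : IsCompact K) :
    Tendsto (fun s : ℝ => ∫⁻ x in K, ‖g (x + s • e) - g x‖ₑ ∂μ) (𝓝 0) (𝓝 0) := by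
  set K' : Set X := K + Metric.closedBall 0 ‖e‖ with hK'
  have hK'c : IsCompact K' := hK.add (isCompact_closedBall _ _)
  have hint : Integrable (K'.indicator g) μ :=
    (hg.integrableOn_isCompact hK'c).integrable_indicator hK'c.measurableSet
  have hmem : MemLp (K'.indicator g) 1 μ := memLp_one_iff_integrable.2 hint
  set G : Lp E 1 μ := hmem.toLp _ with hG
  let τ : ℝ → C(X, X) := fun s => ⟨fun x => x + s • e, by fun_prop⟩
  have hτ : ∀ s, MeasurePreserving (τ s) μ μ := fun s => measurePreserving_add_right μ (s • e)
  have hτc : Continuous τ := by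
    refine ContinuousMap.continuous_of_continuous_uncurry _ ?_
    change Continuous fun p : ℝ × X => p.2 + p.1 • e
    fun_prop
  have hcont : Continuous fun s => Lp.compMeasurePreserving (τ s) (hτ s) G :=
    continuous_const.compMeasurePreservingLp hτc hτ (by simp)
  have h0 : Tendsto (fun s => edist (Lp.compMeasurePreserving (τ s) (hτ s) G)
      (Lp.compMeasurePreserving (τ 0) (hτ 0) G)) (𝓝 0) (𝓝 0) := by
    have := (hcont.edist continuous_const).tendsto (f := fun s => edist
      (Lp.compMeasurePreserving (τ s) (hτ s) G) (Lp.compMeasurePreserving (τ 0) (hτ 0) G)) 0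
    simpa using this
  refine tendsto_of_tendsto_of_tendsto_of_le_of_le' tendsto_const_nhds h0
    (Eventually.of_forall fun _ => zero_le) ?_
  filter_upwards [Metric.closedBall_mem_nhds (0 : ℝ) one_pos] with s hs
  rw [mem_closedBall_zero_iff] at hs
  simp only [hG, Lp.toLp_compMeasurePreserving, Lp.edist_toLp_toLp, eLpNorm_one_eq_lintegral_enorm]
  rw [← lintegral_indicator hK.measurableSet]
  refine lintegral_mono fun x => ?_
  by_cases hx : x ∈ K
  · have h1 : x + s • e ∈ K' := Set.add_mem_add hx (by
      rw [mem_closedBall_zero_iff, norm_smul]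
      nlinarith [norm_nonneg e])
    have h2 : x ∈ K' := by
      simpa using Set.add_mem_add hx (show (0 : X) ∈ Metric.closedBall 0 ‖e‖ by simp)
    simp [τ, hx, h1, h2]
  · simp [hx]

lemma MeasureTheory.LocallyIntegrable.comp_add_right {f : X → E} (hf : LocallyIntegrable f μ) (c : X) :
    LocallyIntegrable (fun x => f (x + c)) μ := by
  intro x
  obtain ⟨s, hs, hfs⟩ := hf (x + c)
  refine ⟨(· + c) ⁻¹' s, (continuous_add_const c).continuousAt.preimage_mem_nhds hs, ?_⟩
  exact ((measurePreserving_add_right μ c).integrableOn_comp_preimage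
    (Homeomorph.addRight c).measurableEmbedding).2 hfs

open scoped Pointwise in
-- Justifies Fubini along segments: for 0 < s ≤ t the translates of `K` stay in the compact set
-- `K'`, so one integral over `K'` bounds all the inner integrals.
lemma integrable_prod_translate {g : X → E} (hg : LocallyIntegrable g μ)
    (hgm : StronglyMeasurable g) (e : X) {K : Set X} (hK : IsCompact K) (t : ℝ) :
    Integrable (fun p : X × ℝ => g (p.1 + p.2 • e))
      ((μ.restrict K).prod (volume.restrict (Set.Ioc 0 t))) := by
  set K' : Set X := K + Metric.closedBall 0 (t * ‖e‖) with hK'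
  have hK'c : IsCompact K' := hK.add (isCompact_closedBall _ _)
  have hC := (hg.integrableOn_isCompact hK'c).2
  refine ⟨(hgm.comp_measurable (by fun_prop)).aestronglyMeasurable, ?_⟩
  have hm : Measurable fun p : X × ℝ => ‖g (p.1 + p.2 • e)‖ₑ :=
    (hgm.comp_measurable (by fun_prop)).enorm
  rw [hasFiniteIntegral_iff_enorm, lintegral_prod_symm _ hm.aemeasurable]
  calc ∫⁻ s in Set.Ioc 0 t, ∫⁻ x in K, ‖g (x + s • e)‖ₑ ∂μ
      ≤ ∫⁻ s in Set.Ioc 0 t, ∫⁻ x in K', ‖g x‖ₑ ∂μ := by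
        refine setLIntegral_mono' measurableSet_Ioc fun s hs => ?_
        rw [← lintegral_indicator hK.measurableSet, ← lintegral_indicator hK'c.measurableSet,
          ← lintegral_add_right_eq_self (μ := μ) (K'.indicator fun x => ‖g x‖ₑ) (s • e)]
        refine lintegral_mono fun x => ?_
        by_cases hx : x ∈ K
        · have h1 : x + s • e ∈ K' := Set.add_mem_add hx (by
            rw [mem_closedBall_zero_iff, norm_smul, Real.norm_of_nonneg hs.1.le]
            exact mul_le_mul_of_nonneg_right hs.2 (norm_nonneg e))
          simp [hx, h1]
        · simp [hx]
    _ < ⊤ := by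
        rw [lintegral_const]
        exact ENNReal.mul_lt_top hC (by simp)

open scoped Pointwise in
-- Fundamental theorem of calculus in the direction `e`. After testing against φ, Fubini and a
-- translation put the shift on φ; the weak derivative turns `g` into the s-derivative of φ(x - se),
-- and integrating in s leaves the increment φ(x) - φ(x - te).
lemma IsWeakDeriv.ae_sub_eq_integral [CompleteSpace E] {e : X} {f g : X → E}
    (h : IsWeakDeriv μ e f g) (hgm : StronglyMeasurable g)
    {t : ℝ} (ht : 0 ≤ t) :
    ∀ᵐ x ∂μ, f (x + t • e) - f x = ∫ s in Set.Ioc 0 t, g (x + s • e) := by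
  have hf := h.locallyIntegrable
  have hg := h.locallyIntegrable_deriv
  set ν : Measure ℝ := volume.restrict (Set.Ioc 0 t) with hν
  have hft : LocallyIntegrable (fun x => f (x + t • e)) μ :=
    hf.comp_add_right _
  refine ae_eq_of_integral_contDiff_smul_eq (hft.sub hf) ?_ fun φ hφ hφc => ?_
  · rw [locallyIntegrable_iff]
    intro K hK
    exact (integrable_prod_translate hg hgm e hK t).integral_prod_left
  have hφ' := hφ.fderiv_apply_const e
  have hφc' : HasCompactSupport fun x => fderiv ℝ φ x e := hφc.fderiv_apply ℝ e
  have hI1 : Integrable (Function.uncurry fun x s => φ x • g (x + s • e)) (μ.prod ν) := by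
    have h1 := integrable_prod_translate hg hgm e hφc.isCompact t
    obtain ⟨C, hC⟩ := hφc.exists_bound_of_continuous hφ.continuous
    have h2 : Integrable (Function.uncurry fun x s => φ x • g (x + s • e))
        ((μ.restrict (tsupport φ)).prod ν) :=
      h1.bdd_smul C (hφ.continuous.comp continuous_fst).aestronglyMeasurable
        (Eventually.of_forall fun p => hC p.1)
    rw [hν, Measure.prod_restrict] at h2
    rw [hν, ← Measure.restrict_univ (μ := μ), Measure.prod_restrict]
    refine IntegrableOn.of_forall_sdiff_eq_zero h2 (MeasurableSet.univ.prod measurableSet_Ioc) ?_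
    rintro ⟨x, s⟩ ⟨h3, h4⟩
    have : x ∉ tsupport φ := fun hx => h4 ⟨hx, h3.2⟩
    simp [image_eq_zero_of_notMem_tsupport this]
  have hI2 : Integrable (Function.uncurry fun x s => fderiv ℝ φ (x - s • e) e • f x)
      (μ.prod ν) := by
    set K' : Set X := tsupport (fun x => fderiv ℝ φ x e) + Metric.closedBall 0 (t * ‖e‖) with hK'
    have hK'c : IsCompact K' := hφc'.isCompact.add (isCompact_closedBall _ _)
    have h1 : Integrable (fun p : X × ℝ => f p.1) ((μ.restrict K').prod ν) :=
      Integrable.comp_fst (hf.integrableOn_isCompact hK'c) ν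
    obtain ⟨C, hC⟩ := hφc'.exists_bound_of_continuous hφ'.continuous
    have h2 : Integrable (Function.uncurry fun x s => fderiv ℝ φ (x - s • e) e • f x)
        ((μ.restrict K').prod ν) :=
      h1.bdd_smul C (hφ'.continuous.comp
          (show Continuous fun p : X × ℝ => p.1 - p.2 • e by fun_prop)).aestronglyMeasurable
        (Eventually.of_forall fun p => hC _)
    rw [hν, Measure.prod_restrict] at h2
    rw [hν, ← Measure.restrict_univ (μ := μ), Measure.prod_restrict]
    refine IntegrableOn.of_forall_sdiff_eq_zero h2 (MeasurableSet.univ.prod measurableSet_Ioc) ?_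
    rintro ⟨x, s⟩ ⟨h3, h4⟩
    have : x - s • e ∉ tsupport (fun x => fderiv ℝ φ x e) := fun hx => h4 ⟨by
      have := Set.add_mem_add hx (show s • e ∈ Metric.closedBall 0 (t * ‖e‖) by
        rw [mem_closedBall_zero_iff, norm_smul, Real.norm_of_nonneg h3.2.1.le]
        exact mul_le_mul_of_nonneg_right h3.2.2 (norm_nonneg e))
      simpa using this, h3.2⟩
    have := image_eq_zero_of_notMem_tsupport this
    simp [this]
  have hR : ∫ x, φ x • (∫ s in Set.Ioc 0 t, g (x + s • e)) ∂μ
      = -∫ x, (φ x - φ (x - t • e)) • f x ∂μ := by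
    calc ∫ x, φ x • (∫ s in Set.Ioc 0 t, g (x + s • e)) ∂μ
        = ∫ x, (∫ s in Set.Ioc 0 t, φ x • g (x + s • e)) ∂μ := by
          simp only [integral_smul]
      _ = ∫ s in Set.Ioc 0 t, ∫ x, φ x • g (x + s • e) ∂μ := integral_integral_swap hI1
      _ = ∫ s in Set.Ioc 0 t, -∫ x, fderiv ℝ φ (x - s • e) e • f x ∂μ := by
          congr 1 with s
          have h1 := h.integral_eq (fun x => φ (x + -(s • e)))
            (hφ.comp (contDiff_id.add contDiff_const))
            (hφc.comp_homeomorph (Homeomorph.addRight (-(s • e))))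
          simp only [fderiv_comp_add_right] at h1
          simp only [sub_eq_add_neg]
          rw [h1, neg_neg, ← integral_add_right_eq_self
            (fun x => φ (x + -(s • e)) • g x) (s • e)]
          simp only [add_neg_cancel_right]
      _ = -∫ x, (∫ s in Set.Ioc 0 t, fderiv ℝ φ (x - s • e) e • f x) ∂μ := by
          rw [integral_neg, ← integral_integral_swap hI2]
      _ = -∫ x, (φ x - φ (x - t • e)) • f x ∂μ := by
          congr 2 with x
          rw [integral_smul_const, ← intervalIntegral.integral_of_le ht]
          congr 1
          have hd : ∀ s ∈ Set.uIcc 0 t, HasDerivAt (fun s => -φ (x - s • e))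
              (fderiv ℝ φ (x - s • e) e) s := by
            intro s _
            have h1 : HasDerivAt (fun s : ℝ => x - s • e) (-e) s := by
              simpa using ((hasDerivAt_id s).smul_const e).const_sub x
            have h2 := ((hφ.differentiable (by simp)) (x - s • e)).hasFDerivAt.comp_hasDerivAt s h1
            have h3 := h2.neg
            rw [map_neg, neg_neg] at h3
            exact h3
          rw [intervalIntegral.integral_eq_sub_of_hasDerivAt hd
            ((hφ'.continuous.comp (by fun_prop)).intervalIntegrable _ _)]
          simp; ring
  rw [hR]
  have hi1 : Integrable (fun x => φ x • f (x + t • e)) μ :=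
    hft.integrable_smul_left_of_hasCompactSupport hφ.continuous hφc
  have hi2 : Integrable (fun x => φ x • f x) μ :=
    hf.integrable_smul_left_of_hasCompactSupport hφ.continuous hφc
  have hi3 : Integrable (fun x => φ (x - t • e) • f x) μ :=
    hf.integrable_smul_left_of_hasCompactSupport (hφ.continuous.comp (by fun_prop))
      (hφc.comp_homeomorph (Homeomorph.subRight (t • e)))
  simp only [smul_sub, sub_smul]
  rw [integral_sub hi1 hi2, integral_sub hi2 hi3,
    ← integral_add_right_eq_self (fun x => φ (x - t • e) • f x) (t • e)]
  simp

end WeakDerivative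

section WeakDerivative

variable {X : Type*} [NormedAddCommGroup X] [NormedSpace ℝ X]
  [MeasurableSpace X] {μ : Measure X}
  {E : Type*} [NormedAddCommGroup E] [NormedSpace ℝ E]
  {E' : Type*} [NormedAddCommGroup E'] [NormedSpace ℝ E']
variable [FiniteDimensional ℝ X] [BorelSpace X] [μ.IsAddHaarMeasure]

lemma ae_comp_add_right {p : X → Prop} (h : ∀ᵐ x ∂μ, p x) (c : X) : ∀ᵐ x ∂μ, p (x + c) :=
  (measurePreserving_add_right μ c).quasiMeasurePreserving.ae h

lemma aestronglyMeasurable_diffQuot {f : X → E} (hf : AEStronglyMeasurable f μ) (e : X) (t : ℝ) :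
    AEStronglyMeasurable (diffQuot e t f) μ :=
  ((hf.comp_measurePreserving (measurePreserving_add_right μ (t • e))).sub hf).const_smul _

/-- The difference quotients of a function converge in `L¹_loc` to its weak derivative. -/
theorem IsWeakDeriv.tendsto_lintegral_diffQuot_sub [CompleteSpace E] {e : X} {f g : X → E}
    (h : IsWeakDeriv μ e f g) {K : Set X} (hK : IsCompact K) :
    Tendsto (fun t : ℝ => ∫⁻ x in K, ‖diffQuot e t f x - g x‖ₑ ∂μ) (𝓝[>] 0) (𝓝 0) := by
  -- A strongly measurable representative makes `g (x + s • e)` jointly measurable in `x` and `s`;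
  -- the difference quotients change only on a null set.
  wlog hm : StronglyMeasurable f ∧ StronglyMeasurable g generalizing f g
  · have hf := h.locallyIntegrable.aestronglyMeasurable
    have hg := h.locallyIntegrable_deriv.aestronglyMeasurable
    have := this (h.congr hf.ae_eq_mk hg.ae_eq_mk)
      ⟨hf.stronglyMeasurable_mk, hg.stronglyMeasurable_mk⟩
    refine this.congr fun t => lintegral_congr_ae (ae_restrict_of_ae ?_)
    filter_upwards [hf.ae_eq_mk, hg.ae_eq_mk, ae_comp_add_right hf.ae_eq_mk (t • e)]
      with x h1 h2 h3
    simp [diffQuot, h1, h2, h3]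
  obtain ⟨-, hgm⟩ := hm
  have hω := tendsto_lintegral_translate_sub h.locallyIntegrable_deriv e hK
  rw [ENNReal.tendsto_nhds_zero] at hω ⊢
  intro ε hε
  obtain ⟨δ, hδ, hδ'⟩ := Metric.eventually_nhds_iff.1 (hω ε hε)
  filter_upwards [Ioo_mem_nhdsGT hδ] with t ht
  have ht0 : ENNReal.ofReal t ≠ 0 := by simpa using ht.1
  have hmeas : Measurable fun p : X × ℝ => ‖g (p.1 + p.2 • e) - g p.1‖ₑ :=
    ((hgm.comp_measurable (by fun_prop)).sub (hgm.comp_measurable measurable_fst)).enorm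
  -- The error is the mean over (0, t] of g(x + se) - g(x). By Tonelli its L¹(K) norm is at most the
  -- mean of the translation errors, each of which is at most ε.
  calc ∫⁻ x in K, ‖diffQuot e t f x - g x‖ₑ ∂μ
      ≤ ∫⁻ x in K, (ENNReal.ofReal t)⁻¹ *
          (∫⁻ s in Set.Ioc 0 t, ‖g (x + s • e) - g x‖ₑ) ∂μ := by
        refine lintegral_mono_ae ?_
        filter_upwards [ae_restrict_of_ae (h.ae_sub_eq_integral hgm ht.1.le),
          (integrable_prod_translate h.locallyIntegrable_deriv hgm e hK t).prod_right_ae]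
          with x h1 h2
        have h3 : diffQuot e t f x - g x
            = t⁻¹ • ∫ s in Set.Ioc 0 t, (g (x + s • e) - g x) := by
          rw [integral_sub h2 (integrable_const _), ← h1, integral_const, smul_sub]
          simp [diffQuot, smul_smul, ht.1.le, ht.1.ne']
        rw [h3, enorm_smul, Real.enorm_eq_ofReal (by simpa using ht.1.le),
          ENNReal.ofReal_inv_of_pos ht.1]
        gcongr
        exact enorm_integral_le_lintegral_enorm _
    _ = (ENNReal.ofReal t)⁻¹ *
          ∫⁻ s in Set.Ioc 0 t, ∫⁻ x in K, ‖g (x + s • e) - g x‖ₑ ∂μ := by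
        rw [lintegral_const_mul' _ _ (ENNReal.inv_ne_top.2 ht0),
          lintegral_lintegral_swap hmeas.aemeasurable]
    _ ≤ (ENNReal.ofReal t)⁻¹ * ∫⁻ s in Set.Ioc 0 t, ε := by
        refine mul_le_mul' le_rfl (setLIntegral_mono' measurableSet_Ioc fun s hs => hδ' ?_)
        rw [Real.dist_0_eq_abs, abs_of_pos hs.1]
        exact hs.2.trans_lt ht.2
    _ = ε := by
        rw [lintegral_const, mul_comm ε]
        simp only [MeasurableSet.univ, Measure.restrict_apply, Set.univ_inter, Real.volume_Ioc,
          sub_zero]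
        rw [← mul_assoc, ENNReal.inv_mul_cancel ht0 ENNReal.ofReal_ne_top, one_mul]

/-- Along a suitable sequence of steps, difference quotients converge almost everywhere on a
compact set to the weak derivative, and are dominated by an integrable function. -/
lemma IsWeakDeriv.exists_seq_diffQuot [CompleteSpace E] {e : X} {f g : X → E}
    (h : IsWeakDeriv μ e f g) {K : Set X} (hK : IsCompact K) :
    ∃ (s : ℕ → ℝ) (b : X → ℝ), (∀ j, 0 < s j ∧ s j ≤ 1) ∧ Tendsto s atTop (𝓝 0) ∧
      IntegrableOn b K μ ∧ ∀ᵐ x ∂μ.restrict K,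
        Tendsto (fun j => diffQuot e (s j) f x) atTop (𝓝 (g x)) ∧
          ∀ j, ‖diffQuot e (s j) f x‖ ≤ b x := by
  have h1 := ENNReal.tendsto_nhds_zero.1 (h.tendsto_lintegral_diffQuot_sub hK)
  -- Geometric errors make the sum `S` of all errors integrable. Where `S` is finite its terms tend
  -- to zero, and `‖g‖ + S` dominates every difference quotient.
  have h2 : ∀ j : ℕ, ∃ t : ℝ, ∫⁻ x in K, ‖diffQuot e t f x - g x‖ₑ ∂μ ≤ (2⁻¹ : ℝ≥0∞) ^ j ∧
      0 < t ∧ t < 1 / ((j : ℝ) + 1) := fun j =>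
    ((h1 ((2⁻¹ : ℝ≥0∞) ^ j) (ENNReal.pow_pos (by simp) j)).and
      (Ioo_mem_nhdsGT (by positivity))).exists
  choose s hs1 hs2 hs3 using h2
  have hm : ∀ j, AEStronglyMeasurable (fun x => diffQuot e (s j) f x - g x) (μ.restrict K) :=
    fun j => ((aestronglyMeasurable_diffQuot h.locallyIntegrable.aestronglyMeasurable e _).sub
      h.locallyIntegrable_deriv.aestronglyMeasurable).restrict
  set S : X → ℝ≥0∞ := fun x => ∑' j, ‖diffQuot e (s j) f x - g x‖ₑ with hS
  have hSint : ∫⁻ x in K, S x ∂μ ≠ ⊤ := by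
    rw [hS, lintegral_tsum fun j => (hm j).enorm]
    refine ((ENNReal.tsum_le_tsum hs1).trans_lt ?_).ne
    rw [ENNReal.tsum_geometric]
    simp
  have hSm : AEMeasurable S (μ.restrict K) := AEMeasurable.tsum fun j => (hm j).enorm
  refine ⟨s, fun x => ‖g x‖ + (S x).toReal, fun j => ⟨hs2 j, (hs3 j).le.trans ?_⟩, ?_, ?_, ?_⟩
  · rw [div_le_one (by positivity)]
    simp
  · exact squeeze_zero (fun j => (hs2 j).le) (fun j => (hs3 j).le)
      tendsto_one_div_add_atTop_nhds_zero_nat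
  · exact (h.locallyIntegrable_deriv.integrableOn_isCompact hK).norm.add
      (integrable_toReal_of_lintegral_ne_top hSm hSint)
  · filter_upwards [ae_lt_top' hSm hSint] with x hx
    constructor
    · rw [tendsto_iff_edist_tendsto_0]
      simpa [edist_eq_enorm_sub] using ENNReal.tendsto_atTop_zero_of_tsum_ne_top hx.ne
    · intro j
      have h3 : ‖diffQuot e (s j) f x - g x‖ ≤ (S x).toReal := by
        rw [← toReal_enorm]
        exact ENNReal.toReal_mono hx.ne (ENNReal.le_tsum j)
      calc _ = ‖g x + (diffQuot e (s j) f x - g x)‖ := by congr 1; abel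
        _ ≤ _ := (norm_add_le _ _).trans (by gcongr)

open scoped Pointwise in
/-- If `w` is controlled by `f` in the sense of Lipschitz composition, and its difference quotients
converge wherever those of `f` do, then the limit is the weak derivative of `w`. -/
theorem IsWeakDeriv.of_diffQuot [CompleteSpace E] {e : X} {f g : X → E} {w G : X → E'}
    (h : IsWeakDeriv μ e f g) (hw : LocallyIntegrable w μ) (C : ℝ)
    (hC : ∀ x y, ‖w x - w y‖ ≤ C * ‖f x - f y‖)
    (hlim : ∀ᵐ x ∂μ, ∀ s : ℕ → ℝ, (∀ j, 0 < s j) → Tendsto s atTop (𝓝 0) →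
      Tendsto (fun j => diffQuot e (s j) f x) atTop (𝓝 (g x)) →
      Tendsto (fun j => diffQuot e (s j) w x) atTop (𝓝 (G x))) :
    IsWeakDeriv μ e w G := by
  have hCq : ∀ s : ℝ, ∀ x, ‖diffQuot e s w x‖ ≤ C * ‖diffQuot e s f x‖ := by
    intro s x
    simp only [diffQuot, norm_smul]
    nlinarith [hC (x + s • e) x, norm_nonneg s⁻¹]
  -- The Lipschitz bound turns the majorant for `f` into one for `w`. The steps depend on `K`, but
  -- the limit `G` does not.
  have key : ∀ K : Set X, IsCompact K → ∃ (s : ℕ → ℝ) (b : X → ℝ),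
      (∀ j, 0 < s j ∧ s j ≤ 1) ∧ Tendsto s atTop (𝓝 0) ∧
      IntegrableOn b K μ ∧ ∀ᵐ x ∂μ.restrict K,
        Tendsto (fun j => diffQuot e (s j) w x) atTop (𝓝 (G x)) ∧
          ∀ j, ‖diffQuot e (s j) w x‖ ≤ b x := by
    intro K hK
    obtain ⟨s, b, h1, h2, h3, h4⟩ := h.exists_seq_diffQuot hK
    refine ⟨s, fun x => |C| * b x, h1, h2, h3.const_mul _, ?_⟩
    filter_upwards [h4, ae_restrict_of_ae hlim] with x h5 h6
    refine ⟨h6 s (fun j => (h1 j).1) h2 h5.1, fun j => (hCq _ x).trans ?_⟩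
    have := h5.2 j
    gcongr
    exact le_abs_self C
  have hwm := hw.aestronglyMeasurable
  have hG : LocallyIntegrable G μ := by
    rw [locallyIntegrable_iff]
    intro K hK
    obtain ⟨s, b, h1, h2, h3, h4⟩ := key K hK
    refine Integrable.mono' h3 (aestronglyMeasurable_of_tendsto_ae atTop
      (fun j => (aestronglyMeasurable_diffQuot hwm e (s j)).restrict)
      (h4.mono fun x hx => hx.1)) (h4.mono fun x hx => ?_)
    exact le_of_tendsto hx.1.norm (Eventually.of_forall hx.2)
  refine ⟨hw, hG, fun φ hφ hφc => ?_⟩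
  obtain ⟨s, b, h1, h2, h3, h4⟩ := key _ hφc.isCompact
  obtain ⟨M, hM⟩ := hφc.exists_bound_of_continuous hφ.continuous
  have hset : ∀ u : X → E', ∫ x in tsupport φ, φ x • u x ∂μ = ∫ x, φ x • u x ∂μ := fun u =>
    setIntegral_eq_integral_of_forall_compl_eq_zero fun x hx => by
      simp [image_eq_zero_of_notMem_tsupport hx]
  have hlim1 : Tendsto (fun j => ∫ x, φ x • diffQuot e (s j) w x ∂μ) atTop
      (𝓝 (∫ x, φ x • G x ∂μ)) := by
    simp only [← hset]
    refine tendsto_integral_of_dominated_convergence (fun x => M * b x)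
      (fun j => hφ.continuous.aestronglyMeasurable.smul
        (aestronglyMeasurable_diffQuot hwm e (s j)).restrict) (h3.const_mul _) (fun j => ?_) ?_
    · filter_upwards [h4] with x hx
      rw [norm_smul]
      exact mul_le_mul (hM x) (hx.2 j) (norm_nonneg _) ((norm_nonneg _).trans (hM x))
    · filter_upwards [h4] with x hx using hx.1.const_smul _
  -- Summation by parts: translation invariance moves the difference quotient from `w` to φ, with
  -- the step reversed.
  have hshift : ∀ t : ℝ, ∫ x, φ x • diffQuot e t w x ∂μ
      = ∫ x, (t⁻¹ * (φ (x - t • e) - φ x)) • w x ∂μ := by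
    intro t
    have hi1 : Integrable (fun x => φ x • w (x + t • e)) μ :=
      (hw.comp_add_right _).integrable_smul_left_of_hasCompactSupport hφ.continuous hφc
    have hi2 : Integrable (fun x => φ x • w x) μ :=
      hw.integrable_smul_left_of_hasCompactSupport hφ.continuous hφc
    have hi3 : Integrable (fun x => φ (x - t • e) • w x) μ :=
      hw.integrable_smul_left_of_hasCompactSupport (hφ.continuous.comp (by fun_prop))
        (hφc.comp_homeomorph (Homeomorph.subRight (t • e)))
    simp only [diffQuot, smul_comm (φ _) t⁻¹, mul_smul, integral_smul]
    congr 1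
    simp only [smul_sub, sub_smul]
    rw [integral_sub hi1 hi2, integral_sub hi3 hi2,
      ← integral_add_right_eq_self (fun x => φ (x - t • e) • w x) (t • e)]
    simp only [add_sub_cancel_right]
  obtain ⟨L, hL⟩ := hφ.lipschitzWith_of_hasCompactSupport hφc (by simp)
  set K' : Set X := tsupport φ + Metric.closedBall 0 ‖e‖ with hK'
  have hK'c : IsCompact K' := hφc.isCompact.add (isCompact_closedBall _ _)
  have hlim2 : Tendsto (fun j => ∫ x, ((s j)⁻¹ * (φ (x - s j • e) - φ x)) • w x ∂μ) atTop
      (𝓝 (∫ x, (-fderiv ℝ φ x e) • w x ∂μ)) := by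
    refine tendsto_integral_of_dominated_convergence
      (K'.indicator fun x => L * ‖e‖ * ‖w x‖) (fun j => ?_) ?_ (fun j => ?_) ?_
    · exact (Continuous.aestronglyMeasurable
        (by have := hφ.continuous; fun_prop)).smul hwm
    · exact IntegrableOn.integrable_indicator
        ((hw.integrableOn_isCompact hK'c).norm.const_mul _) hK'c.measurableSet
    · refine Eventually.of_forall fun x => ?_
      by_cases hx : x ∈ K'
      · rw [Set.indicator_of_mem hx, norm_smul, norm_mul, norm_inv,
          Real.norm_of_nonneg (h1 j).1.le]
        refine mul_le_mul_of_nonneg_right ?_ (norm_nonneg _)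
        rw [inv_mul_le_iff₀ (h1 j).1]
        have := hL.norm_sub_le (x - s j • e) x
        rw [sub_sub_cancel_left, norm_neg, norm_smul, Real.norm_of_nonneg (h1 j).1.le] at this
        linarith
      · rw [Set.indicator_of_notMem hx]
        have hx1 : x ∉ tsupport φ := fun hx' => hx (by
          simpa using Set.add_mem_add hx' (show (0 : X) ∈ Metric.closedBall 0 ‖e‖ by simp))
        have hx2 : x - s j • e ∉ tsupport φ := fun hx' => hx (by
          have := Set.add_mem_add hx' (show s j • e ∈ Metric.closedBall 0 ‖e‖ by
            rw [mem_closedBall_zero_iff, norm_smul, Real.norm_of_nonneg (h1 j).1.le]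
            nlinarith [norm_nonneg e, h1 j])
          simpa using this)
        simp [image_eq_zero_of_notMem_tsupport hx1, image_eq_zero_of_notMem_tsupport hx2]
    · refine Eventually.of_forall fun x => ?_
      refine Tendsto.smul_const ?_ _
      have hd := ((hφ.differentiable (by simp)) x).hasFDerivAt.hasFDerivWithinAt (s := Set.univ)
      have := hd.lim (c := fun j => (s j)⁻¹) (d := fun j => -(s j • e)) (l := atTop) (v := -e)
        (by simpa using (h2.smul_const e).neg) (by simp)
        (tendsto_const_nhds.congr fun j => by
          rw [smul_neg, smul_smul, inv_mul_cancel₀ (h1 j).1.ne', one_smul])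
      simpa [sub_eq_add_neg] using this
  have huniq := tendsto_nhds_unique (hlim1.congr fun j => hshift (s j)) hlim2
  simp only [neg_smul, integral_neg] at huniq
  rw [huniq, neg_neg]

end WeakDerivative

/-! ### Rules for weak derivatives and limits of difference quotients -/

section WeakDerivativeCalculus

variable {X : Type*} [NormedAddCommGroup X] [NormedSpace ℝ X] [FiniteDimensional ℝ X]
  [MeasurableSpace X] [BorelSpace X] {μ : Measure X} [μ.IsAddHaarMeasure]
  {E : Type*} [NormedAddCommGroup E] [NormedSpace ℝ E]
  {E' : Type*} [NormedAddCommGroup E'] [NormedSpace ℝ E'] {e : X}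

lemma IsWeakDeriv.ae_unique [CompleteSpace E] {f g g' : X → E}
    (h : IsWeakDeriv μ e f g) (h' : IsWeakDeriv μ e f g') : g =ᵐ[μ] g' :=
  ae_eq_of_integral_contDiff_smul_eq h.locallyIntegrable_deriv h'.locallyIntegrable_deriv
    fun φ h1 h2 => by
      rw [← neg_inj, ← h.integral_eq φ h1 h2, ← h'.integral_eq φ h1 h2]

lemma integrable_fderiv_smul {f : X → E} (hf : LocallyIntegrable f μ) {φ : X → ℝ}
    (h1 : ContDiff ℝ ∞ φ) (h2 : HasCompactSupport φ) :
    Integrable (fun x => fderiv ℝ φ x e • f x) μ :=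
  hf.integrable_smul_left_of_hasCompactSupport (h1.fderiv_apply_const e).continuous
    (h2.fderiv_apply ℝ e)

lemma IsWeakDeriv.add {f g f' g' : X → E} (h : IsWeakDeriv μ e f g)
    (h' : IsWeakDeriv μ e f' g') :
    IsWeakDeriv μ e (fun x => f x + f' x) (fun x => g x + g' x) where
  locallyIntegrable := h.locallyIntegrable.add h'.locallyIntegrable
  locallyIntegrable_deriv := h.locallyIntegrable_deriv.add h'.locallyIntegrable_deriv
  integral_eq φ h1 h2 := by
    simp only [smul_add]
    rw [integral_add (integrable_fderiv_smul h.locallyIntegrable h1 h2)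
        (integrable_fderiv_smul h'.locallyIntegrable h1 h2),
      integral_add (h.locallyIntegrable_deriv.integrable_smul_left_of_hasCompactSupport
        h1.continuous h2) (h'.locallyIntegrable_deriv.integrable_smul_left_of_hasCompactSupport
        h1.continuous h2), h.integral_eq φ h1 h2, h'.integral_eq φ h1 h2, neg_add]

lemma IsWeakDeriv.clm_comp [CompleteSpace E] [CompleteSpace E'] {f g : X → E}
    (h : IsWeakDeriv μ e f g) (L : E →L[ℝ] E') :
    IsWeakDeriv μ e (fun x => L (f x)) (fun x => L (g x)) where
  locallyIntegrable x := by
    obtain ⟨s, hs, h1⟩ := h.locallyIntegrable x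
    exact ⟨s, hs, L.integrable_comp h1⟩
  locallyIntegrable_deriv x := by
    obtain ⟨s, hs, h1⟩ := h.locallyIntegrable_deriv x
    exact ⟨s, hs, L.integrable_comp h1⟩
  integral_eq φ h1 h2 := by
    simp only [← map_smul]
    rw [L.integral_comp_comm (integrable_fderiv_smul h.locallyIntegrable h1 h2),
      L.integral_comp_comm (h.locallyIntegrable_deriv.integrable_smul_left_of_hasCompactSupport
        h1.continuous h2), h.integral_eq φ h1 h2, map_neg]

lemma IsWeakDeriv.sub [CompleteSpace E] {f g f' g' : X → E} (h : IsWeakDeriv μ e f g)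
    (h' : IsWeakDeriv μ e f' g') :
    IsWeakDeriv μ e (fun x => f x - f' x) (fun x => g x - g' x) := by
  simpa [sub_eq_add_neg] using h.add (h'.clm_comp (-ContinuousLinearMap.id ℝ E))

lemma IsWeakDeriv.prodMk [CompleteSpace E] [CompleteSpace E'] {f g : X → E} {f' g' : X → E'}
    (h : IsWeakDeriv μ e f g) (h' : IsWeakDeriv μ e f' g') :
    IsWeakDeriv μ e (fun x => (f x, f' x)) (fun x => (g x, g' x)) := by
  simpa using (h.clm_comp (ContinuousLinearMap.inl ℝ E E')).add
    (h'.clm_comp (ContinuousLinearMap.inr ℝ E E'))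

lemma IsWeakDeriv.neg_direction {f g : X → E} (h : IsWeakDeriv μ e f g) :
    IsWeakDeriv μ (-e) f (fun x => -g x) where
  locallyIntegrable := h.locallyIntegrable
  locallyIntegrable_deriv := h.locallyIntegrable_deriv.neg
  integral_eq φ h1 h2 := by
    simp only [map_neg, neg_smul, smul_neg, integral_neg]
    rw [h.integral_eq φ h1 h2]

lemma tendsto_comp_of_tendsto_diffQuot {f : X → E} {x : X} {y : E} {s : ℕ → ℝ}
    (hs : ∀ j, 0 < s j) (hs0 : Tendsto s atTop (𝓝 0))
    (h : Tendsto (fun j => diffQuot e (s j) f x) atTop (𝓝 y)) :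
    Tendsto (fun j => f (x + s j • e)) atTop (𝓝 (f x)) := by
  have h1 := (hs0.smul h).add_const (f x)
  rw [zero_smul, zero_add] at h1
  refine h1.congr fun j => ?_
  simp [diffQuot, smul_smul, (hs j).ne']

lemma HasFDerivAt.tendsto_diffQuot_comp {f : X → E} {x : X} {y : E} {s : ℕ → ℝ}
    {F : E → E'} {F' : E →L[ℝ] E'} (hF : HasFDerivAt F F' (f x))
    (hs : ∀ j, 0 < s j) (hs0 : Tendsto s atTop (𝓝 0))
    (h : Tendsto (fun j => diffQuot e (s j) f x) atTop (𝓝 y)) :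
    Tendsto (fun j => diffQuot e (s j) (fun z => F (f z)) x) atTop (𝓝 (F' y)) := by
  have h1 := tendsto_comp_of_tendsto_diffQuot hs hs0 h
  have h2 := (hF.hasFDerivWithinAt (s := Set.univ)).lim (c := fun j => (s j)⁻¹)
    (d := fun j => f (x + s j • e) - f x) (l := atTop) (v := y)
    (by simpa using h1.sub_const (f x)) (by simp) h
  simpa [diffQuot] using h2

/-- The directional derivative of the norm at `y` in the direction `z`. -/
def normDeriv {E : Type*} [NormedAddCommGroup E] [InnerProductSpace ℝ E] (y z : E) : ℝ :=
  open Classical in if y = 0 then ‖z‖ else inner ℝ y z / ‖y‖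

end WeakDerivativeCalculus

/-! ### Weak derivative of the norm and of the positive part -/

section Norm

variable {X : Type*} [NormedAddCommGroup X] [NormedSpace ℝ X] [FiniteDimensional ℝ X]
  [MeasurableSpace X] [BorelSpace X] {μ : Measure X} [μ.IsAddHaarMeasure]
  {E : Type*} [NormedAddCommGroup E] [InnerProductSpace ℝ E] {e : X}

lemma hasFDerivAt_norm_of_ne_zero {y : E} (hy : y ≠ 0) :
    HasFDerivAt (fun z : E => ‖z‖) (‖y‖⁻¹ • innerSL ℝ y) y := by
  have h := ((hasStrictFDerivAt_norm_sq y).hasFDerivAt).sqrt (by simpa using hy)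
  simp only [Real.sqrt_sq (norm_nonneg _)] at h
  convert h using 1
  ext z
  simp
  field_simp

lemma tendsto_diffQuot_norm {f : X → E} {x : X} {y : E} {s : ℕ → ℝ}
    (hs : ∀ j, 0 < s j) (hs0 : Tendsto s atTop (𝓝 0))
    (h : Tendsto (fun j => diffQuot e (s j) f x) atTop (𝓝 y)) :
    Tendsto (fun j => diffQuot e (s j) (fun z => ‖f z‖) x) atTop (𝓝 (normDeriv (f x) y)) := by
  by_cases hx : f x = 0
  · rw [normDeriv, if_pos hx]
    refine h.norm.congr fun j => ?_
    simp [diffQuot, hx, norm_smul, abs_of_pos (hs j)]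
  · rw [normDeriv, if_neg hx]
    have := (hasFDerivAt_norm_of_ne_zero hx).tendsto_diffQuot_comp hs hs0 h
    simpa [div_eq_inv_mul] using this

lemma IsWeakDeriv.norm_normDeriv [CompleteSpace E] {f g : X → E} (h : IsWeakDeriv μ e f g) :
    IsWeakDeriv μ e (fun x => ‖f x‖) (fun x => normDeriv (f x) (g x)) :=
  h.of_diffQuot (fun x => (h.locallyIntegrable x).norm) 1
    (fun x y => by simpa using abs_norm_sub_norm_le (f x) (f y))
    (Eventually.of_forall fun _ _ hs hs0 h => tendsto_diffQuot_norm hs hs0 h)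

/-- The weak derivative of `f` vanishes almost everywhere on the zero set of `f`. -/
theorem IsWeakDeriv.ae_eq_zero_of_eq_zero [CompleteSpace E] {f g : X → E}
    (h : IsWeakDeriv μ e f g) : ∀ᵐ x ∂μ, f x = 0 → g x = 0 := by
  -- Differentiating `‖f‖` in the direction `-e` in two ways gives -‖g‖ = ‖-g‖ where `f = 0`, since
  -- the one-sided derivative of the norm at the origin is even in the direction.
  filter_upwards [h.norm_normDeriv.neg_direction.ae_unique h.neg_direction.norm_normDeriv]
    with x hx h0
  simp only [normDeriv, if_pos h0, norm_neg] at hx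
  have := norm_nonneg (g x)
  exact norm_eq_zero.1 (by linarith)

/-- The quotient takes the default value 0 on {f = 0}, which is correct because `g` vanishes a.e.
there. -/
theorem IsWeakDeriv.norm [CompleteSpace E] {f g : X → E} (h : IsWeakDeriv μ e f g) :
    IsWeakDeriv μ e (fun x => ‖f x‖) (fun x => inner ℝ (f x) (g x) / ‖f x‖) := by
  refine h.norm_normDeriv.congr (EventuallyEq.refl _ _) ?_
  filter_upwards [h.ae_eq_zero_of_eq_zero] with x hx
  by_cases h0 : f x = 0
  · simp [normDeriv, h0, hx h0]
  · simp [normDeriv, h0]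

/-- max(f, 0) = (f + |f|)/2, and on {f = 0} both derivatives vanish a.e. -/
theorem IsWeakDeriv.posPart {f g : X → ℝ} (h : IsWeakDeriv μ e f g) :
    IsWeakDeriv μ e (fun x => max (f x) 0) (fun x => if 0 < f x then g x else 0) := by
  have h1 := (h.add h.norm).clm_comp (E' := ℝ) ((2⁻¹ : ℝ) • ContinuousLinearMap.id ℝ ℝ)
  refine h1.congr (Eventually.of_forall fun x => ?_) ?_
  · simp only [smul_apply, ContinuousLinearMap.id_apply, smul_eq_mul,
      Real.norm_eq_abs]
    rcases le_total (f x) 0 with h0 | h0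
    · rw [abs_of_nonpos h0, max_eq_right h0]; ring
    · rw [abs_of_nonneg h0, max_eq_left h0]; ring
  · filter_upwards [h.ae_eq_zero_of_eq_zero] with x hx
    simp only [smul_apply, ContinuousLinearMap.id_apply, smul_eq_mul,
      Real.norm_eq_abs, RCLike.inner_apply, conj_trivial]
    rcases lt_trichotomy (f x) 0 with h0 | h0 | h0
    · rw [abs_of_neg h0, if_neg h0.not_gt]
      have := h0.ne
      field_simp
      ring
    · simp [h0, hx h0]
    · rw [abs_of_pos h0, if_pos h0]
      field_simp
      ring

end Norm

/-! ### The vector-valued truncation `(‖u‖ - r)⁺ u/‖u‖` -/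

section Shrink

variable {X : Type*} [NormedAddCommGroup X] [NormedSpace ℝ X] [FiniteDimensional ℝ X]
  [MeasurableSpace X] [BorelSpace X] {μ : Measure X} [μ.IsAddHaarMeasure]
  {E : Type*} [NormedAddCommGroup E] [InnerProductSpace ℝ E] {e : X}

/-- The vector `z` with its norm reduced by `r`: the difference of `z` and its metric projection
onto the ball of radius `r`. -/
def shrink (r : ℝ) (z : E) : E := (max (‖z‖ - r) 0 / ‖z‖) • z

lemma shrink_of_le {r : ℝ} {z : E} (h : ‖z‖ ≤ r) : shrink r z = 0 := by
  simp [shrink, max_eq_right (sub_nonpos.2 h)]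

lemma shrink_of_lt {r : ℝ} {z : E} (h : r < ‖z‖) :
    shrink r z = ((‖z‖ - r) / ‖z‖) • z := by
  simp [shrink, max_eq_left (sub_pos.2 h).le]

lemma norm_shrink {r : ℝ} (hr : 0 ≤ r) (z : E) : ‖shrink r z‖ = max (‖z‖ - r) 0 := by
  rcases le_or_gt ‖z‖ r with h | h
  · rw [shrink_of_le h, max_eq_right (sub_nonpos.2 h), norm_zero]
  · have h0 : 0 < ‖z‖ := hr.trans_lt h
    rw [shrink_of_lt h, max_eq_left (sub_pos.2 h).le, norm_smul, norm_div, norm_norm,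
      Real.norm_of_nonneg (sub_pos.2 h).le, div_mul_cancel₀ _ h0.ne']

/-- Outside the balls, `shrink r z` is z - (r/‖z‖)z. The subtracted projection changes by at most
2‖z - z'‖ + |r - r'|, so three increments of `z` and one of `r` give the constant 4. -/
lemma norm_shrink_sub_shrink_le {r r' : ℝ} (hr : 0 ≤ r) (hr' : 0 ≤ r') (z z' : E) :
    ‖shrink r z - shrink r' z'‖ ≤ 4 * ‖(r, z) - (r', z')‖ := by
  have h1 : ‖z - z'‖ ≤ ‖(r, z) - (r', z')‖ := norm_snd_le ((r, z) - (r', z'))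
  have h2 : |r - r'| ≤ ‖(r, z) - (r', z')‖ := norm_fst_le ((r, z) - (r', z'))
  have h3 := abs_le.1 (abs_norm_sub_norm_le z z')
  have h4 := abs_le.1 h2
  rcases le_or_gt ‖z‖ r with h | h <;> rcases le_or_gt ‖z'‖ r' with h' | h'
  · simp [shrink_of_le h, shrink_of_le h']
  · rw [shrink_of_le h, zero_sub, norm_neg, norm_shrink hr', max_eq_left (sub_pos.2 h').le]
    linarith
  · rw [shrink_of_le h', sub_zero, norm_shrink hr, max_eq_left (sub_pos.2 h).le]
    linarith
  · have h0 : 0 < ‖z‖ := hr.trans_lt h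
    have h0' : 0 < ‖z'‖ := hr'.trans_lt h'
    have e1 : shrink r z - shrink r' z'
        = (z - z') - ((r / ‖z‖) • (z - z') + (r / ‖z‖ - r' / ‖z'‖) • z') := by
      rw [shrink_of_lt h, shrink_of_lt h', sub_div, sub_div, div_self h0.ne', div_self h0'.ne']
      module
    have e2 : ‖(r / ‖z‖) • (z - z')‖ ≤ ‖z - z'‖ := by
      rw [norm_smul, Real.norm_of_nonneg (by positivity)]
      exact mul_le_of_le_one_left (norm_nonneg _) ((div_le_one h0).2 h.le)
    have e3 : ‖(r / ‖z‖ - r' / ‖z'‖) • z'‖ ≤ ‖z - z'‖ + |r - r'| := by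
      rw [norm_smul, Real.norm_eq_abs, ← abs_norm z', ← abs_mul]
      have : (r / ‖z‖ - r' / ‖z'‖) * ‖z'‖ = (r / ‖z‖) * (‖z'‖ - ‖z‖) + (r - r') := by
        field_simp
        ring
      rw [abs_norm, this]
      refine (abs_add_le _ _).trans ?_
      gcongr
      rw [abs_mul, abs_of_nonneg (by positivity : (0 : ℝ) ≤ r / ‖z‖), abs_sub_comm]
      exact (mul_le_of_le_one_left (abs_nonneg _) ((div_le_one h0).2 h.le)).trans
        (abs_norm_sub_norm_le z z')
    rw [e1]
    have := norm_sub_le (z - z') ((r / ‖z‖) • (z - z') + (r / ‖z‖ - r' / ‖z'‖) • z')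
    have := norm_add_le ((r / ‖z‖) • (z - z')) ((r / ‖z‖ - r' / ‖z'‖) • z')
    linarith

/-- The derivative of `(‖z‖ - r) / ‖z‖` at `(r, z)` in the direction `(r', z')`. -/
def shrinkFactorDeriv (r : ℝ) (z : E) (r' : ℝ) (z' : E) : ℝ :=
  r * inner ℝ z z' / ‖z‖ ^ 3 - r' / ‖z‖

lemma hasFDerivAt_shrink {r : ℝ} {z : E} (hr : 0 ≤ r) (h : r < ‖z‖) :
    ∃ F' : ℝ × E →L[ℝ] E, HasFDerivAt (fun p : ℝ × E => shrink p.1 p.2) F' (r, z) ∧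
      ∀ r' z', F' (r', z') = ((‖z‖ - r) / ‖z‖) • z' + shrinkFactorDeriv r z r' z' • z := by
  have h0 : ‖z‖ ≠ 0 := (hr.trans_lt h).ne'
  have hn : HasFDerivAt (fun p : ℝ × E => ‖p.2‖)
      ((‖z‖⁻¹ • innerSL ℝ z).comp (ContinuousLinearMap.snd ℝ ℝ E)) (r, z) :=
    (hasFDerivAt_norm_of_ne_zero (norm_ne_zero_iff.1 h0)).comp (r, z) hasFDerivAt_snd
  have hd := (((hn.sub hasFDerivAt_fst).mul ((hasDerivAt_inv h0).comp_hasFDerivAt (r, z) hn)).smul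
    (hasFDerivAt_snd (𝕜 := ℝ) (E := ℝ) (F := E) (p := (r, z))))
  refine ⟨_, hd.congr_of_eventuallyEq ?_, ?_⟩
  · have : ∀ᶠ p : ℝ × E in 𝓝 (r, z), p.1 < ‖p.2‖ :=
      (isOpen_lt continuous_fst continuous_snd.norm).mem_nhds h
    filter_upwards [this] with p hp
    rw [shrink_of_lt hp]
    simp [div_eq_mul_inv]
  · intro r' z'
    simp [shrinkFactorDeriv, div_eq_mul_inv]
    congr 1
    field_simp
    ring

/-- The map (r, z) ↦ `shrink r z` is Lipschitz for r ≥ 0, differentiable where r < ‖z‖ and zero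
where ‖z‖ ≤ r. On the interface ‖u‖ = r the weak derivative of ‖u‖ - r vanishes a.e., and the
difference quotients of ‖u‖ - r bound those of the truncation, which therefore tend to zero. -/
theorem IsWeakDeriv.shrink [CompleteSpace E] {u u' : X → E} {r r' : X → ℝ}
    (hu : IsWeakDeriv μ e u u') (hr : IsWeakDeriv μ e r r') (hr0 : ∀ x, 0 ≤ r x) :
    IsWeakDeriv μ e (fun x => shrink (r x) (u x)) (fun x =>
      if r x < ‖u x‖ then ((‖u x‖ - r x) / ‖u x‖) • u' x
        + shrinkFactorDeriv (r x) (u x) (r' x) (u' x) • u x else 0) := by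
  have hk := hu.norm_normDeriv.sub hr
  have hloc : LocallyIntegrable (fun x => _root_.shrink (r x) (u x)) μ := by
    refine hu.locallyIntegrable.mono ?_ (Eventually.of_forall fun x => ?_)
    · have h1 := hu.locallyIntegrable.aestronglyMeasurable
      have h2 := hr.locallyIntegrable.aestronglyMeasurable
      exact ((((h1.norm.aemeasurable.sub h2.aemeasurable).max aemeasurable_const).div
        h1.norm.aemeasurable).aestronglyMeasurable).smul h1
    · rw [norm_shrink (hr0 x)]
      exact max_le (by linarith [hr0 x]) (norm_nonneg _)
  refine (hr.prodMk hu).of_diffQuot hloc 4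
    (fun x y => norm_shrink_sub_shrink_le (hr0 x) (hr0 y) _ _) ?_
  filter_upwards [hk.ae_eq_zero_of_eq_zero] with x hx s hs hs0 hlim
  have hlimu : Tendsto (fun j => diffQuot e (s j) u x) atTop (𝓝 (u' x)) :=
    ((continuous_snd.tendsto _).comp hlim).congr fun j => by simp [diffQuot]
  have hlimr : Tendsto (fun j => diffQuot e (s j) r x) atTop (𝓝 (r' x)) :=
    ((continuous_fst.tendsto _).comp hlim).congr fun j => by simp [diffQuot]
  by_cases h : r x < ‖u x‖
  · obtain ⟨F', h1, h2⟩ := hasFDerivAt_shrink (hr0 x) h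
    have := HasFDerivAt.tendsto_diffQuot_comp (f := fun x => (r x, u x)) h1 hs hs0 hlim
    rw [if_pos h]
    rwa [h2] at this
  · rw [if_neg h]
    have hlimk : Tendsto (fun j => diffQuot e (s j) (fun x => ‖u x‖ - r x) x) atTop
        (𝓝 (normDeriv (u x) (u' x) - r' x)) :=
      ((tendsto_diffQuot_norm hs hs0 hlimu).sub hlimr).congr fun j => by
        simp only [diffQuot, smul_eq_mul]; ring
    have hnorm : ∀ j, ‖diffQuot e (s j) (fun x => _root_.shrink (r x) (u x)) x‖
        = (s j)⁻¹ * max (‖u (x + s j • e)‖ - r (x + s j • e)) 0 := fun j => by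
      rw [diffQuot, shrink_of_le (not_lt.1 h), sub_zero, norm_smul, norm_shrink (hr0 _), norm_inv,
        Real.norm_of_nonneg (hs j).le]
    rw [tendsto_zero_iff_norm_tendsto_zero]
    rcases (not_lt.1 h).lt_or_eq with h1 | h1
    · refine tendsto_const_nhds.congr' ?_
      have := tendsto_comp_of_tendsto_diffQuot hs hs0 hlimk
      filter_upwards [this.eventually_lt_const (sub_neg.2 h1)] with j hj
      rw [hnorm, max_eq_right hj.le, mul_zero]
    · rw [hx (sub_eq_zero.2 h1)] at hlimk
      refine squeeze_zero (fun _ => norm_nonneg _) (fun j => ?_) (by simpa using hlimk.norm)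
      rw [hnorm, diffQuot, h1, sub_self, sub_zero, smul_eq_mul, abs_mul,
        abs_of_pos (inv_pos.2 (hs j))]
      exact mul_le_mul_of_nonneg_left (max_le (le_abs_self _) (abs_nonneg _))
        (inv_nonneg.2 (hs j).le)

end Shrink

/-! ### The semigroup as a function of the resolvent -/

section ResolventSemigroup

/-- The function `x ↦ exp (-t (1/x - 1))`, which maps `(1 + a)⁻¹` to `exp (-t a)`. -/
def expResolvent (t x : ℝ) : ℝ := if x ≤ 0 then 0 else Real.exp (-(t * (x⁻¹ - 1)))

lemma expResolvent_of_pos (t : ℝ) {x : ℝ} (hx : 0 < x) :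
    expResolvent t x = Real.exp (-(t * (x⁻¹ - 1))) := if_neg hx.not_ge

lemma expResolvent_zero_right (t : ℝ) : expResolvent t 0 = 0 := if_pos le_rfl

lemma expResolvent_nonneg (t x : ℝ) : 0 ≤ expResolvent t x := by
  unfold expResolvent
  split_ifs
  exacts [le_rfl, (Real.exp_pos _).le]

lemma inv_sub_one_nonneg {x : ℝ} (hx : 0 < x) (hx1 : x ≤ 1) : 0 ≤ x⁻¹ - 1 := by
  have := (one_le_inv₀ hx).2 hx1
  linarith

lemma expResolvent_le_one {t x : ℝ} (ht : 0 ≤ t) (hx : x ≤ 1) : expResolvent t x ≤ 1 := by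
  rcases le_or_gt x 0 with h | h
  · rw [expResolvent, if_pos h]; exact zero_le_one
  · rw [expResolvent_of_pos t h]
    exact Real.exp_le_one_iff.2 (by nlinarith [inv_sub_one_nonneg h hx])

/-- The function mapping `(1 + a)⁻¹` to `(1 + s a)⁻¹`. -/
def scaledResolvent (s x : ℝ) : ℝ := x / (x + s * (1 - x))

lemma scaledResolvent_of_pos (s : ℝ) {x : ℝ} (hx : 0 < x) :
    scaledResolvent s x = (1 + s * (x⁻¹ - 1))⁻¹ := by
  have : x + s * (1 - x) = x * (1 + s * (x⁻¹ - 1)) := by field_simp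
  rw [scaledResolvent, this, div_mul_cancel_left₀ hx.ne']

lemma scaledResolvent_den_pos {s x : ℝ} (hs : 0 < s) (hx : x ∈ Set.Icc (0 : ℝ) 1) :
    0 < x + s * (1 - x) := by
  rcases hx.1.eq_or_lt with h | h
  · rw [← h]; simpa using hs
  · nlinarith [hx.2]

lemma scaledResolvent_nonneg {s x : ℝ} (hs : 0 < s) (hx : x ∈ Set.Icc (0 : ℝ) 1) :
    0 ≤ scaledResolvent s x := div_nonneg hx.1 (scaledResolvent_den_pos hs hx).le

lemma scaledResolvent_le_one {s x : ℝ} (hs : 0 < s) (hx : x ∈ Set.Icc (0 : ℝ) 1) :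
    scaledResolvent s x ≤ 1 := by
  rw [scaledResolvent, div_le_one (scaledResolvent_den_pos hs hx)]
  nlinarith [hx.2]

lemma continuousOn_scaledResolvent {s : ℝ} (hs : 0 < s) :
    ContinuousOn (scaledResolvent s) (Set.Icc 0 1) :=
  continuousOn_id.div (by fun_prop) fun _ hx => (scaledResolvent_den_pos hs hx).ne'

/-- This is e^y ≥ 1 + y; the continuous upper bound, zero at x = 0, yields continuity of
`expResolvent t` there for t > 0. -/
lemma expResolvent_le_scaledResolvent {t x : ℝ} (ht : 0 < t) (hx : x ∈ Set.Icc (0 : ℝ) 1) :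
    expResolvent t x ≤ scaledResolvent t x := by
  rcases hx.1.eq_or_lt with h | h
  · rw [← h, expResolvent_zero_right]
    simp [scaledResolvent]
  · have := inv_sub_one_nonneg h hx.2
    rw [expResolvent_of_pos t h, scaledResolvent_of_pos t h, Real.exp_neg]
    gcongr
    linarith [Real.add_one_le_exp (t * (x⁻¹ - 1))]

lemma continuousOn_expResolvent {t : ℝ} (ht : 0 < t) :
    ContinuousOn (expResolvent t) (Set.Icc 0 1) := by
  intro x hx
  rcases hx.1.eq_or_lt with h | h
  · subst h
    rw [ContinuousWithinAt, expResolvent_zero_right]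
    refine squeeze_zero' (Eventually.of_forall fun y => expResolvent_nonneg t y)
      (eventually_mem_nhdsWithin.mono fun y hy => expResolvent_le_scaledResolvent ht hy) ?_
    simpa [ContinuousWithinAt, scaledResolvent] using continuousOn_scaledResolvent ht 0 hx
  · refine ContinuousAt.continuousWithinAt ?_
    have : ContinuousAt (fun x : ℝ => Real.exp (-(t * (x⁻¹ - 1)))) x := by
      have := h.ne'
      fun_prop (disch := assumption)
    refine this.congr ?_
    filter_upwards [lt_mem_nhds h] with y hy
    rw [expResolvent_of_pos t hy]

/-- At t = 0 `expResolvent` jumps at x = 0. The factor x removes the jump, so that t = 0, where the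
semigroup is set to 1 by hand, can be treated together with t > 0. -/
lemma continuousOn_expResolvent_mul_id {t : ℝ} (ht : 0 ≤ t) :
    ContinuousOn (fun x => expResolvent t x * x) (Set.Icc 0 1) := by
  rcases ht.eq_or_lt with h | h
  · subst h
    refine continuousOn_id.congr fun x hx => ?_
    rcases hx.1.eq_or_lt with h | h
    · simp [← h]
    · simp [expResolvent_of_pos 0 h]
  · exact (continuousOn_expResolvent h).mul continuousOn_id

lemma expResolvent_add {s t x : ℝ} :
    expResolvent (s + t) x = expResolvent s x * expResolvent t x := by
  unfold expResolvent
  split_ifs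
  · simp
  · rw [← Real.exp_add]; ring_nf

/-- With a = 1/x - 1 one has xa = 1 - x ≤ 1: one factor of the resolvent absorbs the factor a
produced by differentiating in t. -/
lemma abs_expResolvent_mul_sub_le {s t x : ℝ} (hs : 0 ≤ s) (ht : 0 ≤ t)
    (hx : x ∈ Set.Icc (0 : ℝ) 1) :
    |expResolvent s x * x - expResolvent t x * x| ≤ |s - t| := by
  wlog hst : s ≤ t generalizing s t
  · rw [abs_sub_comm, abs_sub_comm s t]
    exact this ht hs (le_of_not_ge hst)
  rcases hx.1.eq_or_lt with h | h
  · simp [← h]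
  have ha := inv_sub_one_nonneg h hx.2
  set a := x⁻¹ - 1 with hadef
  have hxa : x * a = 1 - x := by rw [hadef]; field_simp
  rw [expResolvent_of_pos s h, expResolvent_of_pos t h, ← hadef]
  have h1 : Real.exp (-(t * a)) = Real.exp (-(s * a)) * Real.exp (-((t - s) * a)) := by
    rw [← Real.exp_add]; ring_nf
  have h2 := Real.add_one_le_exp (-((t - s) * a))
  have h3 : Real.exp (-((t - s) * a)) ≤ 1 :=
    Real.exp_le_one_iff.2 (by nlinarith)
  have h4 : Real.exp (-(s * a)) ≤ 1 := Real.exp_le_one_iff.2 (by nlinarith)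
  have h5 := Real.exp_pos (-(s * a))
  have h6 : 0 ≤ (Real.exp (-(s * a)) - Real.exp (-(t * a))) * x := by
    rw [h1]
    have : 0 ≤ Real.exp (-(s * a)) * (1 - Real.exp (-((t - s) * a))) :=
      mul_nonneg h5.le (by linarith)
    nlinarith
  rw [← sub_mul, abs_of_nonneg h6, abs_sub_comm, abs_of_nonneg (sub_nonneg.2 hst)]
  calc (Real.exp (-(s * a)) - Real.exp (-(t * a))) * x
      = Real.exp (-(s * a)) * ((1 - Real.exp (-((t - s) * a))) * x) := by rw [h1]; ring
    _ ≤ 1 * (((t - s) * a) * x) := by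
        refine mul_le_mul h4 ?_ ?_ zero_le_one
        · nlinarith
        · exact mul_nonneg (by linarith) h.le
    _ = (t - s) * (1 - x) := by rw [← hxa]; ring
    _ ≤ t - s := by nlinarith [hx.1]

lemma exp_neg_bounds {y : ℝ} (hy : 0 ≤ y) :
    1 - y ≤ Real.exp (-y) ∧ Real.exp (-y) ≤ (1 + y)⁻¹ ∧ (1 + y)⁻¹ ≤ 1 - y + y ^ 2 := by
  refine ⟨by linarith [Real.add_one_le_exp (-y)], ?_, ?_⟩
  · rw [Real.exp_neg]
    gcongr
    linarith [Real.add_one_le_exp y]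
  · rw [inv_le_iff_one_le_mul₀ (by positivity)]
    nlinarith [pow_nonneg hy 3]

lemma abs_expResolvent_quotient_le {t x : ℝ} (ht : 0 < t) (hx : x ∈ Set.Icc (0 : ℝ) 1) :
    |t⁻¹ * (expResolvent t x * x - x)| ≤ 1 := by
  have := abs_expResolvent_mul_sub_le ht.le le_rfl hx
  have h0 : expResolvent 0 x * x = x := by
    rcases hx.1.eq_or_lt with h | h
    · simp [← h]
    · simp [expResolvent_of_pos 0 h]
  rw [h0, sub_zero, abs_of_pos ht] at this
  rwa [abs_mul, abs_of_pos (inv_pos.2 ht), inv_mul_le_iff₀ ht, mul_one]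

/-- The second-order remainder e^{-y} - 1 + y ≤ y² with y = ta costs a², which the factor x²
absorbs. -/
lemma abs_expResolvent_quotient_add_le {t x : ℝ} (ht : 0 < t) (hx : x ∈ Set.Icc (0 : ℝ) 1) :
    |t⁻¹ * (expResolvent t x * x - x) * x + (x - x * x)| ≤ t := by
  rcases hx.1.eq_or_lt with h | h
  · simp [← h, ht.le]
  have ha := inv_sub_one_nonneg h hx.2
  rw [expResolvent_of_pos t h]
  set a := x⁻¹ - 1 with hadef
  have hxa : x * a = 1 - x := by rw [hadef]; field_simp
  obtain ⟨h1, h2, h3⟩ := exp_neg_bounds (mul_nonneg ht.le ha)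
  have e : t⁻¹ * (Real.exp (-(t * a)) * x - x) * x + (x - x * x)
      = t⁻¹ * x ^ 2 * (Real.exp (-(t * a)) - 1 + t * a) := by
    have : x - x * x = x * (x * a) := by rw [hxa]; ring
    rw [this]
    field_simp
  have h4 : 0 ≤ Real.exp (-(t * a)) - 1 + t * a := by linarith
  rw [e, abs_of_nonneg (by positivity)]
  calc t⁻¹ * x ^ 2 * (Real.exp (-(t * a)) - 1 + t * a) ≤ t⁻¹ * x ^ 2 * (t * a) ^ 2 := by
        gcongr; linarith
    _ = t * (x * a) ^ 2 := by field_simp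
    _ ≤ t * 1 ^ 2 := by
        gcongr
        rw [hxa]; linarith
    _ = t := by ring

lemma abs_pow_sub_pow_le_of_le_one {b c : ℝ} (hb : 0 ≤ b) (hb1 : b ≤ 1) (hc : 0 ≤ c)
    (hc1 : c ≤ 1) (n : ℕ) : |b ^ n - c ^ n| ≤ n * |b - c| := by
  induction n with
  | zero => simp
  | succ n ih =>
    have e : b ^ (n + 1) - c ^ (n + 1) = b * (b ^ n - c ^ n) + c ^ n * (b - c) := by ring
    rw [e]
    refine (abs_add_le _ _).trans ?_
    rw [abs_mul, abs_mul, abs_of_nonneg hb, abs_of_nonneg (pow_nonneg hc n)]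
    have h1 := mul_le_of_le_one_left (abs_nonneg (b ^ n - c ^ n)) hb1
    have h2 := mul_le_of_le_one_left (abs_nonneg (b - c)) (pow_le_one₀ hc hc1 (n := n))
    push_cast
    linarith

/-- Each of the n + 1 factors differs from e^{-y} by at most y², where y = ta/(n + 1). Errors of
powers of numbers in [0, 1] add up, and (n + 1)y²x² = t²(xa)²/(n + 1). -/
lemma abs_scaledResolvent_pow_sub_le {t x : ℝ} (ht : 0 < t) (hx : x ∈ Set.Icc (0 : ℝ) 1) (n : ℕ) :
    |scaledResolvent (t / (n + 1)) x ^ (n + 1) * (x * x) - expResolvent t x * (x * x)|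
      ≤ t ^ 2 / (n + 1) := by
  rcases hx.1.eq_or_lt with h | h
  · simp only [← h, mul_zero, sub_zero, abs_zero]
    positivity
  have ha := inv_sub_one_nonneg h hx.2
  have hs : 0 < t / ((n : ℝ) + 1) := by positivity
  have hb := scaledResolvent_nonneg hs hx
  have hb1 := scaledResolvent_le_one hs hx
  rw [expResolvent_of_pos t h]
  rw [scaledResolvent_of_pos _ h] at hb hb1 ⊢
  set a := x⁻¹ - 1 with hadef
  have hxa : x * a = 1 - x := by rw [hadef]; field_simp
  obtain ⟨h1, h2, h3⟩ := exp_neg_bounds (mul_nonneg hs.le ha)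
  set y := t / ((n : ℝ) + 1) * a with hy
  have e : Real.exp (-(t * a)) = Real.exp (-y) ^ (n + 1) := by
    rw [← Real.exp_nat_mul]
    congr 1
    rw [hy]
    push_cast
    field_simp
  have h4 := abs_pow_sub_pow_le_of_le_one hb hb1 (Real.exp_pos (-y)).le (h2.trans hb1) (n + 1)
  have h5 : |(1 + y)⁻¹ - Real.exp (-y)| ≤ y ^ 2 := by
    rw [abs_of_nonneg (by linarith)]; linarith
  rw [e, ← sub_mul, abs_mul, abs_of_nonneg (mul_nonneg h.le h.le)]
  calc |(1 + y)⁻¹ ^ (n + 1) - Real.exp (-y) ^ (n + 1)| * (x * x)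
      ≤ (((n + 1 : ℕ) : ℝ) * y ^ 2) * (x * x) := by
        refine mul_le_mul_of_nonneg_right (h4.trans ?_) (mul_nonneg h.le h.le)
        exact mul_le_mul_of_nonneg_left h5 (Nat.cast_nonneg _)
    _ = t ^ 2 / (n + 1) * (x * a) ^ 2 := by
        rw [hy]; push_cast; field_simp
    _ ≤ t ^ 2 / (n + 1) * 1 ^ 2 := by
        refine mul_le_mul_of_nonneg_left ?_ (by positivity)
        gcongr
        rw [hxa]; linarith
    _ = t ^ 2 / (n + 1) := by ring

variable {E : Type*} [NormedAddCommGroup E] [InnerProductSpace ℂ E]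

/-- The density argument shared by strong continuity, the generator and the exponential formula:
estimates are made only on the range of a power of the resolvent. -/
lemma tendsto_apply_of_denseRange {ι : Type*} {l : Filter ι} {A : ι → E →L[ℂ] E} {B R : E →L[ℂ] E}
    (hA : ∀ᶠ i in l, ‖A i‖ ≤ 1) (hR : DenseRange R)
    (h : ∀ g, Tendsto (fun i => A i (R g)) l (𝓝 (B (R g)))) (u : E) :
    Tendsto (fun i => A i u) l (𝓝 (B u)) := by
  rw [Metric.tendsto_nhds]
  intro ε hε
  obtain ⟨g, hg⟩ := hR.exists_dist_lt u (show 0 < ε / (2 * (2 + ‖B‖)) by positivity)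
  have hg' : (2 + ‖B‖) * ‖u - R g‖ ≤ ε / 2 := by
    rw [dist_eq_norm] at hg
    calc _ ≤ (2 + ‖B‖) * (ε / (2 * (2 + ‖B‖))) := by gcongr
      _ = ε / 2 := by field_simp
  filter_upwards [hA, Metric.tendsto_nhds.1 (h g) (ε / 2) (by positivity)] with i h1 h2
  rw [dist_eq_norm] at h2 ⊢
  have e : A i u - B u = A i (u - R g) + (A i (R g) - B (R g)) - B (u - R g) := by
    simp only [map_sub]; abel
  have h3 : ‖A i (u - R g)‖ ≤ 1 * ‖u - R g‖ := (A i).le_of_opNorm_le h1 _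
  have h4 := B.le_opNorm (u - R g)
  rw [e]
  have h5 := norm_sub_le (A i (u - R g) + (A i (R g) - B (R g))) (B (u - R g))
  have h6 := norm_add_le (A i (u - R g)) (A i (R g) - B (R g))
  nlinarith [norm_nonneg (u - R g)]

/-- `R` behaves like the resolvent `(1 + A)⁻¹` of a nonnegative self-adjoint operator. -/
structure IsUnitResolvent [CompleteSpace E] (R : E →L[ℂ] E) : Prop where
  isSelfAdjoint : IsSelfAdjoint R
  spectrum_subset : spectrum ℝ R ⊆ Set.Icc 0 1
  denseRange : DenseRange R

/-- The semigroup `e^{-tA}`, where `R = (1 + A)⁻¹`. -/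
def resolventSemigroup [CompleteSpace E] (R : E →L[ℂ] E) (t : ℝ≥0) : E →L[ℂ] E :=
  open Classical in if t = 0 then 1 else cfc (expResolvent t) R

/-- The resolvent `(1 + s A)⁻¹`, where `R = (1 + A)⁻¹`. -/
def resolventScaled [CompleteSpace E] (R : E →L[ℂ] E) (s : ℝ) : E →L[ℂ] E :=
  cfc (scaledResolvent s) R

namespace IsUnitResolvent

variable [CompleteSpace E] {R : E →L[ℂ] E} (hR : IsUnitResolvent R)
include hR

lemma norm_cfc_sub_le {f g : ℝ → ℝ} (hf : ContinuousOn f (Set.Icc 0 1))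
    (hg : ContinuousOn g (Set.Icc 0 1)) {c : ℝ} (hc : 0 ≤ c)
    (h : ∀ x ∈ Set.Icc (0 : ℝ) 1, |f x - g x| ≤ c) : ‖cfc f R - cfc g R‖ ≤ c := by
  rw [← cfc_sub f g R (hf.mono hR.spectrum_subset) (hg.mono hR.spectrum_subset)]
  exact norm_cfc_le hc fun x hx => h x (hR.spectrum_subset hx)

lemma cfc_mul_eq {f g : ℝ → ℝ} (hf : ContinuousOn f (Set.Icc 0 1))
    (hg : ContinuousOn g (Set.Icc 0 1)) : cfc f R * cfc g R = cfc (fun x => f x * g x) R :=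
  (cfc_mul f g R (hf.mono hR.spectrum_subset) (hg.mono hR.spectrum_subset)).symm

lemma cfc_id_eq : cfc (fun x : ℝ => x) R = R := cfc_id' ℝ R hR.isSelfAdjoint

lemma cfc_mul_self_eq {f : ℝ → ℝ} (hf : ContinuousOn f (Set.Icc 0 1)) :
    cfc f R * R = cfc (fun x => f x * x) R := by
  conv_lhs => rw [← hR.cfc_id_eq]
  rw [hR.cfc_id_eq]
  conv_lhs => enter [2]; rw [← hR.cfc_id_eq]
  exact hR.cfc_mul_eq hf continuousOn_id

lemma mul_self_eq : R * R = cfc (fun x : ℝ => x * x) R := by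
  have := hR.cfc_mul_self_eq (f := fun x => x) continuousOn_id
  rwa [hR.cfc_id_eq] at this

lemma semigroup_mul (t : ℝ≥0) :
    resolventSemigroup R t * R = cfc (fun x => expResolvent t x * x) R := by
  rw [resolventSemigroup]
  split_ifs with h
  · subst h
    rw [one_mul]
    conv_lhs => rw [← hR.cfc_id_eq]
    refine cfc_congr fun x hx => ?_
    rcases (hR.spectrum_subset hx).1.eq_or_lt with h | h
    · simp [← h]
    · simp [expResolvent_of_pos 0 h]
  · exact hR.cfc_mul_self_eq (continuousOn_expResolvent (NNReal.coe_pos.2 (pos_iff_ne_zero.2 h)))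

lemma norm_semigroup_le (t : ℝ≥0) : ‖resolventSemigroup R t‖ ≤ 1 := by
  rw [resolventSemigroup]
  split_ifs with h
  · exact ContinuousLinearMap.norm_id_le
  · refine norm_cfc_le zero_le_one fun x hx => ?_
    rw [Real.norm_of_nonneg (expResolvent_nonneg _ _)]
    exact expResolvent_le_one t.2 (hR.spectrum_subset hx).2

lemma norm_semigroup_mul_sub_le (s t : ℝ≥0) :
    ‖resolventSemigroup R s * R - resolventSemigroup R t * R‖ ≤ |(s : ℝ) - t| := by
  rw [hR.semigroup_mul, hR.semigroup_mul]
  exact hR.norm_cfc_sub_le (continuousOn_expResolvent_mul_id s.2)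
    (continuousOn_expResolvent_mul_id t.2) (abs_nonneg _)
    fun x hx => abs_expResolvent_mul_sub_le s.2 t.2 hx

theorem isC0Semigroup : IsC0Semigroup (resolventSemigroup R) where
  map_zero := by simp [resolventSemigroup, ContinuousLinearMap.one_def]
  map_add s t := by
    change _ = resolventSemigroup R s * resolventSemigroup R t
    rcases eq_or_ne s 0 with hs | hs
    · simp [hs, resolventSemigroup]
    rcases eq_or_ne t 0 with ht | ht
    · simp [ht, resolventSemigroup]
    simp only [resolventSemigroup, hs, ht, if_false, add_eq_zero, and_self]
    rw [hR.cfc_mul_eq (continuousOn_expResolvent (NNReal.coe_pos.2 (pos_iff_ne_zero.2 hs)))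
      (continuousOn_expResolvent (NNReal.coe_pos.2 (pos_iff_ne_zero.2 ht)))]
    simp only [NNReal.coe_add]
    exact cfc_congr fun x _ => expResolvent_add
  continuous_orbit u := by
    rw [continuous_iff_continuousAt]
    intro t
    refine tendsto_apply_of_denseRange
      (Eventually.of_forall hR.norm_semigroup_le) hR.denseRange (fun g => ?_) u
    rw [tendsto_iff_norm_sub_tendsto_zero]
    have h0 : Tendsto (fun s : ℝ≥0 => |(s : ℝ) - t| * ‖g‖) (𝓝 t) (𝓝 0) := by
      have : Continuous fun s : ℝ≥0 => |(s : ℝ) - t| * ‖g‖ := by fun_prop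
      simpa using this.tendsto t
    refine squeeze_zero (fun _ => norm_nonneg _) (fun s => ?_) h0
    exact ((resolventSemigroup R s * R - resolventSemigroup R t * R).le_opNorm g).trans
      (mul_le_mul_of_nonneg_right (hR.norm_semigroup_mul_sub_le s t) (norm_nonneg g))

/-- The operators t⁻¹(T(t)R - R) are bounded by 1, and on the range of `R` they converge to R - 1 at
rate t; density gives every `g`. For u = Rg, the vector g - Rg is Au. -/
theorem isGeneratorValue (g : E) :
    IsGeneratorValue (resolventSemigroup R) (R g) (-(g - R g)) := by
  set A : ℝ≥0 → E →L[ℂ] E := fun t =>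
    cfc (fun x => (t : ℝ)⁻¹ * (expResolvent t x * x - x)) R with hAdef
  have hc : ∀ t : ℝ≥0, ContinuousOn (fun x => (t : ℝ)⁻¹ * (expResolvent t x * x - x))
      (Set.Icc 0 1) := fun t =>
    continuousOn_const.mul ((continuousOn_expResolvent_mul_id t.2).sub continuousOn_id)
  have hA : ∀ t : ℝ≥0, A t = (t : ℝ)⁻¹ • (resolventSemigroup R t * R - R) := by
    intro t
    rw [hR.semigroup_mul]
    conv_rhs => enter [2, 2]; rw [← hR.cfc_id_eq]
    have c1 : ContinuousOn (fun x => expResolvent t x * x) (spectrum ℝ R) :=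
      (continuousOn_expResolvent_mul_id t.2).mono hR.spectrum_subset
    have c2 : ContinuousOn (fun x => expResolvent t x * x - x) (spectrum ℝ R) :=
      c1.sub continuousOn_id
    rw [← cfc_sub _ (fun x => x) R c1 continuousOn_id, ← cfc_smul _ _ R c2]
    rfl
  have hpos : ∀ᶠ t : ℝ≥0 in 𝓝[>] 0, 0 < t := eventually_mem_nhdsWithin
  have key : Tendsto (fun t => A t g) (𝓝[>] 0) (𝓝 ((R - 1) g)) := by
    refine tendsto_apply_of_denseRange ?_ hR.denseRange (fun g => ?_) g
    · filter_upwards [hpos] with t ht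
      exact norm_cfc_le zero_le_one fun x hx =>
        abs_expResolvent_quotient_le (NNReal.coe_pos.2 ht) (hR.spectrum_subset hx)
    · rw [tendsto_iff_norm_sub_tendsto_zero]
      have h0 : Tendsto (fun s : ℝ≥0 => (s : ℝ) * ‖g‖) (𝓝[>] 0) (𝓝 0) := by
        have : Continuous fun s : ℝ≥0 => (s : ℝ) * ‖g‖ := by fun_prop
        simpa using (this.tendsto 0).mono_left nhdsWithin_le_nhds
      refine squeeze_zero' (Eventually.of_forall fun _ => norm_nonneg _) ?_ h0
      filter_upwards [hpos] with t ht
      have h1 : ‖A t * R - (R * R - R)‖ ≤ t := by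
        have : R * R - R = cfc (fun x : ℝ => x * x - x) R := by
          conv_lhs => rw [hR.mul_self_eq]
          conv_lhs => enter [2]; rw [← hR.cfc_id_eq]
          rw [← cfc_sub _ _ R (by fun_prop) (by fun_prop)]
        rw [this, hAdef, hR.cfc_mul_self_eq (hc t)]
        refine hR.norm_cfc_sub_le ((hc t).mul continuousOn_id) (by fun_prop) t.2 fun x hx => ?_
        have := abs_expResolvent_quotient_add_le (NNReal.coe_pos.2 ht) hx
        rwa [← sub_neg_eq_add, neg_sub] at this
      have h2 := (A t * R - (R * R - R)).le_opNorm g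
      exact h2.trans (mul_le_mul_of_nonneg_right h1 (norm_nonneg g))
  have e : -(g - R g) = (R - 1) g := by simp
  rw [IsGeneratorValue, e]
  refine key.congr fun t => ?_
  rw [hA, ← Complex.ofReal_inv, Complex.coe_smul]
  simp

/-- For w = (1 + sA)⁻¹g one has Aw = s⁻¹(g - w), hence (1 + A)w = w + s⁻¹(g - w). The proof is an
identity between functions of `R`, so that the unbounded A does not appear. -/
lemma scaled_mul (s : ℝ) (hs : 0 < s) (g : E) :
    resolventScaled R s g = R (resolventScaled R s g + s⁻¹ • (g - resolventScaled R s g)) := by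
  have hc := continuousOn_scaledResolvent hs
  have h1 : R * resolventScaled R s + s • resolventScaled R s - s • (R * resolventScaled R s)
      = R := by
    have hcomm : R * resolventScaled R s = cfc (fun x => x * scaledResolvent s x) R := by
      conv_lhs => enter [1]; rw [← hR.cfc_id_eq]
      exact hR.cfc_mul_eq continuousOn_id hc
    have c1 : ContinuousOn (fun x => x * scaledResolvent s x) (spectrum ℝ R) :=
      (continuousOn_id.mul hc).mono hR.spectrum_subset
    have c2 := hc.mono hR.spectrum_subset
    have c3 : ContinuousOn (fun x => s • scaledResolvent s x) (spectrum ℝ R) := c2.const_smul s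
    have c4 : ContinuousOn (fun x => s • (x * scaledResolvent s x)) (spectrum ℝ R) :=
      c1.const_smul s
    have c5 : ContinuousOn (fun x => x * scaledResolvent s x + s • scaledResolvent s x)
        (spectrum ℝ R) := c1.add c3
    rw [hcomm, resolventScaled, ← cfc_smul s _ R c2, ← cfc_smul s _ R c1,
      ← cfc_add R _ _ c1 c3, ← cfc_sub _ _ R c5 c4]
    conv_rhs => rw [← hR.cfc_id_eq]
    refine cfc_congr fun x hx => ?_
    have := (scaledResolvent_den_pos hs (hR.spectrum_subset hx)).ne'
    simp only [smul_eq_mul, scaledResolvent]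
    field_simp
    ring
  have h2 := congrArg (fun B : E →L[ℂ] E => B g) h1
  simp only [sub_apply, add_apply, smul_apply,
    mul_apply_eq_comp] at h2
  set w := resolventScaled R s g
  have h3 : R (s⁻¹ • (g - w)) = s⁻¹ • (R g - R w) := by
    rw [← Complex.coe_smul, map_smul, Complex.coe_smul, map_sub]
  have h4 : R g - R w = s • (w - R w) := by rw [← h2, smul_sub]; abel
  rw [map_add, h3, h4, smul_smul, inv_mul_cancel₀ hs.ne', one_smul, add_sub_cancel]

lemma norm_scaled_le {s : ℝ} (hs : 0 < s) : ‖resolventScaled R s‖ ≤ 1 :=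
  norm_cfc_le zero_le_one fun x hx => by
    rw [Real.norm_of_nonneg (scaledResolvent_nonneg hs (hR.spectrum_subset hx))]
    exact scaledResolvent_le_one hs (hR.spectrum_subset hx)

/-- The exponential formula `e^{-tA} = lim (1 + (t/n) A)^{-n}`. -/
theorem tendsto_scaled_pow {t : ℝ≥0} (ht : 0 < t) (u : E) :
    Tendsto (fun n : ℕ => (resolventScaled R ((t : ℝ) / (n + 1)) ^ (n + 1)) u) atTop
      (𝓝 (resolventSemigroup R t u)) := by
  have ht' : 0 < (t : ℝ) := NNReal.coe_pos.2 ht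
  have hs : ∀ n : ℕ, 0 < (t : ℝ) / (n + 1) := fun n => by positivity
  -- The error bound for the powers contains a², so two factors of the resolvent are needed.
  have hdense : DenseRange (R * R) := hR.denseRange.comp hR.denseRange R.continuous
  refine tendsto_apply_of_denseRange (Eventually.of_forall fun n => ?_) hdense (fun g => ?_) u
  · exact (norm_pow_le' _ n.succ_pos).trans
      (pow_le_one₀ (norm_nonneg _) (hR.norm_scaled_le (hs n)))
  · rw [tendsto_iff_norm_sub_tendsto_zero]
    have h0 : Tendsto (fun n : ℕ => (t : ℝ) ^ 2 / ((n : ℝ) + 1) * ‖g‖) atTop (𝓝 0) := by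
      have := (tendsto_one_div_add_atTop_nhds_zero_nat (𝕜 := ℝ)).const_mul ((t : ℝ) ^ 2)
      simpa [div_eq_mul_inv] using this.mul_const ‖g‖
    refine squeeze_zero (fun _ => norm_nonneg _) (fun n => ?_) h0
    have h1 : ‖resolventScaled R ((t : ℝ) / (n + 1)) ^ (n + 1) * (R * R)
        - resolventSemigroup R t * (R * R)‖ ≤ (t : ℝ) ^ 2 / (n + 1) := by
      have hc := continuousOn_scaledResolvent (hs n)
      have hsq : ContinuousOn (fun x : ℝ => x * x) (Set.Icc 0 1) := by fun_prop
      have hcp : ContinuousOn (fun x => scaledResolvent ((t : ℝ) / (n + 1)) x ^ (n + 1))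
        (Set.Icc 0 1) := hc.pow _
      rw [resolventSemigroup, if_neg ht.ne', resolventScaled,
        ← cfc_pow _ _ R (hc.mono hR.spectrum_subset) hR.isSelfAdjoint, hR.mul_self_eq,
        hR.cfc_mul_eq hcp hsq, hR.cfc_mul_eq (continuousOn_expResolvent ht') hsq]
      exact hR.norm_cfc_sub_le (hcp.mul hsq) ((continuousOn_expResolvent ht').mul hsq)
        (by positivity) fun x hx => abs_scaledResolvent_pow_sub_le ht' hx n
    exact (ContinuousLinearMap.le_opNorm _ g).trans
      (mul_le_mul_of_nonneg_right h1 (norm_nonneg g))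

end IsUnitResolvent

end ResolventSemigroup

/-! ### Resolvent and semigroup of a closed form; uniqueness -/

section FormResolvent

variable {E : Type*} [NormedAddCommGroup E] [InnerProductSpace ℂ E]
  {F : Type*} [NormedAddCommGroup F] [InnerProductSpace ℂ F]

/-- The form `q(u, v) = ⟨B u, B v⟩` on `D`, where `Γ` is the closed graph of `B` and `D` its
dense domain. -/
structure IsClosedForm (Γ : Submodule ℂ (WithLp 2 (E × F))) (D : Set E) (q : E → E → ℂ) :
    Prop where
  isClosed : IsClosed (Γ : Set (WithLp 2 (E × F)))
  mem_iff : ∀ u, u ∈ D ↔ ∃ w, WithLp.toLp 2 (u, w) ∈ Γ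
  form_eq : ∀ u v w w', WithLp.toLp 2 (u, w) ∈ Γ → WithLp.toLp 2 (v, w') ∈ Γ →
    q u v = inner ℂ w' w
  dense : ∀ g, (∀ v ∈ D, inner ℂ v g = 0) → g = 0

/-- `R = (1 + A)⁻¹`, where `A` is the operator associated with the form `q` on `D`. -/
structure IsFormResolvent [CompleteSpace E] (D : Set E) (q : E → E → ℂ) (R : E →L[ℂ] E) :
    Prop extends IsUnitResolvent R where
  isFormOperatorValue_iff : ∀ u f, IsFormOperatorValue D q u f ↔ R (u + f) = u

/-- The resolvent `(1 + B* B)⁻¹`, where `Γ` is the graph of `B`. -/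
def graphResolvent (Γ : Submodule ℂ (WithLp 2 (E × F))) [Γ.HasOrthogonalProjection] :
    E →L[ℂ] E :=
  (WithLp.fstL 2 ℂ E F).comp (Γ.starProjection.comp
    (((WithLp.prodContinuousLinearEquiv 2 ℂ E F).symm : E × F →L[ℂ] WithLp 2 (E × F)).comp
      (ContinuousLinearMap.inl ℂ E F)))

lemma graphResolvent_apply (Γ : Submodule ℂ (WithLp 2 (E × F))) [Γ.HasOrthogonalProjection]
    (g : E) : graphResolvent Γ g = (Γ.starProjection (WithLp.toLp 2 (g, (0 : F)))).fst := rfl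

lemma inner_graphResolvent_left (Γ : Submodule ℂ (WithLp 2 (E × F))) [Γ.HasOrthogonalProjection]
    (g h : E) : inner ℂ (graphResolvent Γ g) h = inner ℂ (Γ.starProjection (WithLp.toLp 2 (g, (0 : F))))
      (WithLp.toLp 2 (h, (0 : F))) := by
  simp [graphResolvent_apply, WithLp.prod_inner_apply]

lemma inner_graphResolvent_right (Γ : Submodule ℂ (WithLp 2 (E × F)))
    [Γ.HasOrthogonalProjection] (g h : E) : inner ℂ g (graphResolvent Γ h)
      = inner ℂ (WithLp.toLp 2 (g, (0 : F)))
          (Γ.starProjection (WithLp.toLp 2 (h, (0 : F)))) := by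
  simp [graphResolvent_apply, WithLp.prod_inner_apply]

/-- ⟨Rg, g⟩ = ‖P(g, 0)‖² for the orthogonal projection P onto `Γ`. -/
lemma isPositive_graphResolvent (Γ : Submodule ℂ (WithLp 2 (E × F)))
    [Γ.HasOrthogonalProjection] : (graphResolvent Γ).IsPositive := by
  refine ⟨fun g h => ?_, fun g => ?_⟩
  · change inner ℂ (graphResolvent Γ g) h = inner ℂ g (graphResolvent Γ h)
    rw [inner_graphResolvent_left, inner_graphResolvent_right,
      Submodule.inner_starProjection_left_eq_right]
  · rw [ContinuousLinearMap.reApplyInnerSelf_apply, inner_graphResolvent_left,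
      ← Γ.starProjection_eq_self_iff.2 (Γ.starProjection_apply_mem _),
      Submodule.inner_starProjection_left_eq_right]
    exact inner_self_nonneg

lemma norm_graphResolvent_le (Γ : Submodule ℂ (WithLp 2 (E × F)))
    [Γ.HasOrthogonalProjection] : ‖graphResolvent Γ‖ ≤ 1 := by
  refine ContinuousLinearMap.opNorm_le_bound _ zero_le_one fun g => ?_
  rw [one_mul, graphResolvent_apply]
  calc _ ≤ ‖Γ.starProjection (WithLp.toLp 2 (g, (0 : F)))‖ := WithLp.norm_fst_le _ _
    _ ≤ ‖WithLp.toLp 2 (g, (0 : F))‖ := Γ.norm_starProjection_apply_le _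
    _ = ‖g‖ := by simp

namespace IsClosedForm

variable {Γ : Submodule ℂ (WithLp 2 (E × F))} {D : Set E} {q : E → E → ℂ}

/-- The equality P(u + f, 0) = (u, Bu) says that (f, -Bu) is orthogonal to the graph, that is, ⟨Bv,
Bu⟩ = ⟨v, f⟩ for every v in the domain. -/
lemma isFormOperatorValue_iff (h : IsClosedForm Γ D q) [Γ.HasOrthogonalProjection] (u f : E) :
    IsFormOperatorValue D q u f ↔ graphResolvent Γ (u + f) = u := by
  constructor
  · rintro ⟨hu, hq⟩
    obtain ⟨w, hw⟩ := (h.mem_iff u).1 hu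
    have hp : Γ.starProjection (WithLp.toLp 2 (u + f, (0 : F))) = WithLp.toLp 2 (u, w) := by
      refine Submodule.eq_starProjection_of_mem_of_inner_eq_zero hw ?_
      rintro ⟨v, w'⟩ hv
      have h1 := hq v ((h.mem_iff v).2 ⟨w', hv⟩)
      rw [h.form_eq u v w w' hw hv] at h1
      have h2 := congrArg (starRingEnd ℂ) h1
      rw [inner_conj_symm, inner_conj_symm] at h2
      simp [WithLp.prod_inner_apply, h2]
    rw [graphResolvent_apply, hp]
    rfl
  · intro hu
    set p := Γ.starProjection (WithLp.toLp 2 (u + f, (0 : F))) with hp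
    have hpΓ : p ∈ Γ := Γ.starProjection_apply_mem _
    have hpu : p = WithLp.toLp 2 (u, p.snd) := by
      rw [graphResolvent_apply] at hu
      conv_rhs => rw [← hu]
      rfl
    rw [hpu] at hpΓ
    refine ⟨(h.mem_iff u).2 ⟨_, hpΓ⟩, fun v hv => ?_⟩
    obtain ⟨w', hw'⟩ := (h.mem_iff v).1 hv
    rw [h.form_eq u v _ w' hpΓ hw']
    have h1 := Γ.starProjection_inner_eq_zero (WithLp.toLp 2 (u + f, (0 : F))) _ hw'
    rw [← hp, hpu] at h1
    have h2 := congrArg (starRingEnd ℂ) h1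
    rw [inner_conj_symm, map_zero] at h2
    simp [WithLp.prod_inner_apply] at h2
    linear_combination -h2

theorem isFormResolvent [CompleteSpace E] [CompleteSpace F] (h : IsClosedForm Γ D q)
    [Γ.HasOrthogonalProjection] : IsFormResolvent D q (graphResolvent Γ) where
  isSelfAdjoint := (isPositive_graphResolvent Γ).isSelfAdjoint
  spectrum_subset x hx := by
    refine ⟨spectrum_nonneg_of_nonneg
      ((ContinuousLinearMap.nonneg_iff_isPositive _).2 (isPositive_graphResolvent Γ)) hx, ?_⟩
    have h1 := spectrum.norm_le_norm_mul_of_mem hx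
    have h2 : ‖(1 : E →L[ℂ] E)‖ ≤ 1 := ContinuousLinearMap.norm_id_le
    have h3 := norm_graphResolvent_le Γ
    calc x ≤ ‖x‖ := le_abs_self x
      _ ≤ _ := h1
      _ ≤ 1 := mul_le_one₀ h3 (norm_nonneg _) h2
  -- By self-adjointness the complement of the range is the kernel. If Rg = 0, then g is the value
  -- of the form operator at 0, so g is orthogonal to the dense form domain.
  denseRange := by
    have hsa := (isPositive_graphResolvent Γ).isSelfAdjoint
    have hker : ∀ g, graphResolvent Γ g = 0 → g = 0 := fun g hg => by
      have h1 := (h.isFormOperatorValue_iff 0 g).2 (by simpa using hg)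
      refine h.dense g fun v hv => ?_
      obtain ⟨w', hw'⟩ := (h.mem_iff v).1 hv
      rw [← h1.2 v hv, h.form_eq 0 v 0 w' Γ.zero_mem hw', inner_zero_right]
    have h1 : ((graphResolvent Γ : E →ₗ[ℂ] E).range)ᗮ = ⊥ := by
      rw [ContinuousLinearMap.orthogonal_range, ← ContinuousLinearMap.star_eq_adjoint,
        hsa.star_eq]
      exact LinearMap.ker_eq_bot'.2 hker
    have h2 := Submodule.topologicalClosure_eq_top_iff.2 h1
    exact Submodule.dense_iff_topologicalClosure_eq_top.2 h2
  isFormOperatorValue_iff := h.isFormOperatorValue_iff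

end IsClosedForm

namespace IsGeneratorValue

variable {T : ℝ≥0 → E →L[ℂ] E}

lemma sub {u u' g g' : E} (h : IsGeneratorValue T u g) (h' : IsGeneratorValue T u' g') :
    IsGeneratorValue T (u - u') (g - g') :=
  (Tendsto.sub h h').congr fun t => by rw [← smul_sub, map_sub]; congr 1; abel

/-- Contractions satisfy Re⟨u, T(t)u - u⟩ ≤ 0; dividing by t and letting t → 0 keeps the sign. -/
lemma re_inner_nonpos (hT : ∀ t, ‖T t‖ ≤ 1) {u g : E} (h : IsGeneratorValue T u g) :
    (inner ℂ u g).re ≤ 0 := by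
  have h1 : Tendsto (fun t : ℝ≥0 => (inner ℂ u ((((t : ℝ) : ℂ))⁻¹ • (T t u - u))).re) (𝓝[>] 0)
      (𝓝 (inner ℂ u g).re) :=
    (Complex.continuous_re.tendsto _).comp (tendsto_const_nhds.inner h)
  refine le_of_tendsto h1 (Eventually.of_forall fun t => ?_)
  rw [← Complex.ofReal_inv, inner_smul_right, Complex.re_ofReal_mul, inner_sub_right,
    Complex.sub_re]
  refine mul_nonpos_of_nonneg_of_nonpos (by positivity) (sub_nonpos.2 ?_)
  have h2 : (inner ℂ u (T t u)).re ≤ ‖u‖ * ‖u‖ :=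
    (Complex.re_le_norm _).trans ((norm_inner_le_norm _ _).trans
      (by gcongr; simpa using (T t).le_of_opNorm_le (hT t) u))
  have h3 : (inner ℂ u u).re = ‖u‖ * ‖u‖ := by
    have := inner_self_eq_norm_mul_norm (𝕜 := ℂ) u
    simpa using this
  rw [h3]; exact h2

end IsGeneratorValue

namespace IsFormResolvent

variable [CompleteSpace E] {D : Set E} {q : E → E → ℂ} {R : E →L[ℂ] E}

theorem isFormSemigroup (h : IsFormResolvent D q R) :
    IsFormSemigroup D q (resolventSemigroup R) where
  isC0Semigroup := h.isC0Semigroup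
  generator u f := by
    rw [h.isFormOperatorValue_iff]
    constructor
    · intro hu
      have := h.isGeneratorValue (u + f)
      rwa [hu, add_sub_cancel_left] at this
    · intro hu
      -- The generator maps w = u - R(u + f) to w itself; dissipativity then forces ‖w‖² ≤ 0. Hence
      -- the generator has no domain beyond the range of `R`.
      have h1 := hu.sub (h.isGeneratorValue (u + f))
      have e : -f - -(u + f - R (u + f)) = u - R (u + f) := by abel
      rw [e] at h1
      have h2 := h1.re_inner_nonpos h.norm_semigroup_le
      have h3 : (inner ℂ (u - R (u + f)) (u - R (u + f))).re
          = ‖u - R (u + f)‖ * ‖u - R (u + f)‖ := by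
        have := inner_self_eq_norm_mul_norm (𝕜 := ℂ) (u - R (u + f))
        simpa using this
      rw [h3] at h2
      have h4 : ‖u - R (u + f)‖ = 0 := by nlinarith [norm_nonneg (u - R (u + f))]
      exact (sub_eq_zero.1 (norm_eq_zero.1 h4)).symm

lemma re_inner_nonneg (h : IsFormResolvent D q R) {u f : E} (hu : IsFormOperatorValue D q u f) :
    0 ≤ (inner ℂ u f).re := by
  have := ((h.isFormSemigroup.generator u f).1 hu).re_inner_nonpos h.norm_semigroup_le
  rw [inner_neg_right, Complex.neg_re] at this
  linarith

lemma sub (h : IsFormResolvent D q R) {u f u' f' : E} (hu : IsFormOperatorValue D q u f)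
    (hu' : IsFormOperatorValue D q u' f') : IsFormOperatorValue D q (u - u') (f - f') := by
  rw [h.isFormOperatorValue_iff] at hu hu' ⊢
  rw [show u - u' + (f - f') = (u + f) - (u' + f') by abel, map_sub, hu, hu']

lemma isFormOperatorValue_scaled (h : IsFormResolvent D q R) {s : ℝ} (hs : 0 < s) (g : E) :
    IsFormOperatorValue D q (resolventScaled R s g) (s⁻¹ • (g - resolventScaled R s g)) := by
  rw [h.isFormOperatorValue_iff, ← h.scaled_mul s hs g]

end IsFormResolvent

/-- The limit defining the generator gives right derivatives, which suffice for the monotonicity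
argument in the uniqueness proof. -/
lemma IsC0Semigroup.hasDerivWithinAt {T : ℝ≥0 → E →L[ℂ] E} (hT : IsC0Semigroup T) {u g : E}
    (h : IsGeneratorValue T u g) {t : ℝ} (ht : 0 ≤ t) :
    HasDerivWithinAt (fun s : ℝ => T s.toNNReal u) (T t.toNNReal g) (Set.Ici t) t := by
  rw [← hasDerivWithinAt_Ioi_iff_Ici, hasDerivWithinAt_iff_tendsto_slope' (by simp)]
  have h1 : Tendsto (fun s : ℝ => (s - t).toNNReal) (𝓝[>] t) (𝓝[>] 0) := by
    refine tendsto_nhdsWithin_iff.2 ⟨?_, ?_⟩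
    · have : Continuous fun s : ℝ => (s - t).toNNReal := by fun_prop
      simpa using (this.tendsto t).mono_left nhdsWithin_le_nhds
    · filter_upwards [self_mem_nhdsWithin] with s hs
      simpa using hs
  refine (((T t.toNNReal).continuous.tendsto _).comp (h.comp h1)).congr' ?_
  filter_upwards [self_mem_nhdsWithin] with s hs
  have hs' : 0 < s - t := sub_pos.2 hs
  have e : s.toNNReal = t.toNNReal + (s - t).toNNReal := by
    rw [← Real.toNNReal_add ht hs'.le, add_sub_cancel]
  simp only [Function.comp_apply, slope_def_module]
  rw [e, hT.map_add, Real.coe_toNNReal _ hs'.le, ← Complex.ofReal_inv, map_smul, Complex.coe_smul,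
    map_sub]
  rfl

lemma IsC0Semigroup.isGeneratorValue_apply {T : ℝ≥0 → E →L[ℂ] E} (hT : IsC0Semigroup T) {u g : E}
    (h : IsGeneratorValue T u g) (s : ℝ≥0) : IsGeneratorValue T (T s u) (T s g) := by
  refine (((T s).continuous.tendsto _).comp h).congr fun t => ?_
  simp only [Function.comp_apply]
  rw [map_smul, map_sub, ← ContinuousLinearMap.comp_apply, ← hT.map_add, add_comm, hT.map_add]
  rfl

/-- The semigroup generated by the operator associated with a closed form is unique. -/
theorem IsFormResolvent.isFormSemigroup_unique [CompleteSpace E] {D : Set E} {q : E → E → ℂ}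
    {R : E →L[ℂ] E} (h : IsFormResolvent D q R) {S T : ℝ≥0 → E →L[ℂ] E}
    (hS : IsFormSemigroup D q S) (hT : IsFormSemigroup D q T) : S = T := by
  have key : ∀ g t, S t (R g) = T t (R g) := by
    intro g t
    set u := R g with hu
    have hu' : IsFormOperatorValue D q u (g - u) := by
      rw [h.isFormOperatorValue_iff, add_sub_cancel, hu]
    set f := g - u
    let w : ℝ → E := fun s => S s.toNNReal u - T s.toNNReal u
    have hw : ∀ s, IsFormOperatorValue D q (w s) (S s.toNNReal f - T s.toNNReal f) := fun s => by
      refine h.sub ?_ ?_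
      · rw [hS.generator, ← map_neg]
        exact hS.isC0Semigroup.isGeneratorValue_apply ((hS.generator _ _).1 hu') _
      · rw [hT.generator, ← map_neg]
        exact hT.isC0Semigroup.isGeneratorValue_apply ((hT.generator _ _).1 hu') _
    have hd : ∀ s, 0 ≤ s → HasDerivWithinAt w (-(S s.toNNReal f - T s.toNNReal f))
        (Set.Ici s) s := fun s hs => by
      have := (hS.isC0Semigroup.hasDerivWithinAt ((hS.generator _ _).1 hu') hs).sub
        (hT.isC0Semigroup.hasDerivWithinAt ((hT.generator _ _).1 hu') hs)
      have e : S s.toNNReal (-f) - T s.toNNReal (-f) = -(S s.toNNReal f - T s.toNNReal f) := by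
        rw [map_neg, map_neg]; abel
      rwa [e] at this
    have hc : Continuous w :=
      ((hS.isC0Semigroup.continuous_orbit u).comp continuous_real_toNNReal).sub
        ((hT.isC0Semigroup.continuous_orbit u).comp continuous_real_toNNReal)
    let _ : InnerProductSpace ℝ E := InnerProductSpace.complexToReal
    -- The derivative of ‖w‖² is -2 Re⟨w, Aw⟩ ≤ 0. The sign is a property of A alone: contractivity
    -- of `S` and `T` is not assumed.
    have h1 := image_le_of_deriv_right_le_deriv_boundary (f := fun s => ‖w s‖ ^ 2) (a := 0)
      (b := (t : ℝ)) (hc.norm.pow 2).continuousOn (fun s hs => (hd s hs.1).norm_sq)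
      (B := fun _ => 0) (B' := fun _ => 0)
      (by simp [w, hS.isC0Semigroup.map_zero, hT.isC0Semigroup.map_zero])
      continuousOn_const (fun s _ => hasDerivWithinAt_const _ _ _)
      (fun s _ => by
        have h2 := h.re_inner_nonneg (hw s)
        rw [inner_neg_right, real_inner_eq_re_inner ℂ]
        simp only [RCLike.re_eq_complex_re]
        linarith) (Set.right_mem_Icc.2 t.2)
    have h3 : ‖w t‖ = 0 := by
      have := norm_nonneg (w t)
      nlinarith
    simpa [w, sub_eq_zero] using h3
  funext t
  ext1 u
  exact congrFun (h.denseRange.equalizer (S t).continuous (T t).continuous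
    (funext fun g => key g t)) u

end FormResolvent

/-! ### The magnetic gradient as a closed operator on L² -/

section MagneticGradient

variable {d : ℕ}

/-- `L²(ℝ^d; ℂ^d)`. -/
abbrev L2Grad (d : ℕ) : Type :=
  Lp (EuclideanSpace ℂ (Fin d)) 2 (volume : Measure (EuclideanSpace ℝ (Fin d)))

/-- `P` is the distribution `∇f - i a f`. -/
def IsMagneticGradient (a : EuclideanSpace ℝ (Fin d) → EuclideanSpace ℝ (Fin d))
    (f : EuclideanSpace ℝ (Fin d) → ℂ)
    (P : EuclideanSpace ℝ (Fin d) → EuclideanSpace ℂ (Fin d)) : Prop :=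
  ∀ k, IsWeakDeriv volume (EuclideanSpace.single k 1) f
    fun x => P x k + Complex.I * (a x k : ℂ) * f x

lemma IsMagneticGradient.congr {a : EuclideanSpace ℝ (Fin d) → EuclideanSpace ℝ (Fin d)}
    {f f' : EuclideanSpace ℝ (Fin d) → ℂ}
    {P P' : EuclideanSpace ℝ (Fin d) → EuclideanSpace ℂ (Fin d)}
    (h : IsMagneticGradient a f P) (hf : f =ᵐ[volume] f') (hP : P =ᵐ[volume] P') :
    IsMagneticGradient a f' P' := fun k =>
  (h k).congr hf (by filter_upwards [hf, hP] with x h1 h2; rw [h1, h2])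

lemma locallyIntegrable_euclidean_iff {X : Type*} [TopologicalSpace X] [MeasurableSpace X]
    {μ : Measure X} {ι : Type*} [Fintype ι] {G : X → EuclideanSpace ℂ ι} :
    LocallyIntegrable G μ ↔ ∀ k, LocallyIntegrable (fun x => G x k) μ := by
  classical
  constructor
  · intro h k x
    obtain ⟨s, hs, h1⟩ := h x
    exact ⟨s, hs, (EuclideanSpace.proj (𝕜 := ℂ) k).integrable_comp h1⟩
  · intro h x
    choose s hs h1 using fun k => h k x
    refine ⟨⋂ k, s k, (iInter_mem).2 hs, ?_⟩
    have h2 : IntegrableOn (fun x => ∑ k, G x k • EuclideanSpace.single k (1 : ℂ)) (⋂ k, s k) μ := by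
      refine integrable_finsetSum _ fun k _ => ?_
      have h3 := (h1 k).mono_set (Set.iInter_subset s k)
      exact h3.smul_const _
    convert h2 using 2 with y
    ext j
    simp [Pi.single_apply]

lemma isWeakGradient_iff {f : EuclideanSpace ℝ (Fin d) → ℂ}
    {G : EuclideanSpace ℝ (Fin d) → EuclideanSpace ℂ (Fin d)}
    (hf : LocallyIntegrable f volume) :
    IsWeakGradient f G ↔
      ∀ k, IsWeakDeriv volume (EuclideanSpace.single k 1) f fun x => G x k := by
  constructor
  · intro h k
    refine ⟨hf, locallyIntegrable_euclidean_iff.1 h.locallyIntegrable_grad k, fun φ h1 h2 => ?_⟩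
    simpa only [Complex.real_smul] using h.integral_eq φ h1 h2 k
  · intro h
    refine ⟨hf, locallyIntegrable_euclidean_iff.2 fun k => (h k).locallyIntegrable_deriv,
      fun φ h1 h2 k => ?_⟩
    simpa only [Complex.real_smul] using (h k).integral_eq φ h1 h2

lemma HasWeakGradient.isWeakGradient {f : EuclideanSpace ℝ (Fin d) → ℂ} (h : HasWeakGradient f) :
    IsWeakGradient f (weakGradient f) := by
  rw [weakGradient, dif_pos h]
  exact h.choose_spec

lemma HasL2MagneticGradient.isMagneticGradient
    {a : EuclideanSpace ℝ (Fin d) → EuclideanSpace ℝ (Fin d)}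
    {f : EuclideanSpace ℝ (Fin d) → ℂ} (h : HasL2MagneticGradient a f) :
    IsMagneticGradient a f (magneticGradient a f) := by
  have h1 := h.1.isWeakGradient
  intro k
  simpa [magneticGradient] using (isWeakGradient_iff h1.locallyIntegrable).1 h1 k

lemma IsMagneticGradient.hasL2MagneticGradient
    {a : EuclideanSpace ℝ (Fin d) → EuclideanSpace ℝ (Fin d)}
    {f : EuclideanSpace ℝ (Fin d) → ℂ} (hf : LocallyIntegrable f volume)
    {P : EuclideanSpace ℝ (Fin d) → EuclideanSpace ℂ (Fin d)}
    (h : IsMagneticGradient a f P) (hP : MemLp P 2 volume) :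
    HasL2MagneticGradient a f ∧ magneticGradient a f =ᵐ[volume] P := by
  have h1 : IsWeakGradient f
      (fun x => WithLp.toLp 2 fun k => P x k + Complex.I * (a x k : ℂ) * f x) :=
    (isWeakGradient_iff hf).2 h
  have h2 : HasWeakGradient f := ⟨_, h1⟩
  have h3 : magneticGradient a f =ᵐ[volume] P := by
    have h4 := (isWeakGradient_iff hf).1 h2.isWeakGradient
    have h5 : ∀ᵐ x, ∀ k, weakGradient f x k = P x k + Complex.I * (a x k : ℂ) * f x :=
      ae_all_iff.2 fun k => (h4 k).ae_unique (h k)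
    filter_upwards [h5] with x hx
    ext k
    simp [magneticGradient, hx k]
  exact ⟨⟨h2, hP.ae_eq h3.symm⟩, h3⟩

variable {a : EuclideanSpace ℝ (Fin d) → EuclideanSpace ℝ (Fin d)}
  (ha : ∀ K : Set (EuclideanSpace ℝ (Fin d)), IsCompact K → MemLp a 2 (volume.restrict K))

section
include ha

/-- Since φa is in L², testing a f against φ is a bounded functional of f ∈ L², although a f itself
is only locally integrable. -/
lemma memLp_cutoff_smul_potential {φ : EuclideanSpace ℝ (Fin d) → ℝ} (hφ : Continuous φ)
    (hφc : HasCompactSupport φ) (k : Fin d) :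
    MemLp (fun x => ((φ x * a x k : ℝ) : ℂ)) 2 volume := by
  have h1 : MemLp ((tsupport φ).indicator a) 2 volume :=
    (memLp_indicator_iff_restrict hφc.isCompact.measurableSet).2 (ha _ hφc.isCompact)
  have h2 : MemLp φ ⊤ volume := hφ.memLp_of_hasCompactSupport hφc
  have h3 : MemLp (fun x => φ x • (tsupport φ).indicator a x) 2 volume := h1.smul h2
  refine ((EuclideanSpace.proj (𝕜 := ℝ) k).comp_memLp' h3).ofReal.ae_eq
    (Eventually.of_forall fun x => ?_)
  by_cases hx : x ∈ tsupport φ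
  · simp [hx]
  · simp [hx, image_eq_zero_of_notMem_tsupport hx]

lemma locallyIntegrable_potential_mul {f : EuclideanSpace ℝ (Fin d) → ℂ} (hf : MemLp f 2 volume)
    (k : Fin d) : LocallyIntegrable (fun x => (a x k : ℂ) * f x) volume := by
  rw [locallyIntegrable_iff]
  intro K hK
  have h1 := ((EuclideanSpace.proj (𝕜 := ℝ) k).comp_memLp' (ha K hK)).ofReal (K := ℂ)
  exact h1.integrable_mul (hf.restrict K)

/-- For L² data local integrability is automatic. What remains are integral identities, each
continuous in (f, P), and this makes the graph closed. -/
lemma isMagneticGradient_iff {f : EuclideanSpace ℝ (Fin d) → ℂ}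
    {P : EuclideanSpace ℝ (Fin d) → EuclideanSpace ℂ (Fin d)} (hf : MemLp f 2 volume)
    (hP : MemLp P 2 volume) :
    IsMagneticGradient a f P ↔ ∀ k (φ : EuclideanSpace ℝ (Fin d) → ℝ), ContDiff ℝ ∞ φ →
      HasCompactSupport φ → ∫ x, fderiv ℝ φ x (EuclideanSpace.single k 1) • f x
        = -∫ x, φ x • (P x k + Complex.I * (a x k : ℂ) * f x) := by
  refine ⟨fun h k φ h1 h2 => (h k).integral_eq φ h1 h2, fun h k =>
    ⟨hf.locallyIntegrable (by norm_num), ?_, h k⟩⟩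
  refine (locallyIntegrable_euclidean_iff.1 (hP.locallyIntegrable (by norm_num)) k).add ?_
  simp only [mul_assoc]
  exact (locallyIntegrable_potential_mul ha hf k).smul Complex.I

end

include ha in
lemma memLp_magneticTest_fst (k : Fin d) {φ : EuclideanSpace ℝ (Fin d) → ℝ} (hφ : ContDiff ℝ ∞ φ)
    (hφc : HasCompactSupport φ) :
    MemLp (fun x => ((fderiv ℝ φ x (EuclideanSpace.single k 1) : ℝ) : ℂ)
      - Complex.I * ((φ x * a x k : ℝ) : ℂ)) 2 volume :=
  ((hφ.fderiv_apply_const _).continuous.memLp_of_hasCompactSupport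
    (hφc.fderiv_apply ℝ _)).ofReal.sub
      ((memLp_cutoff_smul_potential ha hφ.continuous hφc k).const_mul Complex.I)

lemma memLp_magneticTest_snd (k : Fin d) {φ : EuclideanSpace ℝ (Fin d) → ℝ} (hφ : ContDiff ℝ ∞ φ)
    (hφc : HasCompactSupport φ) :
    MemLp (fun x => ((φ x : ℝ) : ℂ) • EuclideanSpace.single k (1 : ℂ)) 2 volume :=
  ((ContinuousLinearMap.id ℂ ℂ).smulRight (EuclideanSpace.single k (1 : ℂ))).comp_memLp'
    (hφ.continuous.memLp_of_hasCompactSupport hφc).ofReal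

/-- The functional on `L² × L²` whose vanishing for all test functions `φ` says that the second
argument is the magnetic gradient of the first one. -/
def magneticTest (k : Fin d) {φ : EuclideanSpace ℝ (Fin d) → ℝ} (hφ : ContDiff ℝ ∞ φ)
    (hφc : HasCompactSupport φ) : WithLp 2 (L2Scalar d × L2Grad d) →L[ℂ] ℂ :=
  (innerSL ℂ (memLp_magneticTest_fst ha k hφ hφc).toLp).comp (WithLp.fstL 2 ℂ _ _)
  + (innerSL ℂ (memLp_magneticTest_snd k hφ hφc).toLp).comp (WithLp.sndL 2 ℂ _ _)

lemma magneticTest_apply (k : Fin d) {φ : EuclideanSpace ℝ (Fin d) → ℝ} (hφ : ContDiff ℝ ∞ φ)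
    (hφc : HasCompactSupport φ) (p : WithLp 2 (L2Scalar d × L2Grad d)) :
    magneticTest ha k hφ hφc p = (∫ x, fderiv ℝ φ x (EuclideanSpace.single k 1) • p.fst x)
        + ∫ x, φ x • (p.snd x k + Complex.I * (a x k : ℂ) * p.fst x) := by
  have hu : MemLp p.fst 2 volume := Lp.memLp _
  have hP : MemLp p.snd 2 volume := Lp.memLp _
  have hloc : LocallyIntegrable (fun x => Complex.I * (a x k : ℂ) * p.fst x) volume := by
    simp only [mul_assoc]
    exact (locallyIntegrable_potential_mul ha hu k).smul Complex.I
  have i1 : Integrable (fun x => fderiv ℝ φ x (EuclideanSpace.single k 1) • p.fst x) volume :=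
    integrable_fderiv_smul (hu.locallyIntegrable (by norm_num)) hφ hφc
  have i2 : Integrable (fun x => φ x • p.snd x k) volume :=
    (locallyIntegrable_euclidean_iff.1 (hP.locallyIntegrable (by norm_num))
      k).integrable_smul_left_of_hasCompactSupport hφ.continuous hφc
  have i3 : Integrable (fun x => φ x • (Complex.I * (a x k : ℂ) * p.fst x)) volume :=
    hloc.integrable_smul_left_of_hasCompactSupport hφ.continuous hφc
  simp only [magneticTest, add_apply, ContinuousLinearMap.comp_apply,
    innerSL_apply_apply, WithLp.fstL_apply, WithLp.sndL_apply, L2.inner_def]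
  simp only [smul_add]
  rw [integral_add i2 i3, add_comm (∫ x, φ x • p.snd x k), ← add_assoc, ← integral_add i1 i3]
  congr 1
  · refine integral_congr_ae ?_
    filter_upwards [(memLp_magneticTest_fst ha k hφ hφc).coeFn_toLp] with x hx
    rw [hx]
    simp [RCLike.inner_apply, Complex.real_smul]
    ring
  · refine integral_congr_ae ?_
    filter_upwards [(memLp_magneticTest_snd k hφ hφc).coeFn_toLp] with x hx
    rw [hx, inner_smul_left, EuclideanSpace.inner_single_left]
    simp [Complex.real_smul]

/-- The graph of the magnetic gradient on `L²`. -/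
def magneticGraph : Submodule ℂ (WithLp 2 (L2Scalar d × L2Grad d)) :=
  ⨅ (k : Fin d) (φ : {φ : EuclideanSpace ℝ (Fin d) → ℝ // ContDiff ℝ ∞ φ ∧ HasCompactSupport φ}),
    (magneticTest ha k φ.2.1 φ.2.2).ker

lemma isClosed_magneticGraph :
    IsClosed (magneticGraph ha : Set (WithLp 2 (L2Scalar d × L2Grad d))) := by
  simp only [magneticGraph, Submodule.coe_iInf]
  exact isClosed_iInter fun k => isClosed_iInter fun φ => ContinuousLinearMap.isClosed_ker _

lemma mem_magneticGraph_iff (p : WithLp 2 (L2Scalar d × L2Grad d)) :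
    p ∈ magneticGraph ha ↔ IsMagneticGradient a p.fst p.snd := by
  rw [isMagneticGradient_iff ha (Lp.memLp _) (Lp.memLp _)]
  simp only [magneticGraph, Submodule.mem_iInf, LinearMap.mem_ker, Subtype.forall]
  refine forall_congr' fun k => forall_congr' fun φ => ?_
  constructor
  · intro h h1 h2
    rw [eq_neg_iff_add_eq_zero, ← magneticTest_apply ha k h1 h2 p]
    exact h ⟨h1, h2⟩
  · intro h hφ
    have := h hφ.1 hφ.2
    rwa [eq_neg_iff_add_eq_zero, ← magneticTest_apply ha k hφ.1 hφ.2 p] at this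

end MagneticGradient

/-! ### Multiplication operators have closed graphs -/

section MultiplicationGraph

variable {X : Type*} [MeasurableSpace X] {μ : Measure X}
  {E₁ : Type*} [NormedAddCommGroup E₁] [InnerProductSpace ℂ E₁]
  {E₂ : Type*} [NormedAddCommGroup E₂] [InnerProductSpace ℂ E₂]

/-- The graph of the operator of multiplication by `M` on `L²`. -/
def multiplicationGraph (μ : Measure X) (M : X → E₁ →L[ℂ] E₂) :
    Submodule ℂ (WithLp 2 (Lp E₁ 2 μ × Lp E₂ 2 μ)) where
  carrier := {p | p.snd =ᵐ[μ] fun x => M x (p.fst x)}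
  add_mem' {p q} hp hq := by
    change (p + q).snd =ᵐ[μ] fun x => M x ((p + q).fst x)
    filter_upwards [hp, hq, Lp.coeFn_add p.fst q.fst, Lp.coeFn_add p.snd q.snd] with x h1 h2 h3 h4
    rw [WithLp.add_fst, WithLp.add_snd, h3, h4, Pi.add_apply, Pi.add_apply, h1, h2, map_add]
  zero_mem' := by
    change (0 : WithLp 2 (Lp E₁ 2 μ × Lp E₂ 2 μ)).snd =ᵐ[μ]
      fun x => M x ((0 : WithLp 2 (Lp E₁ 2 μ × Lp E₂ 2 μ)).fst x)
    filter_upwards [Lp.coeFn_zero E₁ 2 μ, Lp.coeFn_zero E₂ 2 μ] with x h1 h2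
    rw [WithLp.zero_fst, WithLp.zero_snd, h1, h2]
    simp
  smul_mem' c p hp := by
    change (c • p).snd =ᵐ[μ] fun x => M x ((c • p).fst x)
    filter_upwards [hp, Lp.coeFn_smul c p.fst, Lp.coeFn_smul c p.snd] with x h1 h2 h3
    rw [WithLp.smul_fst, WithLp.smul_snd, h2, h3, Pi.smul_apply, Pi.smul_apply, h1, map_smul]

/-- Along a common subsequence both components converge a.e., and each `M x` is continuous.
Measurability of `M` in `x` plays no role. -/
lemma isClosed_multiplicationGraph (M : X → E₁ →L[ℂ] E₂) :
    IsClosed (multiplicationGraph μ M : Set (WithLp 2 (Lp E₁ 2 μ × Lp E₂ 2 μ))) := by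
  refine IsSeqClosed.isClosed fun p q hp hq => ?_
  have h1 : Tendsto (fun n => (p n).fst) atTop (𝓝 q.fst) :=
    ((WithLp.fstL 2 ℂ _ _).continuous.tendsto q).comp hq
  have h2 : Tendsto (fun n => (p n).snd) atTop (𝓝 q.snd) :=
    ((WithLp.sndL 2 ℂ _ _).continuous.tendsto q).comp hq
  obtain ⟨n₁, hn₁, h3⟩ := (tendstoInMeasure_of_tendsto_Lp h1).exists_seq_tendsto_ae
  obtain ⟨n₂, hn₂, h4⟩ := (tendstoInMeasure_of_tendsto_Lp
    (h2.comp hn₁.tendsto_atTop)).exists_seq_tendsto_ae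
  have h5 : ∀ᵐ x ∂μ, ∀ n, (p n).snd x = M x ((p n).fst x) := ae_all_iff.2 hp
  change q.snd =ᵐ[μ] fun x => M x (q.fst x)
  filter_upwards [h3, h4, h5] with x h6 h7 h8
  refine tendsto_nhds_unique h7 ?_
  simp only [Function.comp_apply, h8]
  exact ((M x).continuous.tendsto _).comp (h6.comp hn₂.tendsto_atTop)

end MultiplicationGraph

/-! ### Smallest eigenvalue and square root of the potential -/

section Matrices

open scoped ComplexOrder

variable {m : ℕ}

/-- Shifting by `c` reduces the claim to positive semidefiniteness of M - c. The condition m ≥ 1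
makes the set of eigenvalues nonempty, so that its infimum is meaningful. -/
lemma le_smallestEigenvalue_iff (hm : 1 ≤ m) {M : Matrix (Fin m) (Fin m) ℝ} (hM : M.IsSymm)
    (c : ℝ) : c ≤ smallestEigenvalue M ↔
      ∀ z : Fin m → ℝ, c * (z ⬝ᵥ z) ≤ z ⬝ᵥ M.mulVec z := by
  have hH : M.IsHermitian := by rwa [Matrix.IsHermitian, Matrix.conjTranspose_eq_transpose_of_trivial]
  have hev : ∀ (N : Matrix (Fin m) (Fin m) ℝ) (hN : N.IsHermitian) (i : Fin m),
      (hN.eigenvectorBasis i).ofLp ≠ 0 := fun N hN i h0 => by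
    have h2 : ‖hN.eigenvectorBasis i‖ = 1 := (hN.eigenvectorBasis.orthonormal).1 i
    rw [show hN.eigenvectorBasis i = 0 from by ext j; exact congrFun h0 j] at h2
    simp at h2
  have hne : {μ : ℝ | Module.End.HasEigenvalue (Matrix.toLin' M) μ}.Nonempty := by
    refine ⟨hH.eigenvalues ⟨0, hm⟩, Module.End.hasEigenvalue_of_hasEigenvector
      (x := (hH.eigenvectorBasis ⟨0, hm⟩).ofLp) ⟨?_, hev _ hH _⟩⟩
    rw [Module.End.mem_eigenspace_iff, Matrix.toLin'_apply, hH.mulVec_eigenvectorBasis]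
  have hbdd : BddBelow {μ : ℝ | Module.End.HasEigenvalue (Matrix.toLin' M) μ} :=
    (Module.End.finite_hasEigenvalue _).bddBelow
  rw [smallestEigenvalue, le_csInf_iff hbdd hne]
  constructor
  · intro h
    have hH' : (M - c • (1 : Matrix (Fin m) (Fin m) ℝ)).IsHermitian :=
      hH.sub (by simp [Matrix.IsHermitian])
    have hpos := (hH'.posSemidef_iff_eigenvalues_nonneg).2 fun i => by
      have h1 := hH'.mulVec_eigenvectorBasis i
      have h2 : Module.End.HasEigenvalue (Matrix.toLin' M) (hH'.eigenvalues i + c) := by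
        refine Module.End.hasEigenvalue_of_hasEigenvector
          (x := (hH'.eigenvectorBasis i).ofLp) ⟨?_, hev _ hH' _⟩
        rw [Module.End.mem_eigenspace_iff, Matrix.toLin'_apply, add_smul, ← h1, Matrix.sub_mulVec,
          Matrix.smul_mulVec, Matrix.one_mulVec, sub_add_cancel]
      have := h _ h2
      simp only [Pi.zero_apply]
      linarith
    intro z
    have := hpos.dotProduct_mulVec_nonneg z
    rw [Matrix.sub_mulVec, Matrix.smul_mulVec, Matrix.one_mulVec, star_trivial, dotProduct_sub,
      dotProduct_smul, smul_eq_mul] at this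
    linarith
  · intro h μ hμ
    obtain ⟨v, hv⟩ := Module.End.HasEigenvalue.exists_hasEigenvector hμ
    have h1 := h v
    have h2 : M.mulVec v = μ • v := by
      rw [← Matrix.toLin'_apply]; exact hv.apply_eq_smul
    rw [h2, dotProduct_smul, smul_eq_mul] at h1
    have h3 : 0 < v ⬝ᵥ v := by
      refine lt_of_le_of_ne (Finset.sum_nonneg fun i _ => mul_self_nonneg (v i)) fun h0 => ?_
      exact hv.2 (dotProduct_self_eq_zero.1 h0.symm)
    exact le_of_mul_le_mul_right h1 h3

/-- As `M` is real, products of real with imaginary parts of `z` enter only the imaginary part. -/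
lemma re_inner_complexify (M : Matrix (Fin m) (Fin m) ℝ) (z : EuclideanSpace ℂ (Fin m)) :
    (inner ℂ z (Matrix.toEuclideanLin (complexify M) z)).re
      = (fun i => (z i).re) ⬝ᵥ M.mulVec (fun i => (z i).re)
        + (fun i => (z i).im) ⬝ᵥ M.mulVec (fun i => (z i).im) := by
  simp only [PiLp.inner_apply, Matrix.toLpLin_apply, Matrix.mulVec, dotProduct, complexify,
    Matrix.map_apply, RCLike.inner_apply, Complex.re_sum, Complex.mul_re, Complex.im_sum,
    Complex.mul_im, Complex.ofReal_re, Complex.ofReal_im, Complex.conj_re, Complex.conj_im]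
  rw [← Finset.sum_add_distrib]
  refine Finset.sum_congr rfl fun i _ => ?_
  simp only [zero_mul, sub_zero, add_zero]
  ring

lemma isHermitian_complexify {M : Matrix (Fin m) (Fin m) ℝ} (hM : M.IsSymm) :
    (complexify M).IsHermitian := by
  ext i j
  simp [complexify, hM.apply i j]

lemma smallestEigenvalue_mul_le (hm : 1 ≤ m) {M : Matrix (Fin m) (Fin m) ℝ} (hM : M.IsSymm)
    (z : EuclideanSpace ℂ (Fin m)) : smallestEigenvalue M * ‖z‖ ^ 2
      ≤ (inner ℂ z (Matrix.toEuclideanLin (complexify M) z)).re := by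
  have h := (le_smallestEigenvalue_iff hm hM _).1 le_rfl
  have e : ‖z‖ ^ 2 = (fun i => (z i).re) ⬝ᵥ (fun i => (z i).re)
      + (fun i => (z i).im) ⬝ᵥ (fun i => (z i).im) := by
    rw [EuclideanSpace.norm_sq_eq]
    simp only [dotProduct, ← Finset.sum_add_distrib]
    refine Finset.sum_congr rfl fun i _ => ?_
    rw [← Complex.normSq_eq_norm_sq, Complex.normSq_apply]
  rw [re_inner_complexify, e, mul_add]
  exact add_le_add (h _) (h _)

lemma posSemidef_complexify (hm : 1 ≤ m) {M : Matrix (Fin m) (Fin m) ℝ} (hM : M.IsSymm)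
    (h0 : 0 ≤ smallestEigenvalue M) : (complexify M).PosSemidef := by
  have hH := isHermitian_complexify hM
  rw [hH.posSemidef_iff_eigenvalues_nonneg]
  intro i
  have h1 := smallestEigenvalue_mul_le hm hM (hH.eigenvectorBasis i)
  have h2 : ‖hH.eigenvectorBasis i‖ = 1 := (hH.eigenvectorBasis.orthonormal).1 i
  have h3 : Matrix.toEuclideanLin (complexify M) (hH.eigenvectorBasis i)
      = ((hH.eigenvalues i : ℝ) : ℂ) • hH.eigenvectorBasis i := by
    rw [Matrix.toLpLin_apply, hH.mulVec_eigenvectorBasis]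
    ext j
    simp
  rw [h3, inner_smul_right, Complex.re_ofReal_mul, h2] at h1
  have h4 : (inner ℂ (hH.eigenvectorBasis i) (hH.eigenvectorBasis i)).re = 1 := by
    rw [inner_self_eq_norm_sq_to_K, h2]; simp
  rw [h4] at h1
  simp only [Pi.zero_apply]
  linarith

lemma isHermitian_matrixSqrt (M : Matrix (Fin m) (Fin m) ℝ) : (matrixSqrt M).IsHermitian :=
  cfc_predicate (R := ℝ) (p := IsSelfAdjoint) Real.sqrt (complexify M)

lemma matrixSqrt_mul_self {M : Matrix (Fin m) (Fin m) ℝ} (h : (complexify M).PosSemidef) :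
    matrixSqrt M * matrixSqrt M = complexify M := by
  have hsa : IsSelfAdjoint (complexify M) := h.1
  rw [matrixSqrt, ← cfc_mul Real.sqrt Real.sqrt (complexify M)
    Real.continuous_sqrt.continuousOn Real.continuous_sqrt.continuousOn]
  conv_rhs => rw [← cfc_id' ℝ (complexify M) hsa]
  refine cfc_congr fun x hx => ?_
  rw [h.1.spectrum_real_eq_range_eigenvalues] at hx
  obtain ⟨i, rfl⟩ := hx
  exact Real.mul_self_sqrt (h.eigenvalues_nonneg i)

lemma inner_matrixSqrt {M : Matrix (Fin m) (Fin m) ℝ} (h : (complexify M).PosSemidef)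
    (u v : EuclideanSpace ℂ (Fin m)) :
    inner ℂ (Matrix.toEuclideanLin (matrixSqrt M) v) (Matrix.toEuclideanLin (matrixSqrt M) u)
      = inner ℂ v (Matrix.toEuclideanLin (complexify M) u) := by
  conv_lhs => rw [← (isHermitian_matrixSqrt M).eq]
  rw [Matrix.toEuclideanLin_conjTranspose_eq_adjoint, LinearMap.adjoint_inner_left,
    ← Matrix.toEuclideanLin_conjTranspose_eq_adjoint, (isHermitian_matrixSqrt M).eq]
  congr 1
  simp only [Matrix.toLpLin_apply, Matrix.mulVec_mulVec, matrixSqrt_mul_self h]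

lemma norm_matrixSqrt_sq {M : Matrix (Fin m) (Fin m) ℝ}
    (h : (complexify M).PosSemidef) (u : EuclideanSpace ℂ (Fin m)) :
    ‖Matrix.toEuclideanLin (matrixSqrt M) u‖ ^ 2
      = (inner ℂ u (Matrix.toEuclideanLin (complexify M) u)).re := by
  rw [← inner_matrixSqrt h, inner_self_eq_norm_sq_to_K]
  norm_cast

/-- Weierstrass on [-n, n] with error 1/(n + 1). It serves to show that V^{1/2} is measurable:
polynomials in V(x) have measurable entries. -/
lemma exists_polynomial_tendsto_sqrt :
    ∃ p : ℕ → Polynomial ℝ, ∀ x, Tendsto (fun n => (p n).eval x) atTop (𝓝 (Real.sqrt x)) := by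
  choose p hp using fun n : ℕ => exists_polynomial_near_of_continuousOn (-n) n Real.sqrt
    Real.continuous_sqrt.continuousOn (1 / ((n : ℝ) + 1)) (by positivity)
  refine ⟨p, fun x => ?_⟩
  rw [tendsto_iff_norm_sub_tendsto_zero]
  refine squeeze_zero' (Eventually.of_forall fun _ => norm_nonneg _) ?_
    tendsto_one_div_add_atTop_nhds_zero_nat
  filter_upwards [tendsto_natCast_atTop_atTop.eventually_ge_atTop |x|] with n hn
  exact (hp n x (abs_le.1 hn)).le

lemma tendsto_aeval_matrixSqrt {p : ℕ → Polynomial ℝ}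
    (hp : ∀ x, Tendsto (fun n => (p n).eval x) atTop (𝓝 (Real.sqrt x)))
    {M : Matrix (Fin m) (Fin m) ℝ} (hM : M.IsSymm) :
    Tendsto (fun n => Polynomial.aeval (complexify M) (p n)) atTop (𝓝 (matrixSqrt M)) := by
  have hH := isHermitian_complexify hM
  have h1 : ∀ n, Polynomial.aeval (complexify M) (p n)
      = hH.cfc fun x => (p n).eval x := fun n => by
    rw [← hH.cfc_eq]
    exact (cfc_polynomial (R := ℝ) (p n) (complexify M) (show IsSelfAdjoint _ from hH)).symm
  simp only [h1, matrixSqrt, hH.cfc_eq]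
  simp only [Matrix.IsHermitian.cfc, Unitary.conjStarAlgAut_apply]
  refine (Tendsto.const_mul _ ?_).mul_const _
  refine ((continuous_id.matrix_diagonal).tendsto _).comp (tendsto_pi_nhds.2 fun i => ?_)
  exact (Complex.continuous_ofReal.tendsto _).comp (hp _)

variable {X : Type*} [MeasurableSpace X] {μ : Measure X}

lemma aemeasurable_aeval_entry {A : X → Matrix (Fin m) (Fin m) ℂ}
    (hA : ∀ i j, AEMeasurable (fun x => A x i j) μ) (p : Polynomial ℝ) (i j : Fin m) :
    AEMeasurable (fun x => Polynomial.aeval (A x) p i j) μ := by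
  have hpow : ∀ (n : ℕ) i j, AEMeasurable (fun x => (A x ^ n) i j) μ := by
    intro n
    induction n with
    | zero => intro i j; simp
    | succ n ih =>
      intro i j
      simp only [pow_succ, Matrix.mul_apply]
      exact Finset.aemeasurable_fun_sum _ fun k _ => (ih i k).mul (hA k j)
  simp only [Polynomial.aeval_eq_sum_range, Matrix.sum_apply, Matrix.smul_apply]
  refine Finset.aemeasurable_fun_sum _ fun k _ => ?_
  simp only [Complex.real_smul]
  exact (hpow k i j).const_mul _

variable {V : X → Matrix (Fin m) (Fin m) ℝ}

lemma aemeasurable_matrixSqrt_entry (hV : ∀ i j, AEMeasurable (fun x => V x i j) μ)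
    (hsymm : ∀ᵐ x ∂μ, (V x).IsSymm) (i j : Fin m) :
    AEMeasurable (fun x => matrixSqrt (V x) i j) μ := by
  obtain ⟨p, hp⟩ := exists_polynomial_tendsto_sqrt
  refine aemeasurable_of_tendsto_metrizable_ae atTop (fun n => aemeasurable_aeval_entry
    (A := fun x => complexify (V x)) (fun i j => ?_) (p n) i j) ?_
  · exact Complex.measurable_ofReal.comp_aemeasurable (hV i j)
  · filter_upwards [hsymm] with x hx
    exact tendsto_pi_nhds.1 (tendsto_pi_nhds.1 (tendsto_aeval_matrixSqrt hp hx) i) j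

lemma aestronglyMeasurable_matrixSqrt (hV : ∀ i j, AEMeasurable (fun x => V x i j) μ)
    (hsymm : ∀ᵐ x ∂μ, (V x).IsSymm) {u : X → EuclideanSpace ℂ (Fin m)}
    (hu : AEStronglyMeasurable u μ) :
    AEStronglyMeasurable (fun x => Matrix.toEuclideanLin (matrixSqrt (V x)) (u x)) μ := by
  simp only [Matrix.toLpLin_apply]
  refine (PiLp.continuous_toLp 2 _).comp_aestronglyMeasurable
    (AEMeasurable.aestronglyMeasurable (aemeasurable_pi_lambda _ fun i => ?_))
  simp only [Matrix.mulVec, dotProduct]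
  exact Finset.aemeasurable_fun_sum _ fun k _ =>
    (aemeasurable_matrixSqrt_entry hV hsymm i k).mul
      ((EuclideanSpace.proj (𝕜 := ℂ) k).continuous.comp_aestronglyMeasurable hu).aemeasurable

/-- For symmetric matrices the condition c ≤ λ is a family of inequalities in vectors z, and by
continuity a dense sequence of z suffices. The value 0 is used on the null set where symmetry fails.
-/
lemma aemeasurable_smallestEigenvalue (hm : 1 ≤ m)
    (hV : ∀ i j, AEMeasurable (fun x => V x i j) μ) (hsymm : ∀ᵐ x ∂μ, (V x).IsSymm) :
    AEMeasurable (fun x => smallestEigenvalue (V x)) μ := by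
  classical
  set W : X → Matrix (Fin m) (Fin m) ℝ := fun x => Matrix.of fun i j => (hV i j).mk _ x with hW
  have hWm : ∀ i j, Measurable fun x => W x i j := fun i j => (hV i j).measurable_mk
  have hVW : ∀ᵐ x ∂μ, V x = W x := by
    have : ∀ᵐ x ∂μ, ∀ i j, V x i j = W x i j :=
      ae_all_iff.2 fun i => ae_all_iff.2 fun j => (hV i j).ae_eq_mk
    filter_upwards [this] with x hx
    ext i j
    exact hx i j
  have hN : MeasurableSet {x | (W x).IsSymm} := by
    have : {x | (W x).IsSymm} = ⋂ i, ⋂ j, {x | W x j i = W x i j} := by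
      ext x
      simp only [Set.mem_ofPred_eq, Set.mem_iInter, Matrix.IsSymm.ext_iff]
    rw [this]
    exact MeasurableSet.iInter fun i => MeasurableSet.iInter fun j =>
      measurableSet_eq_fun (hWm j i) (hWm i j)
  refine ⟨fun x => if (W x).IsSymm then smallestEigenvalue (W x) else 0, ?_, ?_⟩
  · refine measurable_of_Ici fun c => ?_
    set Z := TopologicalSpace.denseSeq (Fin m → ℝ)
    have : (fun x => if (W x).IsSymm then smallestEigenvalue (W x) else 0) ⁻¹' Set.Ici c
        = ({x | (W x).IsSymm} ∩ ⋂ n, {x | c * (Z n ⬝ᵥ Z n) ≤ Z n ⬝ᵥ (W x).mulVec (Z n)})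
          ∪ ({x | (W x).IsSymm}ᶜ ∩ {_x | c ≤ 0}) := by
      ext x
      by_cases hx : (W x).IsSymm
      · simp only [Set.mem_preimage, hx, if_true, Set.mem_Ici, Set.mem_union, Set.mem_inter_iff,
          Set.mem_ofPred_eq, true_and, Set.mem_compl_iff, not_true, false_and, or_false,
          Set.mem_iInter]
        rw [le_smallestEigenvalue_iff hm hx]
        refine ⟨fun h n => h _, fun h z => ?_⟩
        refine (TopologicalSpace.denseRange_denseSeq (Fin m → ℝ)).induction_on
          (p := fun z => c * (z ⬝ᵥ z) ≤ z ⬝ᵥ (W x).mulVec z) z ?_ h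
        refine isClosed_le (by fun_prop) ?_
        exact continuous_id.dotProduct (continuous_const.matrix_mulVec continuous_id)
      · simp [hx]
    rw [this]
    refine (hN.inter (MeasurableSet.iInter fun n => ?_)).union (hN.compl.inter (by simp))
    refine measurableSet_le measurable_const ?_
    simp only [Matrix.mulVec, dotProduct]
    fun_prop
  · filter_upwards [hVW, hsymm] with x h1 h2
    rw [if_pos (h1 ▸ h2), h1]

end Matrices

/-! ### Test functions have magnetic gradients in L² -/

section Test

variable {d : ℕ}

lemma isWeakDeriv_of_contDiff {X : Type*} [NormedAddCommGroup X] [NormedSpace ℝ X]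
    [FiniteDimensional ℝ X] [MeasurableSpace X] [BorelSpace X] {μ : Measure X}
    [μ.IsAddHaarMeasure] {f : X → ℝ} (hf : ContDiff ℝ ∞ f) (e : X) :
    IsWeakDeriv μ e f (fun x => fderiv ℝ f x e) where
  locallyIntegrable := hf.continuous.locallyIntegrable
  locallyIntegrable_deriv := (hf.fderiv_apply_const e).continuous.locallyIntegrable
  integral_eq φ h1 h2 := by
    simp only [smul_eq_mul]
    have i1 : Integrable (fun x => fderiv ℝ φ x e * f x) μ :=
      integrable_fderiv_smul hf.continuous.locallyIntegrable h1 h2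
    have i2 : Integrable (fun x => φ x * fderiv ℝ f x e) μ :=
      (hf.fderiv_apply_const
        e).continuous.locallyIntegrable.integrable_smul_left_of_hasCompactSupport h1.continuous h2
    have i3 : Integrable (fun x => φ x * f x) μ :=
      hf.continuous.locallyIntegrable.integrable_smul_left_of_hasCompactSupport h1.continuous h2
    rw [integral_mul_fderiv_eq_neg_fderiv_mul_of_integrable i1 i2 i3
      (fun x _ => h1.differentiable (by simp) x) (fun x _ => hf.differentiable (by simp) x), neg_neg]

variable {a : EuclideanSpace ℝ (Fin d) → EuclideanSpace ℝ (Fin d)}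
  (ha : ∀ K : Set (EuclideanSpace ℝ (Fin d)), IsCompact K → MemLp a 2 (volume.restrict K))

include ha in
/-- Multiples of test functions have a magnetic gradient in `L²`. -/
lemma hasL2MagneticGradient_test {φ : EuclideanSpace ℝ (Fin d) → ℝ} (hφ : ContDiff ℝ ∞ φ)
    (hφc : HasCompactSupport φ) (c : ℂ) :
    HasL2MagneticGradient a fun x => (φ x : ℂ) * c := by
  have h1 : MemLp (fun x => (φ x : ℂ) * c) 2 volume :=
    ((hφ.continuous.memLp_of_hasCompactSupport hφc).ofReal).mul_const c
  have h2 : IsMagneticGradient a (fun x => (φ x : ℂ) * c) (fun x => WithLp.toLp 2 fun k =>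
      (((fderiv ℝ φ x (EuclideanSpace.single k 1) : ℝ) : ℂ)
        - Complex.I * ((φ x * a x k : ℝ) : ℂ)) * c) := fun k => by
    refine ((isWeakDeriv_of_contDiff (μ := volume) hφ (EuclideanSpace.single k 1)).clm_comp
      ((ContinuousLinearMap.lsmul ℝ ℝ (E := ℂ)).flip c)).congr
        (Eventually.of_forall fun x => ?_) (Eventually.of_forall fun x => ?_)
    · simp
    · simp
      ring
  refine (h2.hasL2MagneticGradient (h1.locallyIntegrable (by norm_num)) ?_).1
  refine MemLp.of_eval_piLp fun k => ?_
  exact (memLp_magneticTest_fst ha k hφ hφc).mul_const c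

end Test

/-! ### Closedness of the magnetic Schrödinger form -/

section MagneticForm

variable {d m : ℕ}

/-- The `i`-th component of a vector-valued function in `L²`. -/
def componentL2 (d : ℕ) (i : Fin m) : L2Vec d m →L[ℂ] L2Scalar d :=
  (EuclideanSpace.proj (𝕜 := ℂ) i).compLpL 2 volume

lemma coeFn_componentL2 (i : Fin m) (u : L2Vec d m) :
    componentL2 d i u =ᵐ[volume] fun x => u x i :=
  ContinuousLinearMap.coeFn_compLp _ u

variable {a : EuclideanSpace ℝ (Fin d) → EuclideanSpace ℝ (Fin d)}
  (ha : ∀ K : Set (EuclideanSpace ℝ (Fin d)), IsCompact K → MemLp a 2 (volume.restrict K))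
  (V : EuclideanSpace ℝ (Fin d) → Matrix (Fin m) (Fin m) ℝ)

/-- The values of `(∇_a u_1, …, ∇_a u_m, V^{1/2} u)`. -/
abbrev L2Energy (d m : ℕ) : Type :=
  WithLp 2 (PiLp 2 (fun _ : Fin m => L2Grad d) × L2Vec d m)

/-- The pair consisting of the `i`-th component and the `i`-th magnetic gradient. -/
def gradientPair (d m : ℕ) (i : Fin m) :
    WithLp 2 (L2Vec d m × L2Energy d m) →L[ℂ] WithLp 2 (L2Scalar d × L2Grad d) :=
  ((WithLp.prodContinuousLinearEquiv 2 ℂ (L2Scalar d) (L2Grad d)).symm :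
    (L2Scalar d × L2Grad d) →L[ℂ] _).comp
      (((componentL2 d i).comp (WithLp.fstL 2 ℂ _ _)).prod
        ((PiLp.proj 2 (fun _ : Fin m => L2Grad d) i).comp
          ((WithLp.fstL 2 ℂ _ _).comp (WithLp.sndL 2 ℂ _ _))))

/-- The pair consisting of `u` and `V^{1/2} u`. -/
def potentialPair (d m : ℕ) :
    WithLp 2 (L2Vec d m × L2Energy d m) →L[ℂ] WithLp 2 (L2Vec d m × L2Vec d m) :=
  ((WithLp.prodContinuousLinearEquiv 2 ℂ (L2Vec d m) (L2Vec d m)).symm :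
    (L2Vec d m × L2Vec d m) →L[ℂ] _).comp
      ((WithLp.fstL 2 ℂ _ _).prod ((WithLp.sndL 2 ℂ _ _).comp (WithLp.sndL 2 ℂ _ _)))

/-- The graph of `u ↦ (∇_a u_1, …, ∇_a u_m, V^{1/2} u)`. -/
def energyGraph : Submodule ℂ (WithLp 2 (L2Vec d m × L2Energy d m)) :=
  (⨅ i, (magneticGraph ha).comap (gradientPair d m i : _ →ₗ[ℂ] _)) ⊓
    (multiplicationGraph volume fun x =>
      (Matrix.toEuclideanLin (matrixSqrt (V x))).toContinuousLinearMap).comap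
        (potentialPair d m : _ →ₗ[ℂ] _)

lemma isClosed_energyGraph :
    IsClosed (energyGraph ha V : Set (WithLp 2 (L2Vec d m × L2Energy d m))) := by
  simp only [energyGraph, Submodule.coe_inf, Submodule.coe_iInf, Submodule.comap_coe]
  exact (isClosed_iInter fun i => (isClosed_magneticGraph ha).preimage
    (gradientPair d m i).continuous).inter
      ((isClosed_multiplicationGraph _).preimage (potentialPair d m).continuous)

lemma mem_energyGraph_iff (u : L2Vec d m) (w : L2Energy d m) :
    WithLp.toLp 2 (u, w) ∈ energyGraph ha V ↔
      (∀ i, IsMagneticGradient a (fun x => u x i) (w.fst i)) ∧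
        w.snd =ᵐ[volume] fun x => Matrix.toEuclideanLin (matrixSqrt (V x)) (u x) := by
  simp only [energyGraph, Submodule.mem_inf, Submodule.mem_iInf, Submodule.mem_comap]
  refine and_congr (forall_congr' fun i => ?_) Iff.rfl
  refine (mem_magneticGraph_iff ha _).trans ?_
  exact ⟨fun h => h.congr (coeFn_componentL2 i u) EventuallyEq.rfl,
    fun h => h.congr (coeFn_componentL2 i u).symm EventuallyEq.rfl⟩

lemma locallyIntegrable_component (u : L2Vec d m) (i : Fin m) :
    LocallyIntegrable (fun x => u x i) volume :=
  ((Lp.memLp u).eval_piLp i).locallyIntegrable (by norm_num)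

variable {V}

/-- The magnetic Schrödinger form is closed. -/
theorem isClosedForm_magneticForm (hm : 1 ≤ m) (hVsymm : ∀ᵐ x, (V x).IsSymm)
    (hVloc : ∀ i j, LocallyIntegrable (fun x => V x i j) volume)
    (hVnonneg : ∀ᵐ x, 0 ≤ smallestEigenvalue (V x)) :
    IsClosedForm (energyGraph ha V) (magneticFormDomain a V) (magneticForm a V) where
  isClosed := isClosed_energyGraph ha V
  mem_iff u := by
    simp only [mem_energyGraph_iff]
    constructor
    · intro h
      refine ⟨WithLp.toLp 2 (WithLp.toLp 2 fun i => (h.1 i).2.toLp, h.2.toLp), fun i => ?_, ?_⟩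
      · exact (h.1 i).isMagneticGradient.congr EventuallyEq.rfl (h.1 i).2.coeFn_toLp.symm
      · exact h.2.coeFn_toLp
    · rintro ⟨w, h1, h2⟩
      exact ⟨fun i => ((h1 i).hasL2MagneticGradient (locallyIntegrable_component u i)
        (Lp.memLp _)).1, (Lp.memLp w.snd).ae_eq h2⟩
  form_eq u v w w' hw hw' := by
    rw [mem_energyGraph_iff] at hw hw'
    rw [WithLp.prod_inner_apply, PiLp.inner_apply, magneticForm]
    congr 1
    · refine Finset.sum_congr rfl fun i _ => ?_
      rw [L2.inner_def]
      refine integral_congr_ae ?_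
      filter_upwards [((hw.1 i).hasL2MagneticGradient (locallyIntegrable_component u i)
        (Lp.memLp _)).2, ((hw'.1 i).hasL2MagneticGradient (locallyIntegrable_component v i)
        (Lp.memLp _)).2] with x h1 h2
      rw [h1, h2]
      rfl
    · rw [L2.inner_def]
      refine integral_congr_ae ?_
      filter_upwards [hw.2, hw'.2, hVsymm, hVnonneg] with x h1 h2 h3 h4
      rw [← inner_matrixSqrt (posSemidef_complexify hm h3 h4), ← h1, ← h2]
      rfl
  dense g hg := by
    have hVm : ∀ i j, AEMeasurable (fun x => V x i j) volume := fun i j =>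
      (hVloc i j).aestronglyMeasurable.aemeasurable
    have key : ∀ i, ∀ᵐ x, g x i = 0 := fun i => by
      refine ae_eq_zero_of_integral_contDiff_smul_eq_zero (locallyIntegrable_component g i)
        fun φ hφ hφc => ?_
      have hv : MemLp (fun x => ((φ x : ℝ) : ℂ) • EuclideanSpace.single i (1 : ℂ)) 2
          (volume : Measure (EuclideanSpace ℝ (Fin d))) :=
        ((ContinuousLinearMap.id ℂ ℂ).smulRight (EuclideanSpace.single i (1 : ℂ))).comp_memLp'
          (hφ.continuous.memLp_of_hasCompactSupport hφc).ofReal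
      -- The potential energy density of φ e_i is φ² V_ii, integrable because the diagonal entries
      -- of V are locally integrable.
      have hmem : hv.toLp _ ∈ magneticFormDomain a V := by
        refine ⟨fun j => ?_, ?_⟩
        · have h1 := hasL2MagneticGradient_test ha hφ hφc ((EuclideanSpace.single i (1 : ℂ)) j)
          refine ((h1.isMagneticGradient.congr (f' := fun x => (hv.toLp _) x j) ?_
            EventuallyEq.rfl).hasL2MagneticGradient (locallyIntegrable_component _ j) h1.2).1
          filter_upwards [hv.coeFn_toLp] with x hx
          rw [hx]; simp
        · rw [memLp_two_iff_integrable_sq_norm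
            (aestronglyMeasurable_matrixSqrt hVm hVsymm (Lp.aestronglyMeasurable _))]
          have h2 : Integrable (fun x => (φ x * φ x) • V x i i) volume :=
            (hVloc i i).integrable_smul_left_of_hasCompactSupport
              (hφ.continuous.mul hφ.continuous) hφc.mul_right
          refine h2.congr ?_
          filter_upwards [hv.coeFn_toLp, hVsymm, hVnonneg] with x h1 h3 h4
          rw [h1, norm_matrixSqrt_sq (posSemidef_complexify hm h3 h4), map_smul, inner_smul_left,
            inner_smul_right, EuclideanSpace.inner_single_left, Matrix.toLpLin_apply]
          simp [complexify, mul_assoc]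
      have h := hg _ hmem
      rw [L2.inner_def] at h
      rw [← h]
      refine integral_congr_ae ?_
      filter_upwards [hv.coeFn_toLp] with x hx
      rw [hx, inner_smul_left, EuclideanSpace.inner_single_left]
      simp [Complex.real_smul]
    rw [Lp.eq_zero_iff_ae_eq_zero]
    filter_upwards [ae_all_iff.2 key] with x hx
    ext i
    exact hx i

end MagneticForm

/-! ### Closedness of the scalar form, with gradient part the case a = 0 -/

section ScalarForm

variable {d : ℕ}

lemma memLp_restrict_zero (K : Set (EuclideanSpace ℝ (Fin d))) (_ : IsCompact K) :
    MemLp (0 : EuclideanSpace ℝ (Fin d) → EuclideanSpace ℝ (Fin d)) 2 (volume.restrict K) :=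
  MemLp.zero

lemma magneticGradient_zero (f : EuclideanSpace ℝ (Fin d) → ℂ) :
    magneticGradient 0 f = weakGradient f := by
  ext x k
  simp [magneticGradient]

lemma hasL2MagneticGradient_zero_iff {f : EuclideanSpace ℝ (Fin d) → ℂ} :
    HasL2MagneticGradient 0 f ↔ HasWeakGradient f ∧ MemLp (weakGradient f) 2 volume := by
  rw [HasL2MagneticGradient, magneticGradient_zero]

/-- The pair consisting of a function and its gradient. -/
def scalarGradientPair (d : ℕ) : WithLp 2 (L2Scalar d × WithLp 2 (L2Grad d × L2Scalar d)) →L[ℂ]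
    WithLp 2 (L2Scalar d × L2Grad d) :=
  ((WithLp.prodContinuousLinearEquiv 2 ℂ (L2Scalar d) (L2Grad d)).symm :
    (L2Scalar d × L2Grad d) →L[ℂ] _).comp
      ((WithLp.fstL 2 ℂ _ _).prod ((WithLp.fstL 2 ℂ _ _).comp (WithLp.sndL 2 ℂ _ _)))

/-- The pair consisting of `u` and `√w u`. -/
def scalarPotentialPair (d : ℕ) : WithLp 2 (L2Scalar d × WithLp 2 (L2Grad d × L2Scalar d)) →L[ℂ]
    WithLp 2 (L2Scalar d × L2Scalar d) :=
  ((WithLp.prodContinuousLinearEquiv 2 ℂ (L2Scalar d) (L2Scalar d)).symm :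
    (L2Scalar d × L2Scalar d) →L[ℂ] _).comp
      ((WithLp.fstL 2 ℂ _ _).prod ((WithLp.sndL 2 ℂ _ _).comp (WithLp.sndL 2 ℂ _ _)))

/-- The graph of `u ↦ (∇u, √w u)`. -/
def scalarEnergyGraph (w : EuclideanSpace ℝ (Fin d) → ℝ) :
    Submodule ℂ (WithLp 2 (L2Scalar d × WithLp 2 (L2Grad d × L2Scalar d))) :=
  (magneticGraph (memLp_restrict_zero (d := d))).comap (scalarGradientPair d : _ →ₗ[ℂ] _) ⊓
    (multiplicationGraph volume fun x =>
      ((√(w x) : ℝ) : ℂ) • ContinuousLinearMap.id ℂ ℂ).comap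
        (scalarPotentialPair d : _ →ₗ[ℂ] _)

variable {w : EuclideanSpace ℝ (Fin d) → ℝ}

lemma isClosed_scalarEnergyGraph : IsClosed (scalarEnergyGraph w : Set (WithLp 2 (L2Scalar d ×
    WithLp 2 (L2Grad d × L2Scalar d)))) := by
  simp only [scalarEnergyGraph, Submodule.coe_inf, Submodule.comap_coe]
  exact ((isClosed_magneticGraph _).preimage (scalarGradientPair d).continuous).inter
    ((isClosed_multiplicationGraph _).preimage (scalarPotentialPair d).continuous)

lemma mem_scalarEnergyGraph_iff (u : L2Scalar d) (p : WithLp 2 (L2Grad d × L2Scalar d)) :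
    WithLp.toLp 2 (u, p) ∈ scalarEnergyGraph w ↔ IsMagneticGradient 0 u p.fst ∧
      p.snd =ᵐ[volume] fun x => ((√(w x) : ℝ) : ℂ) * u x := by
  simp only [scalarEnergyGraph, Submodule.mem_inf, Submodule.mem_comap]
  exact and_congr (mem_magneticGraph_iff memLp_restrict_zero _) Iff.rfl

lemma Lp.locallyIntegrable_two {E : Type*} [NormedAddCommGroup E]
    (u : Lp E 2 (volume : Measure (EuclideanSpace ℝ (Fin d)))) : LocallyIntegrable u volume :=
  (Lp.memLp u).locallyIntegrable (by norm_num)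

/-- The scalar Schrödinger form is closed. -/
theorem isClosedForm_scalarForm (hw : LocallyIntegrable w volume) (hw0 : ∀ᵐ x, 0 ≤ w x) :
    IsClosedForm (scalarEnergyGraph w) (scalarFormDomain w) (scalarForm w) where
  isClosed := isClosed_scalarEnergyGraph
  mem_iff u := by
    simp only [mem_scalarEnergyGraph_iff]
    constructor
    · intro h
      have h1 := hasL2MagneticGradient_zero_iff.2 ⟨h.1, h.2.1⟩
      exact ⟨WithLp.toLp 2 (h1.2.toLp, h.2.2.toLp),
        h1.isMagneticGradient.congr EventuallyEq.rfl h1.2.coeFn_toLp.symm, h.2.2.coeFn_toLp⟩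
    · rintro ⟨p, h1, h2⟩
      have h3 := hasL2MagneticGradient_zero_iff.1
        (h1.hasL2MagneticGradient (Lp.locallyIntegrable_two u) (Lp.memLp _)).1
      exact ⟨h3.1, h3.2, (Lp.memLp p.snd).ae_eq h2⟩
  form_eq u v p p' hp hp' := by
    rw [mem_scalarEnergyGraph_iff] at hp hp'
    rw [WithLp.prod_inner_apply, scalarForm]
    congr 1
    · rw [L2.inner_def, ← magneticGradient_zero, ← magneticGradient_zero]
      refine integral_congr_ae ?_
      filter_upwards [(hp.1.hasL2MagneticGradient (Lp.locallyIntegrable_two u) (Lp.memLp _)).2,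
        (hp'.1.hasL2MagneticGradient (Lp.locallyIntegrable_two v) (Lp.memLp _)).2] with x h1 h2
      rw [h1, h2]
      rfl
    · rw [L2.inner_def]
      refine integral_congr_ae ?_
      filter_upwards [hp.2, hp'.2, hw0] with x h1 h2 h3
      change _ = inner ℂ (p'.snd x) (p.snd x)
      rw [h1, h2, RCLike.inner_apply, map_mul, Complex.conj_ofReal]
      nth_rw 1 [← Real.mul_self_sqrt h3]
      push_cast
      ring
  dense g hg := by
    rw [Lp.eq_zero_iff_ae_eq_zero]
    refine ae_eq_zero_of_integral_contDiff_smul_eq_zero (Lp.locallyIntegrable_two g)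
      fun φ hφ hφc => ?_
    have hv : MemLp (fun x => ((φ x : ℝ) : ℂ)) 2
        (volume : Measure (EuclideanSpace ℝ (Fin d))) :=
      (hφ.continuous.memLp_of_hasCompactSupport hφc).ofReal
    have hmem : hv.toLp _ ∈ scalarFormDomain w := by
      have h1 := hasL2MagneticGradient_test memLp_restrict_zero hφ hφc 1
      have h3 := hasL2MagneticGradient_zero_iff.1
        ((h1.isMagneticGradient.congr (f' := hv.toLp _) (by
          filter_upwards [hv.coeFn_toLp] with x hx
          rw [hx, mul_one]) EventuallyEq.rfl).hasL2MagneticGradient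
            (Lp.locallyIntegrable_two _) h1.2).1
      refine ⟨h3.1, h3.2, ?_⟩
      have hm : AEStronglyMeasurable (fun x => ((√(w x) : ℝ) : ℂ)) volume :=
        (Complex.continuous_ofReal.comp Real.continuous_sqrt).comp_aestronglyMeasurable
          hw.aestronglyMeasurable
      refine (memLp_two_iff_integrable_sq_norm (hm.mul (Lp.aestronglyMeasurable _))).2 ?_
      have h2 : Integrable (fun x => (φ x * φ x) • w x) volume :=
        hw.integrable_smul_left_of_hasCompactSupport
          (hφ.continuous.mul hφ.continuous) hφc.mul_right
      refine h2.congr ?_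
      filter_upwards [hv.coeFn_toLp, hw0] with x h1 h3
      rw [Pi.mul_apply, h1, norm_mul, mul_pow, Complex.norm_real, Complex.norm_real, Real.norm_eq_abs,
        Real.norm_eq_abs, sq_abs, sq_abs, Real.sq_sqrt h3, smul_eq_mul]
      ring
    have h := hg _ hmem
    rw [L2.inner_def] at h
    rw [← h]
    refine integral_congr_ae ?_
    filter_upwards [hv.coeFn_toLp] with x hx
    rw [hx, RCLike.inner_apply]
    simp [Complex.real_smul, mul_comm]

end ScalarForm

/-- Testing the quadratic form with the first basis vector gives 0 ≤ λ_V ≤ V_00. -/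
lemma locallyIntegrable_smallestEigenvalue {X : Type*} [TopologicalSpace X] [MeasurableSpace X]
    {μ : Measure X} {m : ℕ} (hm : 1 ≤ m) {V : X → Matrix (Fin m) (Fin m) ℝ}
    (hVsymm : ∀ᵐ x ∂μ, (V x).IsSymm)
    (hVloc : ∀ i j, LocallyIntegrable (fun x => V x i j) μ)
    (hVnonneg : ∀ᵐ x ∂μ, 0 ≤ smallestEigenvalue (V x))
    (hVm : ∀ i j, AEMeasurable (fun x => V x i j) μ) :
    LocallyIntegrable (fun x => smallestEigenvalue (V x)) μ := by
  have h1 : ∀ᵐ x ∂μ, ‖smallestEigenvalue (V x)‖ ≤ ‖V x ⟨0, hm⟩ ⟨0, hm⟩‖ := by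
    filter_upwards [hVsymm, hVnonneg] with x h1 h2
    have h3 := (le_smallestEigenvalue_iff hm h1 _).1 le_rfl (Pi.single ⟨0, hm⟩ 1)
    simp only [single_one_dotProduct, Pi.single_eq_same, mul_one, Matrix.mulVec_single_one,
      Matrix.col_apply] at h3
    rw [Real.norm_of_nonneg h2]
    exact h3.trans (le_abs_self _)
  intro x
  obtain ⟨s, hs, h2⟩ := hVloc ⟨0, hm⟩ ⟨0, hm⟩ x
  exact ⟨s, hs, Integrable.mono h2
    ((aemeasurable_smallestEigenvalue hm hVm hVsymm).aestronglyMeasurable.restrict)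
    (ae_restrict_of_ae h1)⟩

lemma real_inner_euclidean_eq_re {ι : Type*} [Fintype ι] (x y : EuclideanSpace ℂ ι) :
    inner ℝ x y = (inner ℂ x y).re := by
  simp [PiLp.inner_apply, RCLike.inner_apply, Complex.inner]

lemma MeasureTheory.MemLp.integrable_inner_two {X : Type*} [MeasurableSpace X] {μ : Measure X}
    {E : Type*} [NormedAddCommGroup E] [InnerProductSpace ℂ E] {f g : X → E} (hf : MemLp f 2 μ)
    (hg : MemLp g 2 μ) : Integrable (fun x => inner ℂ (f x) (g x)) μ := by
  refine (L2.integrable_inner (𝕜 := ℂ) hf.toLp hg.toLp).congr ?_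
  filter_upwards [hf.coeFn_toLp, hg.coeFn_toLp] with x h1 h2
  rw [h1, h2]

/-! ### Pointwise inequalities behind the comparison of the forms -/

section Pointwise

variable {m : ℕ}

/-- The covariant derivative of `shrink r z`, where `p` is that of `z` and `s` is the derivative
of `r`. -/
def shrinkCovariant (r s : ℝ) (z p : EuclideanSpace ℂ (Fin m)) : EuclideanSpace ℂ (Fin m) :=
  if r < ‖z‖ then ((‖z‖ - r) / ‖z‖) • p + shrinkFactorDeriv r z s p • z else 0

/-- The derivative of `max (‖z‖ - r) 0`. -/
def excessDeriv (r s : ℝ) (z p : EuclideanSpace ℂ (Fin m)) : ℝ :=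
  if 0 < ‖z‖ - r then inner ℝ z p / ‖z‖ - s else 0

lemma abs_real_inner_div_norm_le_norm {E : Type*} [NormedAddCommGroup E] [InnerProductSpace ℝ E]
    (z p : E) : |inner ℝ z p / ‖z‖| ≤ ‖p‖ := by
  rw [abs_div, abs_norm]
  exact div_le_of_le_mul₀ (norm_nonneg _) (norm_nonneg _)
    ((abs_real_inner_le_norm z p).trans_eq (mul_comm _ _))

/-- Where the expression is nonzero, r/‖z‖ < 1 controls the singular-looking coefficients. The bound
puts the covariant derivative of the test function in L². -/
lemma norm_shrinkCovariant_le {r s : ℝ} (hr : 0 ≤ r) (z p : EuclideanSpace ℂ (Fin m)) :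
    ‖shrinkCovariant r s z p‖ ≤ 2 * ‖p‖ + |s| := by
  unfold shrinkCovariant
  split_ifs with h
  · have h0 : 0 < ‖z‖ := hr.trans_lt h
    have h1 : ‖((‖z‖ - r) / ‖z‖) • p‖ ≤ ‖p‖ := by
      rw [norm_smul, Real.norm_of_nonneg (div_nonneg (sub_pos.2 h).le h0.le)]
      exact mul_le_of_le_one_left (norm_nonneg _) ((div_le_one h0).2 (by linarith))
    have h2 : ‖shrinkFactorDeriv r z s p • z‖ ≤ ‖p‖ + |s| := by
      rw [norm_smul, Real.norm_eq_abs, ← abs_norm z, ← abs_mul]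
      have e : shrinkFactorDeriv r z s p * ‖z‖ = (r / ‖z‖) * (inner ℝ z p / ‖z‖) - s := by
        rw [shrinkFactorDeriv]
        field_simp
      rw [e]
      refine (abs_sub _ _).trans (add_le_add_left ?_ _)
      rw [abs_mul, abs_of_nonneg (div_nonneg hr h0.le)]
      exact (mul_le_of_le_one_left (abs_nonneg _) ((div_le_one h0).2 h.le)).trans
        (abs_real_inner_div_norm_le_norm z p)
    exact (norm_add_le _ _).trans (by linarith)
  · rw [norm_zero]; positivity

lemma abs_excessDeriv_le (r s : ℝ) (z p : EuclideanSpace ℂ (Fin m)) :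
    |excessDeriv r s z p| ≤ ‖p‖ + |s| := by
  unfold excessDeriv
  split_ifs with h
  · exact (abs_sub _ _).trans (add_le_add_left (abs_real_inner_div_norm_le_norm z p) _)
  · rw [abs_zero]; positivity

/-- With n = Re⟨z, p⟩/‖z‖ and r < ‖z‖, right side minus left side equals (‖z‖ - r)/‖z‖ · (‖p‖² - n²)
+ (n - s)². Both terms are nonnegative, the first by Cauchy–Schwarz. -/
lemma mul_excessDeriv_le {r s : ℝ} (hr : 0 ≤ r) (z p : EuclideanSpace ℂ (Fin m)) :
    excessDeriv r s z p * s ≤ (inner ℂ (shrinkCovariant r s z p) p).re := by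
  rw [← real_inner_euclidean_eq_re]
  unfold shrinkCovariant excessDeriv
  by_cases h : r < ‖z‖
  · have h0 : 0 < ‖z‖ := hr.trans_lt h
    rw [if_pos h, if_pos (sub_pos.2 h), inner_add_left, real_inner_smul_left,
      real_inner_smul_left, real_inner_self_eq_norm_sq]
    set n := inner ℝ z p / ‖z‖ with hn
    have e1 : inner ℝ z p = n * ‖z‖ := by rw [hn]; field_simp
    have h1 : n ^ 2 ≤ ‖p‖ ^ 2 := sq_le_sq.2 (by
      rw [abs_norm]; exact abs_real_inner_div_norm_le_norm z p)
    have h2 : (‖z‖ - r) / ‖z‖ * n ^ 2 ≤ (‖z‖ - r) / ‖z‖ * ‖p‖ ^ 2 :=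
      mul_le_mul_of_nonneg_left h1 (div_nonneg (sub_pos.2 h).le h0.le)
    have e2 : (‖z‖ - r) / ‖z‖ * n ^ 2 + shrinkFactorDeriv r z s p * inner ℝ z p
        = n ^ 2 - s * n := by
      rw [shrinkFactorDeriv, e1]
      field_simp
      ring
    nlinarith [sq_nonneg (n - s)]
  · rw [if_neg h, if_neg (by rwa [sub_pos]), inner_zero_left, zero_mul]

/-- The diamagnetic cancellation: the magnetic term only rotates the phase and does not contribute
to the derivative of the norm. -/
lemma real_inner_I_mul_smul_self (c : ℝ) (z : EuclideanSpace ℂ (Fin m)) :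
    inner ℝ z ((Complex.I * (c : ℂ)) • z) = 0 := by
  rw [real_inner_euclidean_eq_re, inner_smul_right, inner_self_eq_norm_sq_to_K]
  simp [← Complex.ofReal_pow]

/-- The truncation multiplies `z` by a real factor depending on `z` only through ‖z‖, so the
magnetic term passes through it unchanged. -/
lemma shrinkCovariant_add (r s c : ℝ) (z p : EuclideanSpace ℂ (Fin m)) :
    (if r < ‖z‖ then ((‖z‖ - r) / ‖z‖) • (p + (Complex.I * (c : ℂ)) • z)
        + shrinkFactorDeriv r z s (p + (Complex.I * (c : ℂ)) • z) • z else 0)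
      = shrinkCovariant r s z p + (Complex.I * (c : ℂ)) • shrink r z := by
  unfold shrinkCovariant
  split_ifs with h
  · rw [shrink_of_lt h, shrinkFactorDeriv, shrinkFactorDeriv, inner_add_right,
      real_inner_I_mul_smul_self, add_zero, smul_add, smul_comm (Complex.I * (c : ℂ))]
    abel
  · rw [shrink_of_le (not_lt.1 h), smul_zero, add_zero]

end Pointwise

/-! ### Covariant derivatives of vector-valued functions -/

section CovariantDerivative

variable {d m : ℕ}

lemma isWeakDeriv_euclidean_iff {X : Type*} [NormedAddCommGroup X] [NormedSpace ℝ X]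
    [FiniteDimensional ℝ X] [MeasurableSpace X] [BorelSpace X] {μ : Measure X}
    [μ.IsAddHaarMeasure] {e : X} {f g : X → EuclideanSpace ℂ (Fin m)} :
    IsWeakDeriv μ e f g ↔ ∀ i, IsWeakDeriv μ e (fun x => f x i) (fun x => g x i) := by
  constructor
  · intro h i
    exact h.clm_comp ((EuclideanSpace.proj (𝕜 := ℂ) i).restrictScalars ℝ)
  · intro h
    have hf := locallyIntegrable_euclidean_iff.2 fun i => (h i).locallyIntegrable
    have hg := locallyIntegrable_euclidean_iff.2 fun i => (h i).locallyIntegrable_deriv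
    refine ⟨hf, hg, fun φ h1 h2 => ?_⟩
    ext i
    have i1 := integrable_fderiv_smul (e := e) hf h1 h2
    have i2 := hg.integrable_smul_left_of_hasCompactSupport h1.continuous h2
    rw [PiLp.neg_apply, eval_integral_piLp (fun i => i1.eval_piLp i),
      eval_integral_piLp (fun i => i2.eval_piLp i)]
    simpa using (h i).integral_eq φ h1 h2

/-- The vector `((∇_a u_1)_k, …, (∇_a u_m)_k)`. -/
def covariantDeriv (a : EuclideanSpace ℝ (Fin d) → EuclideanSpace ℝ (Fin d))
    (u : EuclideanSpace ℝ (Fin d) → EuclideanSpace ℂ (Fin m)) (k : Fin d)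
    (x : EuclideanSpace ℝ (Fin d)) : EuclideanSpace ℂ (Fin m) :=
  WithLp.toLp 2 fun i => magneticGradient a (fun y => u y i) x k

variable {a : EuclideanSpace ℝ (Fin d) → EuclideanSpace ℝ (Fin d)}
  {u v : EuclideanSpace ℝ (Fin d) → EuclideanSpace ℂ (Fin m)}

/-- The norm ‖u‖ couples the components of u, so the comparison is made direction by direction for
the whole vector. -/
lemma sum_inner_magneticGradient (x : EuclideanSpace ℝ (Fin d)) :
    ∑ i, inner ℂ (magneticGradient a (fun y => v y i) x) (magneticGradient a (fun y => u y i) x)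
      = ∑ k, inner ℂ (covariantDeriv a v k x) (covariantDeriv a u k x) := by
  simp only [PiLp.inner_apply, covariantDeriv]
  exact Finset.sum_comm

lemma memLp_covariantDeriv (h : ∀ i, HasL2MagneticGradient a fun x => u x i) (k : Fin d) :
    MemLp (covariantDeriv a u k) 2 volume :=
  MemLp.of_eval_piLp fun i => (h i).2.eval_piLp k

lemma isWeakDeriv_covariantDeriv (h : ∀ i, HasL2MagneticGradient a fun x => u x i) (k : Fin d) :
    IsWeakDeriv volume (EuclideanSpace.single k 1) u
      (fun x => covariantDeriv a u k x + (Complex.I * (a x k : ℂ)) • u x) :=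
  isWeakDeriv_euclidean_iff.2 fun i => (h i).isMagneticGradient k

lemma hasL2MagneticGradient_of_covariantDeriv {Q : Fin d → EuclideanSpace ℝ (Fin d) →
    EuclideanSpace ℂ (Fin m)} (hu : MemLp u 2 volume) (hQ : ∀ k, MemLp (Q k) 2 volume)
    (h : ∀ k, IsWeakDeriv volume (EuclideanSpace.single k 1) u
      (fun x => Q k x + (Complex.I * (a x k : ℂ)) • u x)) :
    (∀ i, HasL2MagneticGradient a fun x => u x i) ∧
      ∀ k, covariantDeriv a u k =ᵐ[volume] Q k := by
  have h1 : ∀ i, IsMagneticGradient a (fun x => u x i)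
      (fun x => WithLp.toLp 2 fun k => Q k x i) := fun i k =>
    isWeakDeriv_euclidean_iff.1 (h k) i
  have h2 := fun i => (h1 i).hasL2MagneticGradient
    ((hu.eval_piLp i).locallyIntegrable (by norm_num))
    (MemLp.of_eval_piLp fun k => (hQ k).eval_piLp i)
  refine ⟨fun i => (h2 i).1, fun k => ?_⟩
  filter_upwards [ae_all_iff.2 fun i => (h2 i).2] with x hx
  ext i
  simp [covariantDeriv, hx i]

end CovariantDerivative

/-! ### Measurability of the truncation and its derivatives -/

section Measurability

variable {m : ℕ}

lemma measurable_shrink : Measurable fun q : ℝ × EuclideanSpace ℂ (Fin m) => shrink q.1 q.2 := by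
  unfold shrink
  fun_prop

lemma measurable_shrinkCovariant : Measurable
    fun q : (ℝ × ℝ) × EuclideanSpace ℂ (Fin m) × EuclideanSpace ℂ (Fin m) =>
      shrinkCovariant q.1.1 q.1.2 q.2.1 q.2.2 := by
  unfold shrinkCovariant shrinkFactorDeriv
  refine Measurable.ite (measurableSet_lt (by fun_prop) (by fun_prop)) ?_ measurable_const
  fun_prop

lemma measurable_excessDeriv : Measurable
    fun q : (ℝ × ℝ) × EuclideanSpace ℂ (Fin m) × EuclideanSpace ℂ (Fin m) =>
      excessDeriv q.1.1 q.1.2 q.2.1 q.2.2 := by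
  unfold excessDeriv
  refine Measurable.ite (measurableSet_lt (by fun_prop) (by fun_prop)) ?_ measurable_const
  fun_prop

end Measurability

/-! ### The forms as single integrals -/

section FormIntegrals

variable {d m : ℕ}

lemma HasWeakGradient.isWeakDeriv {f : EuclideanSpace ℝ (Fin d) → ℂ} (h : HasWeakGradient f)
    (k : Fin d) : IsWeakDeriv volume (EuclideanSpace.single k 1) f (fun x => weakGradient f x k) :=
  (isWeakGradient_iff h.isWeakGradient.locallyIntegrable).1 h.isWeakGradient k

lemma hasWeakGradient_of_isWeakDeriv {f : EuclideanSpace ℝ (Fin d) → ℂ}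
    {Q : Fin d → EuclideanSpace ℝ (Fin d) → ℂ} (hf : MemLp f 2 volume)
    (hQ : ∀ k, MemLp (Q k) 2 volume)
    (h : ∀ k, IsWeakDeriv volume (EuclideanSpace.single k 1) f (Q k)) :
    HasWeakGradient f ∧ MemLp (weakGradient f) 2 volume ∧
      ∀ k, (fun x => weakGradient f x k) =ᵐ[volume] Q k := by
  have h1 : HasWeakGradient f := ⟨fun x => WithLp.toLp 2 fun k => Q k x,
    (isWeakGradient_iff (hf.locallyIntegrable (by norm_num))).2 h⟩
  have h2 : ∀ k, (fun x => weakGradient f x k) =ᵐ[volume] Q k := fun k =>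
    (h1.isWeakDeriv k).ae_unique (h k)
  exact ⟨h1, MemLp.of_eval_piLp fun k => (hQ k).ae_eq (h2 k).symm, h2⟩

open scoped ComplexOrder in
lemma magneticForm_eq_integral {a : EuclideanSpace ℝ (Fin d) → EuclideanSpace ℝ (Fin d)}
    {V : EuclideanSpace ℝ (Fin d) → Matrix (Fin m) (Fin m) ℝ}
    (hV : ∀ᵐ x, (complexify (V x)).PosSemidef) {u v : L2Vec d m}
    (hu : u ∈ magneticFormDomain a V) (hv : v ∈ magneticFormDomain a V) :
    Integrable (fun x => (∑ k, inner ℂ (covariantDeriv a v k x) (covariantDeriv a u k x))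
      + inner ℂ (v x) (Matrix.toEuclideanLin (complexify (V x)) (u x))) volume ∧
    magneticForm a V u v
      = ∫ x, ((∑ k, inner ℂ (covariantDeriv a v k x) (covariantDeriv a u k x))
        + inner ℂ (v x) (Matrix.toEuclideanLin (complexify (V x)) (u x))) := by
  have i1 : ∀ i, Integrable (fun x => inner ℂ (magneticGradient a (fun y => v y i) x)
      (magneticGradient a (fun y => u y i) x)) volume := fun i =>
    (hv.1 i).2.integrable_inner_two (hu.1 i).2
  have i2 : Integrable (fun x => inner ℂ (v x)
      (Matrix.toEuclideanLin (complexify (V x)) (u x))) volume := by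
    refine (hv.2.integrable_inner_two hu.2).congr ?_
    filter_upwards [hV] with x hx
    exact inner_matrixSqrt hx _ _
  simp only [← sum_inner_magneticGradient]
  refine ⟨(integrable_finsetSum _ fun i _ => i1 i).add i2, ?_⟩
  rw [integral_add (integrable_finsetSum _ fun i _ => i1 i) i2,
    integral_finsetSum _ fun i _ => i1 i, magneticForm]

lemma scalarForm_eq_integral {w : EuclideanSpace ℝ (Fin d) → ℝ} (hw : ∀ᵐ x, 0 ≤ w x)
    {u v : L2Scalar d} (hu : u ∈ scalarFormDomain w) (hv : v ∈ scalarFormDomain w) :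
    Integrable (fun x => (∑ k, inner ℂ (weakGradient v x k) (weakGradient u x k))
      + (w x : ℂ) * u x * (starRingEnd ℂ) (v x)) volume ∧
    scalarForm w u v = ∫ x, ((∑ k, inner ℂ (weakGradient v x k) (weakGradient u x k))
      + (w x : ℂ) * u x * (starRingEnd ℂ) (v x)) := by
  have i1 : Integrable (fun x => inner ℂ (weakGradient v x) (weakGradient u x)) volume :=
    hv.2.1.integrable_inner_two hu.2.1
  have i2 : Integrable (fun x => (w x : ℂ) * u x * (starRingEnd ℂ) (v x)) volume := by
    refine (hv.2.2.integrable_inner_two hu.2.2).congr ?_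
    filter_upwards [hw] with x hx
    rw [RCLike.inner_apply, map_mul, Complex.conj_ofReal]
    nth_rw 3 [← Real.mul_self_sqrt hx]
    push_cast
    ring
  simp only [← PiLp.inner_apply]
  exact ⟨i1.add i2, by rw [integral_add i1 i2, scalarForm]⟩

end FormIntegrals

/-! ### Test functions and the form inequality -/

section Domination

variable {d m : ℕ} {a : EuclideanSpace ℝ (Fin d) → EuclideanSpace ℝ (Fin d)}
  {V : EuclideanSpace ℝ (Fin d) → Matrix (Fin m) (Fin m) ℝ}

lemma norm_shrink_le {r : ℝ} (hr : 0 ≤ r) (z : EuclideanSpace ℂ (Fin m)) :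
    ‖shrink r z‖ ≤ ‖z‖ := by
  rw [norm_shrink hr]
  exact max_le (by linarith) (norm_nonneg _)

/-- The test function `(‖u‖ - h)⁺ u / ‖u‖` of the proof of domination. -/
lemma exists_shrink_mem_magneticFormDomain (hVm : ∀ i j, AEMeasurable (fun x => V x i j) volume)
    (hVsymm : ∀ᵐ x, (V x).IsSymm) {u : L2Vec d m} (hu : u ∈ magneticFormDomain a V)
    {r : EuclideanSpace ℝ (Fin d) → ℝ} {r' : Fin d → EuclideanSpace ℝ (Fin d) → ℝ}
    (hr0 : ∀ x, 0 ≤ r x) (hr : AEMeasurable r volume) (hr' : ∀ k, MemLp (r' k) 2 volume)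
    (hrr' : ∀ k, IsWeakDeriv volume (EuclideanSpace.single k 1) r (r' k)) :
    ∃ v ∈ magneticFormDomain a V, (v =ᵐ[volume] fun x => shrink (r x) (u x)) ∧
      ∀ k, covariantDeriv a v k =ᵐ[volume] fun x =>
        shrinkCovariant (r x) (r' k x) (u x) (covariantDeriv a u k x) := by
  have hum : AEMeasurable u volume := (Lp.aestronglyMeasurable u).aemeasurable
  have h0 : MemLp (fun x => shrink (r x) (u x)) 2 volume :=
    (Lp.memLp u).mono (measurable_shrink.comp_aemeasurable (hr.prodMk hum)).aestronglyMeasurable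
      (Eventually.of_forall fun x => norm_shrink_le (hr0 x) _)
  have hp := memLp_covariantDeriv hu.1
  have hQ : ∀ k, MemLp (fun x => shrinkCovariant (r x) (r' k x) (u x) (covariantDeriv a u k x)) 2
      volume := fun k => by
    refine MemLp.mono' (((hp k).norm.const_mul 2).add (hr' k).norm)
      (measurable_shrinkCovariant.comp_aemeasurable ((hr.prodMk
        (hr' k).aestronglyMeasurable.aemeasurable).prodMk
          (hum.prodMk (hp k).aestronglyMeasurable.aemeasurable))).aestronglyMeasurable
      (Eventually.of_forall fun x => norm_shrinkCovariant_le (hr0 x) _ _)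
  have hwd : ∀ k, IsWeakDeriv volume (EuclideanSpace.single k 1) (h0.toLp _)
      (fun x => shrinkCovariant (r x) (r' k x) (u x) (covariantDeriv a u k x)
        + (Complex.I * (a x k : ℂ)) • (h0.toLp _) x) := fun k => by
    refine ((isWeakDeriv_covariantDeriv hu.1 k).shrink (hrr' k) hr0).congr h0.coeFn_toLp.symm ?_
    filter_upwards [h0.coeFn_toLp] with x hx
    rw [shrinkCovariant_add, hx]
  obtain ⟨h1, h2⟩ := hasL2MagneticGradient_of_covariantDeriv (Lp.memLp _) hQ hwd
  refine ⟨h0.toLp _, ⟨h1, ?_⟩, h0.coeFn_toLp, h2⟩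
  -- The test function is u times a real factor in [0, 1], which commutes with V^{1/2}.
  refine hu.2.mono (aestronglyMeasurable_matrixSqrt hVm hVsymm (Lp.aestronglyMeasurable _)) ?_
  filter_upwards [h0.coeFn_toLp] with x hx
  rw [hx, shrink, LinearMap.map_smul_of_tower, norm_smul]
  refine mul_le_of_le_one_left (norm_nonneg _) ?_
  rw [Real.norm_of_nonneg (div_nonneg (le_max_right _ _) (norm_nonneg _))]
  exact div_le_one_of_le₀ (max_le (by linarith [hr0 x]) (norm_nonneg _)) (norm_nonneg _)

/-- The test function `(‖u‖ - h)⁺` of the proof of domination. -/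
lemma exists_excess_mem_scalarFormDomain (hm : 1 ≤ m)
    (hVm : ∀ i j, AEMeasurable (fun x => V x i j) volume)
    (hVsymm : ∀ᵐ x, (V x).IsSymm) (hVnonneg : ∀ᵐ x, 0 ≤ smallestEigenvalue (V x))
    {u : L2Vec d m} (hu : u ∈ magneticFormDomain a V)
    {r : EuclideanSpace ℝ (Fin d) → ℝ} {r' : Fin d → EuclideanSpace ℝ (Fin d) → ℝ}
    (hr0 : ∀ x, 0 ≤ r x) (hr : AEMeasurable r volume) (hr' : ∀ k, MemLp (r' k) 2 volume)
    (hrr' : ∀ k, IsWeakDeriv volume (EuclideanSpace.single k 1) r (r' k)) :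
    ∃ φ ∈ scalarFormDomain fun x => smallestEigenvalue (V x),
      (φ =ᵐ[volume] fun x => ((max (‖u x‖ - r x) 0 : ℝ) : ℂ)) ∧
      ∀ k, (fun x => weakGradient φ x k) =ᵐ[volume] fun x =>
        ((excessDeriv (r x) (r' k x) (u x) (covariantDeriv a u k x) : ℝ) : ℂ) := by
  have hum : AEMeasurable u volume := (Lp.aestronglyMeasurable u).aemeasurable
  have hle : ∀ x, max (‖u x‖ - r x) 0 ≤ ‖u x‖ := fun x =>
    max_le (by linarith [hr0 x]) (norm_nonneg _)
  have h0 : MemLp (fun x => ((max (‖u x‖ - r x) 0 : ℝ) : ℂ)) 2 volume := by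
    refine (MemLp.mono (Lp.memLp u)
      ((hum.norm.sub hr).max aemeasurable_const).aestronglyMeasurable
      (Eventually.of_forall fun x => ?_)).ofReal
    rw [Real.norm_of_nonneg (le_max_right _ _)]
    exact hle x
  have hp := memLp_covariantDeriv hu.1
  have hQ : ∀ k, MemLp (fun x =>
      ((excessDeriv (r x) (r' k x) (u x) (covariantDeriv a u k x) : ℝ) : ℂ)) 2 volume :=
    fun k => by
    refine (MemLp.mono' ((hp k).norm.add (hr' k).norm)
      (measurable_excessDeriv.comp_aemeasurable ((hr.prodMk
        (hr' k).aestronglyMeasurable.aemeasurable).prodMk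
          (hum.prodMk (hp k).aestronglyMeasurable.aemeasurable))).aestronglyMeasurable
      (Eventually.of_forall fun x => abs_excessDeriv_le _ _ _ _)).ofReal
  have hwd : ∀ k, IsWeakDeriv volume (EuclideanSpace.single k 1) (h0.toLp _)
      (fun x => ((excessDeriv (r x) (r' k x) (u x) (covariantDeriv a u k x) : ℝ) : ℂ)) :=
    fun k => by
    refine ((((isWeakDeriv_covariantDeriv hu.1 k).norm.sub (hrr' k)).posPart).clm_comp
      Complex.ofRealCLM).congr h0.coeFn_toLp.symm (Eventually.of_forall fun x => ?_)
    simp only [Complex.ofRealCLM_apply, excessDeriv, inner_add_right,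
      real_inner_I_mul_smul_self, add_zero]
  obtain ⟨h1, h2, h3⟩ := hasWeakGradient_of_isWeakDeriv (Lp.memLp _) hQ hwd
  refine ⟨h0.toLp _, ⟨h1, h2, ?_⟩, h0.coeFn_toLp, h3⟩
  have hsm : AEStronglyMeasurable (fun x => ((√(smallestEigenvalue (V x)) : ℝ) : ℂ)) volume :=
    (Complex.continuous_ofReal.comp Real.continuous_sqrt).comp_aestronglyMeasurable
      (aemeasurable_smallestEigenvalue hm hVm hVsymm).aestronglyMeasurable
  -- √λ_V (‖u‖ - r)⁺ ≤ √λ_V ‖u‖ ≤ ‖V^{1/2}u‖.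
  refine hu.2.mono (hsm.mul (Lp.aestronglyMeasurable _)) ?_
  filter_upwards [h0.coeFn_toLp, hVsymm, hVnonneg] with x hx h4 h5
  rw [hx, norm_mul, Complex.norm_real, Complex.norm_real,
    Real.norm_of_nonneg (Real.sqrt_nonneg _), Real.norm_of_nonneg (le_max_right _ _)]
  refine (mul_le_mul_of_nonneg_left (hle x) (Real.sqrt_nonneg _)).trans
    (le_of_sq_le_sq ?_ (norm_nonneg _))
  rw [norm_matrixSqrt_sq (posSemidef_complexify hm h4 h5), mul_pow, Real.sq_sqrt h5]
  exact smallestEigenvalue_mul_le hm h4 _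

open scoped ComplexOrder in
/-- The form inequality behind the domination of the magnetic Schrödinger semigroup. -/
theorem exists_test_functions (hm : 1 ≤ m)
    (hVm : ∀ i j, AEMeasurable (fun x => V x i j) volume)
    (hVsymm : ∀ᵐ x, (V x).IsSymm) (hVnonneg : ∀ᵐ x, 0 ≤ smallestEigenvalue (V x))
    {u : L2Vec d m} (hu : u ∈ magneticFormDomain a V) {h : L2Scalar d}
    (hh : h ∈ scalarFormDomain fun x => smallestEigenvalue (V x))
    (hpos : ∀ᵐ x, h x = ((‖h x‖ : ℝ) : ℂ)) :
    ∃ v ∈ magneticFormDomain a V, ∃ φ ∈ scalarFormDomain fun x => smallestEigenvalue (V x),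
      (v =ᵐ[volume] fun x => shrink ‖h x‖ (u x)) ∧
      (φ =ᵐ[volume] fun x => ((max (‖u x‖ - ‖h x‖) 0 : ℝ) : ℂ)) ∧
      (scalarForm (fun x => smallestEigenvalue (V x)) h φ).re ≤ (magneticForm a V u v).re := by
  have hps : ∀ᵐ x, (complexify (V x)).PosSemidef := by
    filter_upwards [hVsymm, hVnonneg] with x h1 h2 using posSemidef_complexify hm h1 h2
  have hr' : ∀ k, MemLp (fun x => (weakGradient h x k).re) 2 volume := fun k =>
    (hh.2.1.eval_piLp k).re
  have hrr' : ∀ k, IsWeakDeriv volume (EuclideanSpace.single k 1) (fun x => ‖h x‖)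
      (fun x => (weakGradient h x k).re) := fun k => by
    refine ((hh.1.isWeakDeriv k).clm_comp Complex.reCLM).congr ?_ EventuallyEq.rfl
    filter_upwards [hpos] with x hx
    rw [Complex.reCLM_apply]
    conv_lhs => rw [hx]
    rw [Complex.ofReal_re]
  -- The imaginary part of `h` vanishes a.e., hence so does its weak derivative.
  have him : ∀ᵐ x, ∀ k, weakGradient h x k = (((weakGradient h x k).re : ℝ) : ℂ) := by
    refine ae_all_iff.2 fun k => ?_
    filter_upwards [((hh.1.isWeakDeriv k).clm_comp Complex.imCLM).ae_eq_zero_of_eq_zero, hpos]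
      with x h1 h2
    refine Complex.ext rfl ?_
    rw [Complex.ofReal_im]
    refine h1 ?_
    rw [h2, Complex.imCLM_apply, Complex.ofReal_im]
  have hrm : AEMeasurable (fun x => ‖h x‖) volume := (Lp.aestronglyMeasurable h).norm.aemeasurable
  obtain ⟨v, hv, hv0, hvk⟩ := exists_shrink_mem_magneticFormDomain hVm hVsymm hu
    (fun x => norm_nonneg (h x)) hrm hr' hrr'
  obtain ⟨φ, hφ, hφ0, hφk⟩ := exists_excess_mem_scalarFormDomain hm hVm hVsymm hVnonneg hu
    (fun x => norm_nonneg (h x)) hrm hr' hrr'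
  refine ⟨v, hv, φ, hφ, hv0, hφ0, ?_⟩
  obtain ⟨i1, e1⟩ := magneticForm_eq_integral hps hu hv
  obtain ⟨i2, e2⟩ := scalarForm_eq_integral hVnonneg hh hφ
  rw [e1, e2]
  refine (integral_re i2).symm.trans_le (le_trans (integral_mono_ae i2.re i1.re ?_)
    (integral_re i1).le)
  filter_upwards [hv0, hφ0, ae_all_iff.2 hvk, ae_all_iff.2 hφk, him, hpos, hVsymm, hVnonneg]
    with x h1 h2 h3 h4 h5 h6 h7 h8
  simp only [RCLike.re_eq_complex_re, Complex.add_re, Complex.re_sum]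
  refine add_le_add (Finset.sum_le_sum fun k _ => ?_) ?_
  · rw [h3 k, h4 k, h5 k, RCLike.inner_apply, Complex.conj_ofReal, ← Complex.ofReal_mul,
      Complex.ofReal_re, mul_comm, Complex.ofReal_re]
    exact mul_excessDeriv_le (norm_nonneg _) _ _
  · have h9 := smallestEigenvalue_mul_le hm h7 (u x)
    rw [h1, h2, h6, Complex.conj_ofReal, ← Complex.ofReal_mul, ← Complex.ofReal_mul,
      Complex.ofReal_re, Complex.norm_real, norm_norm, ← real_inner_euclidean_eq_re]
    rw [← real_inner_euclidean_eq_re] at h9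
    rcases le_or_gt ‖u x‖ ‖h x‖ with hle | hlt
    · rw [shrink_of_le hle, max_eq_right (sub_nonpos.2 hle), inner_zero_left, mul_zero]
    · have h0 : 0 < ‖u x‖ := (norm_nonneg _).trans_lt hlt
      rw [shrink_of_lt hlt, max_eq_left (sub_pos.2 hlt).le, real_inner_smul_left]
      -- Since λ_V ≥ 0 and ‖h‖ < ‖u‖, one factor ‖h‖ may be raised to ‖u‖, and then λ_V‖u‖² is
      -- compared with ⟨Vu, u⟩.
      calc smallestEigenvalue (V x) * ‖h x‖ * (‖u x‖ - ‖h x‖)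
          ≤ smallestEigenvalue (V x) * ‖u x‖ * (‖u x‖ - ‖h x‖) := by
            gcongr
        _ = (‖u x‖ - ‖h x‖) / ‖u x‖ * (smallestEigenvalue (V x) * ‖u x‖ ^ 2) := by
            field_simp
        _ ≤ _ := mul_le_mul_of_nonneg_left h9 (div_nonneg (sub_pos.2 hlt).le h0.le)

end Domination

/-! ### Domination in L² and its stability under limits -/

section L2

variable {X : Type*} [MeasurableSpace X] {μ : Measure X}
  {E : Type*} [NormedAddCommGroup E] [InnerProductSpace ℂ E]

lemma L2.re_inner_eq_integral (f g : Lp E 2 μ) :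
    (inner ℂ f g).re = ∫ x, (inner ℂ (f x) (g x)).re ∂μ := by
  rw [L2.inner_def]
  exact (integral_re (L2.integrable_inner (𝕜 := ℂ) f g)).symm

/-- The common end of both comparison arguments: 0 ≤ ∫ F ≤ -∫ ‖f‖². -/
lemma L2.ae_eq_zero_of_integral_nonneg {f : Lp E 2 μ} {F : X → ℝ} (hF : Integrable F μ)
    (hle : ∀ᵐ x ∂μ, F x ≤ -‖f x‖ ^ 2) (h0 : 0 ≤ ∫ x, F x ∂μ) : ∀ᵐ x ∂μ, f x = 0 := by
  have i1 : Integrable (fun x => ‖f x‖ ^ 2) μ := (Lp.memLp f).integrable_norm_pow (by norm_num)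
  have h1 := integral_mono_ae hF i1.neg hle
  simp only [Pi.neg_apply, integral_neg] at h1
  have h2 : ∫ x, ‖f x‖ ^ 2 ∂μ = 0 := le_antisymm (by linarith)
    (integral_nonneg fun x => by positivity)
  filter_upwards [(integral_eq_zero_iff_of_nonneg (fun x => by positivity) i1).1 h2] with x hx
  simpa using hx

/-- The function `g` is real and dominates `‖f‖` almost everywhere. -/
def IsDominatedBy (f : Lp E 2 μ) (g : Lp ℂ 2 μ) : Prop :=
  ∀ᵐ x ∂μ, (g x).im = 0 ∧ ‖f x‖ ≤ (g x).re

/-- Along a common subsequence both sequences converge a.e., and the two pointwise conditions are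
closed. -/
lemma IsDominatedBy.of_tendsto {f : ℕ → Lp E 2 μ} {g : ℕ → Lp ℂ 2 μ} {f₀ : Lp E 2 μ}
    {g₀ : Lp ℂ 2 μ} (h : ∀ n, IsDominatedBy (f n) (g n)) (hf : Tendsto f atTop (𝓝 f₀))
    (hg : Tendsto g atTop (𝓝 g₀)) : IsDominatedBy f₀ g₀ := by
  obtain ⟨n₁, hn₁, h1⟩ := (tendstoInMeasure_of_tendsto_Lp hf).exists_seq_tendsto_ae
  obtain ⟨n₂, hn₂, h2⟩ := (tendstoInMeasure_of_tendsto_Lp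
    (hg.comp hn₁.tendsto_atTop)).exists_seq_tendsto_ae
  filter_upwards [h1, h2, ae_all_iff.2 h] with x h3 h4 h5
  have h6 := h3.comp hn₂.tendsto_atTop
  exact ⟨tendsto_nhds_unique ((Complex.continuous_im.tendsto _).comp h4)
      (tendsto_const_nhds.congr fun j => (h5 _).1.symm),
    le_of_tendsto_of_tendsto' h6.norm ((Complex.continuous_re.tendsto _).comp h4)
      fun j => (h5 _).2⟩

end L2

lemma IsFormOperatorValue.re_form_eq {E : Type*} [NormedAddCommGroup E] [InnerProductSpace ℂ E]
    {D : Set E} {q : E → E → ℂ} {u y v : E} {c : ℝ} (h : IsFormOperatorValue D q u (c • y))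
    (hv : v ∈ D) : (q u v).re = c * (inner ℂ v y).re := by
  rw [h.2 v hv, ← Complex.coe_smul, inner_smul_right, Complex.re_ofReal_mul]

/-! ### Positivity of the scalar resolvent -/

section Positivity

variable {d : ℕ} {w : EuclideanSpace ℝ (Fin d) → ℝ}

/-- The test function `h - (Re h)⁺`. -/
lemma exists_sub_posPart_mem_scalarFormDomain (hw : AEMeasurable w volume) {h : L2Scalar d}
    (hh : h ∈ scalarFormDomain w) :
    ∃ v ∈ scalarFormDomain w, (v =ᵐ[volume] fun x => h x - ((max (h x).re 0 : ℝ) : ℂ)) ∧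
      ∀ k, (fun x => weakGradient v x k) =ᵐ[volume] fun x => weakGradient h x k
        - ((if 0 < (h x).re then (weakGradient h x k).re else 0 : ℝ) : ℂ) := by
  have hle : ∀ z : ℂ, ‖z - ((max z.re 0 : ℝ) : ℂ)‖ ≤ ‖z‖ := fun z => by
    refine le_of_sq_le_sq ?_ (norm_nonneg _)
    rw [← Complex.normSq_eq_norm_sq, ← Complex.normSq_eq_norm_sq, Complex.normSq_apply,
      Complex.normSq_apply, Complex.sub_re, Complex.sub_im, Complex.ofReal_re, Complex.ofReal_im]
    rcases le_total z.re 0 with h0 | h0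
    · rw [max_eq_right h0]; simp
    · rw [max_eq_left h0]; nlinarith [mul_self_nonneg z.re]
  have hm : AEStronglyMeasurable h volume := Lp.aestronglyMeasurable h
  have h0 : MemLp (fun x => h x - ((max (h x).re 0 : ℝ) : ℂ)) 2 volume :=
    (Lp.memLp h).mono (hm.sub (Complex.continuous_ofReal.comp_aestronglyMeasurable
      ((Complex.measurable_re.comp_aemeasurable hm.aemeasurable).max
        aemeasurable_const).aestronglyMeasurable)) (Eventually.of_forall fun x => hle _)
  have hwd : ∀ k, IsWeakDeriv volume (EuclideanSpace.single k 1)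
      (fun x => ((max (h x).re 0 : ℝ) : ℂ))
      (fun x => ((if 0 < (h x).re then (weakGradient h x k).re else 0 : ℝ) : ℂ)) := fun k =>
    (((hh.1.isWeakDeriv k).clm_comp Complex.reCLM).posPart).clm_comp Complex.ofRealCLM
  have hk : ∀ k, MemLp (fun x => weakGradient h x k) 2 volume := fun k => hh.2.1.eval_piLp k
  have hQ : ∀ k, MemLp (fun x => weakGradient h x k
      - ((if 0 < (h x).re then (weakGradient h x k).re else 0 : ℝ) : ℂ)) 2 volume := fun k => by
    refine (hk k).sub ((hk k).mono (hwd k).locallyIntegrable_deriv.aestronglyMeasurable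
      (Eventually.of_forall fun x => ?_))
    rw [Complex.norm_real, Real.norm_eq_abs]
    split_ifs
    · exact Complex.abs_re_le_norm _
    · rw [abs_zero]; exact norm_nonneg _
  obtain ⟨h1, h2, h3⟩ := hasWeakGradient_of_isWeakDeriv (Lp.memLp (h0.toLp _)) hQ fun k =>
    ((hh.1.isWeakDeriv k).sub (hwd k)).congr h0.coeFn_toLp.symm EventuallyEq.rfl
  refine ⟨h0.toLp _, ⟨h1, h2, ?_⟩, h0.coeFn_toLp, h3⟩
  have hsm : AEStronglyMeasurable (fun x => ((√(w x) : ℝ) : ℂ)) volume :=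
    (Complex.continuous_ofReal.comp Real.continuous_sqrt).comp_aestronglyMeasurable
      hw.aestronglyMeasurable
  refine hh.2.2.mono (hsm.mul (Lp.aestronglyMeasurable _)) ?_
  filter_upwards [h0.coeFn_toLp] with x hx
  rw [hx, norm_mul, norm_mul]
  exact mul_le_mul_of_nonneg_left (hle _) (norm_nonneg _)

/-- The resolvent of the scalar Schrödinger operator preserves positivity. -/
theorem ae_eq_norm_of_isFormOperatorValue (hw : AEMeasurable w volume) (hw0 : ∀ᵐ x, 0 ≤ w x)
    {s : ℝ} (hs : 0 < s) {g h : L2Scalar d}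
    (hh : IsFormOperatorValue (scalarFormDomain w) (scalarForm w) h (s⁻¹ • (g - h)))
    (hg : ∀ᵐ x, (g x).im = 0 ∧ 0 ≤ (g x).re) : ∀ᵐ x, h x = ((‖h x‖ : ℝ) : ℂ) := by
  obtain ⟨v, hv, hv0, hvk⟩ := exists_sub_posPart_mem_scalarFormDomain hw hh.1
  have h1 : 0 ≤ (scalarForm w h v).re := by
    obtain ⟨i1, e1⟩ := scalarForm_eq_integral hw0 hh.1 hv
    rw [e1]
    refine le_of_le_of_eq (integral_nonneg_of_ae ?_) (integral_re i1)
    filter_upwards [hv0, ae_all_iff.2 hvk, hw0] with x h2 h3 h4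
    simp only [RCLike.re_eq_complex_re, Complex.add_re, Complex.re_sum, Pi.zero_apply]
    refine add_nonneg (Finset.sum_nonneg fun k _ => ?_) ?_
    -- The gradient term is (Im ∂_k h)² where Re h > 0, and |∂_k h|² elsewhere.
    · rw [h3 k, RCLike.inner_apply]
      simp only [Complex.mul_re, map_sub, Complex.conj_ofReal, Complex.sub_re, Complex.sub_im,
        Complex.conj_re, Complex.conj_im, Complex.ofReal_re, Complex.ofReal_im]
      split_ifs <;> nlinarith [mul_self_nonneg (weakGradient h x k).re,
        mul_self_nonneg (weakGradient h x k).im]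
    · rw [h2, mul_assoc, Complex.re_ofReal_mul]
      refine mul_nonneg h4 ?_
      simp only [Complex.mul_re, map_sub, Complex.conj_ofReal, Complex.sub_re, Complex.sub_im,
        Complex.conj_re, Complex.conj_im, Complex.ofReal_re, Complex.ofReal_im]
      rcases le_total (h x).re 0 with h5 | h5
      · rw [max_eq_right h5]
        nlinarith [mul_self_nonneg (h x).re, mul_self_nonneg (h x).im]
      · rw [max_eq_left h5]
        nlinarith [mul_self_nonneg (h x).im]
  rw [hh.re_form_eq hv, L2.re_inner_eq_integral] at h1
  -- Pointwise Re⟨v, g - h⟩ ≤ -|v|², because Re v ≤ 0 ≤ g and Re v · (Re h)⁺ = 0. Hence v = 0, that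
  -- is, h = (Re h)⁺.
  have h6 := L2.ae_eq_zero_of_integral_nonneg (f := v) (L2.integrable_inner (𝕜 := ℂ) v (g - h)).re ?_
    (nonneg_of_mul_nonneg_right h1 (inv_pos.2 hs))
  · filter_upwards [h6, hv0] with x h7 h8
    rw [h7, eq_comm, sub_eq_zero] at h8
    rw [h8, Complex.norm_real, Real.norm_of_nonneg (le_max_right _ _)]
  · filter_upwards [hv0, hg, Lp.coeFn_sub g h] with x h2 h3 h4
    rw [h4, Pi.sub_apply, h2, RCLike.inner_apply, ← Complex.normSq_eq_norm_sq,
      Complex.normSq_apply]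
    simp only [RCLike.re_eq_complex_re, Complex.mul_re, map_sub, Complex.conj_ofReal,
      Complex.sub_re, Complex.sub_im, Complex.conj_re, Complex.conj_im, Complex.ofReal_re,
      Complex.ofReal_im, h3.1]
    rcases le_total (h x).re 0 with h5 | h5
    · rw [max_eq_right h5]
      nlinarith [mul_nonneg h3.2 (neg_nonneg.2 h5)]
    · rw [max_eq_left h5]
      nlinarith

end Positivity

/-! ### Domination of resolvents and of semigroups -/

section ResolventDomination

variable {d m : ℕ} {a : EuclideanSpace ℝ (Fin d) → EuclideanSpace ℝ (Fin d)}
  {V : EuclideanSpace ℝ (Fin d) → Matrix (Fin m) (Fin m) ℝ}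

/-- The resolvent of the scalar Schrödinger operator dominates that of the magnetic one. -/
theorem isDominatedBy_of_isFormOperatorValue (hm : 1 ≤ m)
    (hVm : ∀ i j, AEMeasurable (fun x => V x i j) volume)
    (hVsymm : ∀ᵐ x, (V x).IsSymm) (hVnonneg : ∀ᵐ x, 0 ≤ smallestEigenvalue (V x))
    {s : ℝ} (hs : 0 < s) {f u : L2Vec d m} {g h : L2Scalar d}
    (hu : IsFormOperatorValue (magneticFormDomain a V) (magneticForm a V) u (s⁻¹ • (f - u)))
    (hh : IsFormOperatorValue (scalarFormDomain fun x => smallestEigenvalue (V x))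
      (scalarForm fun x => smallestEigenvalue (V x)) h (s⁻¹ • (g - h)))
    (hfg : IsDominatedBy f g) : IsDominatedBy u h := by
  have hpos := ae_eq_norm_of_isFormOperatorValue (aemeasurable_smallestEigenvalue hm hVm hVsymm)
    hVnonneg hs hh (hfg.mono fun x hx => ⟨hx.1, (norm_nonneg _).trans hx.2⟩)
  obtain ⟨v, hv, φ, hφ, hv0, hφ0, hle⟩ :=
    exists_test_functions hm hVm hVsymm hVnonneg hu.1 hh.1 hpos
  rw [hu.re_form_eq hv, hh.re_form_eq hφ] at hle
  have h1 := sub_nonneg.2 (le_of_mul_le_mul_left hle (inv_pos.2 hs))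
  have i1 : Integrable (fun x => (inner ℂ (v x) ((f - u) x)).re) volume :=
    (L2.integrable_inner (𝕜 := ℂ) v (f - u)).re
  have i2 : Integrable (fun x => (inner ℂ (φ x) ((g - h) x)).re) volume :=
    (L2.integrable_inner (𝕜 := ℂ) φ (g - h)).re
  rw [L2.re_inner_eq_integral, L2.re_inner_eq_integral, ← integral_sub i1 i2] at h1
  -- With t = (‖u‖ - h)⁺ one has Re⟨v, f⟩ ≤ t g, ⟨v, u⟩ = t‖u‖ and Re⟨φ, g - h⟩ = t(g - h), so the
  -- integrand is at most -t(‖u‖ - h) = -t².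
  have h2 := L2.ae_eq_zero_of_integral_nonneg (f := φ) (i1.sub i2) ?_ h1
  · filter_upwards [h2, hφ0, hpos] with x h3 h4 h5
    rw [h3, eq_comm, Complex.ofReal_eq_zero] at h4
    have h6 : ‖u x‖ - ‖h x‖ ≤ 0 := h4 ▸ le_max_left _ _
    rw [h5, Complex.ofReal_re, Complex.ofReal_im]
    exact ⟨rfl, by linarith⟩
  · filter_upwards [hv0, hφ0, hpos, hfg, Lp.coeFn_sub f u, Lp.coeFn_sub g h]
      with x h3 h4 h5 h6 h7 h8
    rw [Pi.sub_apply, h7, h8, Pi.sub_apply, Pi.sub_apply, ← real_inner_euclidean_eq_re,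
      inner_sub_right, h4, RCLike.inner_apply, Complex.conj_ofReal, mul_comm,
      Complex.re_ofReal_mul, Complex.sub_re, Complex.norm_real]
    have e1 : (h x).re = ‖h x‖ := by
      conv_lhs => rw [h5]
      exact Complex.ofReal_re _
    set t := max (‖u x‖ - ‖h x‖) 0 with ht
    have ht0 : 0 ≤ t := le_max_right _ _
    have e2 : inner ℝ (v x) (u x) = t * ‖u x‖ := by
      rw [h3, shrink, real_inner_smul_left, real_inner_self_eq_norm_sq, ← ht]
      rcases eq_or_ne ‖u x‖ 0 with h0 | h0
      · rw [h0]; simp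
      · field_simp
    have e3 : inner ℝ (v x) (f x) ≤ t * (g x).re := by
      refine (real_inner_le_norm _ _).trans ?_
      rw [h3, norm_shrink (norm_nonneg _)]
      exact mul_le_mul_of_nonneg_left h6.2 ht0
    have e4 : t * (‖u x‖ - ‖h x‖) = t ^ 2 := by
      rcases le_total (‖u x‖ - ‖h x‖) 0 with h0 | h0
      · rw [ht, max_eq_right h0]; ring
      · rw [ht, max_eq_left h0]; ring
    rw [e1, e2, Real.norm_of_nonneg ht0]
    nlinarith

/-- The exponential formula carries the domination over from the resolvents to the semigroups. -/
theorem isDominatedBy_resolventSemigroup (hm : 1 ≤ m)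
    (hVm : ∀ i j, AEMeasurable (fun x => V x i j) volume)
    (hVsymm : ∀ᵐ x, (V x).IsSymm) (hVnonneg : ∀ᵐ x, 0 ≤ smallestEigenvalue (V x))
    {R : L2Vec d m →L[ℂ] L2Vec d m} {R' : L2Scalar d →L[ℂ] L2Scalar d}
    (hR : IsFormResolvent (magneticFormDomain a V) (magneticForm a V) R)
    (hR' : IsFormResolvent (scalarFormDomain fun x => smallestEigenvalue (V x))
      (scalarForm fun x => smallestEigenvalue (V x)) R')
    {t : ℝ≥0} (ht : 0 < t) {f : L2Vec d m} {g : L2Scalar d} (hfg : IsDominatedBy f g) :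
    IsDominatedBy (resolventSemigroup R t f) (resolventSemigroup R' t g) := by
  refine IsDominatedBy.of_tendsto (fun n => ?_) (hR.tendsto_scaled_pow ht f)
    (hR'.tendsto_scaled_pow ht g)
  have hs : 0 < (t : ℝ) / (n + 1) := by positivity
  -- The step size must stay fixed while the exponent n + 1 runs through the induction.
  generalize (t : ℝ) / (n + 1) = s at hs
  induction n + 1 with
  | zero => simpa using hfg
  | succ k ih =>
    rw [pow_succ', pow_succ']
    exact isDominatedBy_of_isFormOperatorValue hm hVm hVsymm hVnonneg hs
      (hR.isFormOperatorValue_scaled hs _) (hR'.isFormOperatorValue_scaled hs _) ih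

end ResolventDomination

lemma isDominatedBy_pointwiseNorm {d m : ℕ} (u : L2Vec d m) :
    IsDominatedBy u (pointwiseNorm u) := by
  have h : pointwiseNorm u =ᵐ[volume] fun x => ((‖u x‖ : ℝ) : ℂ) := MemLp.coeFn_toLp _
  filter_upwards [h] with x hx
  rw [hx]
  simp

end

theorem mainTheorem1 (d m : ℕ) (hd : 1 ≤ d) (hm : 1 ≤ m)
    (a : EuclideanSpace ℝ (Fin d) → EuclideanSpace ℝ (Fin d))
    (ha : ∀ K : Set (EuclideanSpace ℝ (Fin d)), IsCompact K → MemLp a 2 (volume.restrict K))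
    (V : EuclideanSpace ℝ (Fin d) → Matrix (Fin m) (Fin m) ℝ)
    (hVsymm : ∀ᵐ x, (V x).IsSymm)
    (hVloc : ∀ i j, LocallyIntegrable (fun x => V x i j) volume)
    (hVnonneg : ∀ᵐ x, 0 ≤ smallestEigenvalue (V x)) :
    (∃! T : ℝ≥0 → L2Vec d m →L[ℂ] L2Vec d m,
      IsFormSemigroup (magneticFormDomain a V) (magneticForm a V) T) ∧
    (∃! S : ℝ≥0 → L2Scalar d →L[ℂ] L2Scalar d,
      IsFormSemigroup (scalarFormDomain fun x => smallestEigenvalue (V x))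
        (scalarForm fun x => smallestEigenvalue (V x)) S) ∧
    ∀ (T : ℝ≥0 → L2Vec d m →L[ℂ] L2Vec d m) (S : ℝ≥0 → L2Scalar d →L[ℂ] L2Scalar d),
      IsFormSemigroup (magneticFormDomain a V) (magneticForm a V) T →
      IsFormSemigroup (scalarFormDomain fun x => smallestEigenvalue (V x))
        (scalarForm fun x => smallestEigenvalue (V x)) S →
      ∀ (u : L2Vec d m) (t : ℝ≥0), ∀ᵐ x,
        (S t (pointwiseNorm u) x).im = 0 ∧ ‖T t u x‖ ≤ (S t (pointwiseNorm u) x).re := by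
  have hVm : ∀ i j, AEMeasurable (fun x => V x i j) volume := fun i j =>
    (hVloc i j).aestronglyMeasurable.aemeasurable
  have hA := isClosedForm_magneticForm ha hm hVsymm hVloc hVnonneg
  have hH := isClosedForm_scalarForm
    (locallyIntegrable_smallestEigenvalue hm hVsymm hVloc hVnonneg hVm) hVnonneg
  have := hA.isClosed.completeSpace_coe
  have := hH.isClosed.completeSpace_coe
  have hR := hA.isFormResolvent
  have hR' := hH.isFormResolvent
  refine ⟨⟨_, hR.isFormSemigroup, fun T hT => hR.isFormSemigroup_unique hT hR.isFormSemigroup⟩,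
    ⟨_, hR'.isFormSemigroup, fun S hS => hR'.isFormSemigroup_unique hS hR'.isFormSemigroup⟩,
    fun T S hT hS u t => ?_⟩
  -- The exponential formula is available for t > 0 only; at t = 0 both semigroups are the identity.
  rcases eq_or_ne t 0 with rfl | ht
  · rw [hT.isC0Semigroup.map_zero, hS.isC0Semigroup.map_zero]
    exact isDominatedBy_pointwiseNorm u
  · rw [hR.isFormSemigroup_unique hT hR.isFormSemigroup,
      hR'.isFormSemigroup_unique hS hR'.isFormSemigroup]
    exact isDominatedBy_resolventSemigroup hm hVm hVsymm hVnonneg hR hR' (pos_iff_ne_zero.2 ht)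
      (isDominatedBy_pointwiseNorm u)
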